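/- **Definitions.** Put $\mathbb R^{k,m}=[0,\infty)^k\times\mathbb R^{m-k}$, with b-vector fields $v_i=x_i\,\partial/\partial x_i$ for $i\le k$ and $v_i=\partial/\partial x_i$ for $i>k$. A function $f$ on an open $U\subseteq\mathbb R^{k,m}$ is *a-differentiable* if $f$ is continuous, $\partial f/\partial x_i$ exists at the points of $U$ with $x_i>0$ for $i\le k$ (at all points for $i>k$), each $v_if$ (set to be $0$ where $i\le k$ and $x_i=0$) is continuous on $U$, and on each compact $S\subseteq U$ we have $|v_if|\le Cx_i^{\alpha}$ for $i\le k$ and some $C,\alpha>0$; it is *a-smooth* if all iterated $v_{i_1}\cdots v_{i_n}f$, $n\ge 0$, are a-differentiable. A continuous map into $\mathbb R^{l,n}$ is a-smooth if its components with index $>l$ are a-smooth and each component with index $j\le l$ is, near each point $u$, either identically $0$ or of the form $F_j(x)\prod_{i\le k,\,u_i=0}x_i^{a_{i,j}}$ with $F_j>0$ a-smooth and $a_{i,j}\ge 0$. An $m$-dimensional *manifold with a-corners* $X$ is a second countable Hausdorff space with a maximal atlas of charts from open subsets of the $\mathbb R^{k,m}$, $0\le k\le m$, whose changes of coordinates and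 their inverses are a-smooth. The interior $X^\circ$ consists of the points where all boundary coordinates are positive, and ${}^bTX$ is the vector bundle with local bases $v_1,\dots,v_m$, so that ${}^bTX|_{X^\circ}=TX^\circ$. Vector bundles $E\to X$ (of finite rank, real) and their sections are a-smooth. A *b-metric* $g$ is an a-smooth positive definite section of $S^2({}^bT^*X)$, where ${}^bT^*X$ is the dual of ${}^bTX$; a *fibre metric* $h$ is an a-smooth positive definite section of $S^2E^*$; a *b-connection* $\nabla$ on $E$ is an $\mathbb R$-linear map from a-smooth sections of $E$ to a-smooth sections of $E\otimes{}^bT^*X$ satisfying the Leibniz rule. A *weight* $\lambda$ assigns to each a-chart and each boundary coordinate $x_i$ of it a locally constant function $\lambda_i$ on the face $x_i=0$, such that $\lambda_i=\sum_ja_{i,j}\lambda'_j$ whenever $x'_j=F_j(x)\prod_ix_i^{a_{i,j}}$ is the change of boundary coordinates. The line bundle $L_\lambda\to X$ comes with an isomorphism of $L_\lambda|_{X^\circ}$ with the trivial line bundle under which $x_1^{\lambda_1}\cdots x_k^{\lambda_k}$ is a local basis section of $L_\lambda$, in each chart where the $\lambda_i$ are constant. Let $1<p<\infty$ and let $k\ge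 0$ be an integer. Given a b-metric $g$ on $X$, a fibre metric $h$ and a b-connection $\nabla$ on $E$, use the Levi-Civita b-connection of $g$ to form $\nabla^je$, a section of $E\otimes\bigotimes^j{}^bT^*X$ over $X^\circ$, with pointwise norm $|\nabla^je|$ given by $h$ and the inverse of $g$. Then $L^p(E)$ is the space of (almost everywhere classes of) locally integrable sections $e$ of $E|_{X^\circ}$ with $\|e\|_{L^p}=\bigl(\int_{X^\circ}|e|^p\,dV_g\bigr)^{1/p}<\infty$, and $L^p_k(E)$ is the space of those locally integrable sections $e$ that are $k$ times weakly differentiable with $\|e\|_{L^p_k}=\bigl(\sum_{j=0}^k\int_{X^\circ}|\nabla^je|^p\,dV_g\bigr)^{1/p}<\infty$, both with the norm topology. For a weight $\lambda$, put $L^p(E)_\lambda=L^p(E\otimes L_\lambda)$ and $L^p_k(E)_\lambda=L^p_k(E\otimes L_\lambda)$, defined with a b-metric on $X$ and a fibre metric and b-connection on $E\otimes L_\lambda$, and regarded as spaces of sections of $E|_{X^\circ}\cong(E\otimes L_\lambda)|_{X^\circ}$. **Lemma 5.1 (independence of weighted Sobolev spaces).** Let $X$ be a compact manifold with a-corners,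 $E\to X$ a vector bundle, $\lambda$ a weight on $X$, $1<p<\infty$, and $k\ge 0$ an integer. Then each of $L^p(E)$, $L^p_k(E)$, $L^p(E)_\lambda$, $L^p_k(E)_\lambda$ is independent, as a vector space of sections of $E|_{X^\circ}$ with a topology, of the choice of b-metric, fibre metric and b-connection made in its definition. Moreover, if $\|\cdot\|$ and $\|\cdot\|'$ are the norms of one of these spaces for two such choices, then there is a constant $C>0$ with $\|e\|'\le C\|e\|$ and $\|e\|\le C\|e\|'$ for all $e$ in the space. -/

import Mathlib

open Set Filter Topology MeasureTheory
open scoped ContDiff ENNReal NNReal Matrix TensorProduct Kronecker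

noncomputable section

namespace ACorners

/-! ### A-smooth functions on open subsets of the model space -/

/-- The model `⟦0,∞)^k × ℝ^(m-k)`, as a subset of `ℝ^m`. -/
def quadrant (m k : ℕ) : Set (Fin m → ℝ) := {x | ∀ i : Fin m, (i : ℕ) < k → 0 ≤ x i}

/-- `U` is an open subset of the model space `⟦0,∞)^k × ℝ^(m-k)`. -/
def IsModelOpen {m : ℕ} (k : ℕ) (U : Set (Fin m → ℝ)) : Prop :=
  ∃ O : Set (Fin m → ℝ), IsOpen O ∧ U = O ∩ quadrant m k

/-- The factor in front of `∂/∂x_i` in the `i`-th b-vector field: it is `x_i` for the `k` boundary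
coordinates and `1` for the others. -/
def bCoef {m : ℕ} (k : ℕ) (i : Fin m) (x : Fin m → ℝ) : ℝ := if (i : ℕ) < k then x i else 1

/-- The `i`-th b-derivative: `x_i ∂f/∂x_i` (which is `0` where `x_i = 0`) for the `k` boundary
coordinates, and `∂f/∂x_i` for the others. -/
def bDeriv {m : ℕ} (k : ℕ) (i : Fin m) (f : (Fin m → ℝ) → ℝ) (x : Fin m → ℝ) : ℝ :=
  bCoef k i x * lineDeriv ℝ f x (Pi.single i 1)

/-- Iterated b-derivatives (the head of the list is applied first). -/
def iterBDeriv {m : ℕ} (k : ℕ) : List (Fin m) → ((Fin m → ℝ) → ℝ) → (Fin m → ℝ) → ℝ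
  | [], f => f
  | i :: l, f => iterBDeriv k l (bDeriv k i f)

/-- `f` is a-differentiable on the open subset `U` of the model space. -/
structure ADifferentiableOn {m : ℕ} (k : ℕ) (f : (Fin m → ℝ) → ℝ) (U : Set (Fin m → ℝ)) :
    Prop where
  continuousOn : ContinuousOn f U
  exists_deriv : ∀ x ∈ U, ∀ i : Fin m, ((i : ℕ) < k → 0 < x i) →
    LineDifferentiableAt ℝ f x (Pi.single i 1)
  continuousOn_bDeriv : ∀ i, ContinuousOn (bDeriv k i f) U
  decay : ∀ S ⊆ U, IsCompact S → ∀ i : Fin m, (i : ℕ) < k →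
    ∃ C > (0 : ℝ), ∃ α > (0 : ℝ), ∀ x ∈ S, |bDeriv k i f x| ≤ C * x i ^ α

/-- `f` is a-smooth on `U`: all its iterated b-derivatives are a-differentiable. -/
def ASmoothOn {m : ℕ} (k : ℕ) (f : (Fin m → ℝ) → ℝ) (U : Set (Fin m → ℝ)) : Prop :=
  ∀ l : List (Fin m), ADifferentiableOn k (iterBDeriv k l f) U

/-- Near `u`, on `W`, the function `f` is written as `F · x_1^(a_1) ⋯ x_k^(a_k)` with `F > 0`
a-smooth and exponents `a_i ≥ 0` which vanish unless the `i`-th coordinate is a boundary coordinate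
that is zero at `u`. -/
structure IsMonomialOn {m : ℕ} (k : ℕ) (f : (Fin m → ℝ) → ℝ) (u : Fin m → ℝ)
    (W : Set (Fin m → ℝ)) (F : (Fin m → ℝ) → ℝ) (a : Fin m → ℝ) : Prop where
  smooth : ASmoothOn k F W
  pos : ∀ x ∈ W, 0 < F x
  exp_nonneg : ∀ i, 0 ≤ a i
  exp_eq_zero : ∀ i : Fin m, ¬ ((i : ℕ) < k ∧ u i = 0) → a i = 0
  eq : ∀ x ∈ W, f x = F x * ∏ i, x i ^ a i

/-- A-smooth maps from an open subset `U` of `⟦0,∞)^k × ℝ^(m-k)` to `⟦0,∞)^l × ℝ^(n-l)`. -/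
structure ASmoothMapOn {m n : ℕ} (k l : ℕ) (f : (Fin m → ℝ) → (Fin n → ℝ))
    (U : Set (Fin m → ℝ)) : Prop where
  continuousOn : ContinuousOn f U
  mapsTo : MapsTo f U (quadrant n l)
  smooth : ∀ j : Fin n, ¬ (j : ℕ) < l → ASmoothOn k (fun x => f x j) U
  face : ∀ j : Fin n, (j : ℕ) < l → ∀ u ∈ U, ∃ V, IsOpen V ∧ u ∈ V ∧
    ((∃ F a, IsMonomialOn k (fun x => f x j) u (V ∩ U) F a) ∨ ∀ x ∈ V ∩ U, f x j = 0)

/-! #### Closure properties of a-smooth functions -/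

/-- A-smoothness up to order `n`. -/
def ASmoothUpTo {m : ℕ} (k : ℕ) : ℕ → ((Fin m → ℝ) → ℝ) → Set (Fin m → ℝ) → Prop
  | 0, f, U => ADifferentiableOn k f U
  | n + 1, f, U => ADifferentiableOn k f U ∧ ∀ i, ASmoothUpTo k n (bDeriv k i f) U

section Closure

variable {m k : ℕ} {U V : Set (Fin m → ℝ)} {f g : (Fin m → ℝ) → ℝ}

theorem ASmoothUpTo.aDiff {n : ℕ} (h : ASmoothUpTo k n f U) : ADifferentiableOn k f U := by
  cases n with
  | zero => exact h
  | succ n => exact h.1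

theorem ASmoothUpTo.pred {n : ℕ} (h : ASmoothUpTo k (n + 1) f U) : ASmoothUpTo k n f U := by
  induction n generalizing f with
  | zero => exact h.1
  | succ n ih => exact ⟨h.1, fun i => ih (h.2 i)⟩

theorem aSmoothOn_iff : ASmoothOn k f U ↔ ∀ n, ASmoothUpTo k n f U := by
  constructor
  · intro h n
    induction n generalizing f with
    | zero => exact h []
    | succ n ih => exact ⟨h [], fun i => ih fun l => h (i :: l)⟩
  · intro h l
    induction l generalizing f with
    | nil => exact h 0
    | cons i l ih => exact ih fun n => (h (n + 1)).2 i

theorem IsModelOpen.inter_open (hU : IsModelOpen k U) (hV : IsOpen V) : IsModelOpen k (V ∩ U) := by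
  obtain ⟨O, hO, rfl⟩ := hU
  exact ⟨V ∩ O, hV.inter hO, by rw [inter_assoc]⟩

theorem IsModelOpen.eventually_mem (hU : IsModelOpen k U) {x : Fin m → ℝ} (hx : x ∈ U) (i : Fin m)
    (hi : (i : ℕ) < k → 0 < x i) : ∀ᶠ t : ℝ in 𝓝 0, x + t • (Pi.single i 1 : Fin m → ℝ) ∈ U := by
  obtain ⟨O, hO, rfl⟩ := hU
  have hc : Continuous fun t : ℝ => x + t • (Pi.single i 1 : Fin m → ℝ) := by fun_prop
  have h0 : x + (0 : ℝ) • (Pi.single i 1 : Fin m → ℝ) = x := by simp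
  have h1 : ∀ᶠ t : ℝ in 𝓝 0, x + t • (Pi.single i 1 : Fin m → ℝ) ∈ O :=
    hc.continuousAt.eventually_mem (by rw [h0]; exact hO.mem_nhds hx.1)
  have h2 : ∀ᶠ t : ℝ in 𝓝 0, (i : ℕ) < k → 0 < x i + t := by
    by_cases hik : (i : ℕ) < k
    · have : ContinuousAt (fun t : ℝ => x i + t) 0 := by fun_prop
      filter_upwards [this.eventually (lt_mem_nhds (a := 0) (by simpa using hi hik))] with t ht _
      exact ht
    · exact Eventually.of_forall fun t h => absurd h hik
  filter_upwards [h1, h2] with t ht1 ht2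
  refine ⟨ht1, fun j hj => ?_⟩
  by_cases hji : j = i
  · subst hji
    simpa using (ht2 hj).le
  · simpa [Pi.single_apply, hji] using hx.2 j hj

theorem IsModelOpen.nonneg (hU : IsModelOpen k U) {x : Fin m → ℝ} (hx : x ∈ U) {i : Fin m}
    (hi : (i : ℕ) < k) : 0 ≤ x i := by
  obtain ⟨O, hO, rfl⟩ := hU
  exact hx.2 i hi

/-- Either the `i`-th b-vector field vanishes at `x`, or one can move freely in the direction `i`. -/
theorem bCoef_cases (hU : IsModelOpen k U) {x : Fin m → ℝ} (hx : x ∈ U) (i : Fin m) :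
    bCoef k i x = 0 ∨ ((i : ℕ) < k → 0 < x i) := by
  by_cases hik : (i : ℕ) < k
  · rcases (hU.nonneg hx hik).eq_or_lt with h | h
    · left; simp [bCoef, hik, ← h]
    · right; exact fun _ => h
  · right; exact fun h => absurd h hik

theorem bDeriv_eq (hU : IsModelOpen k U) {x : Fin m → ℝ} (hx : x ∈ U) (i : Fin m) {a : ℝ}
    (h : ((i : ℕ) < k → 0 < x i) → HasLineDerivAt ℝ f a x (Pi.single i 1)) :
    bDeriv k i f x = bCoef k i x * a := by
  rcases bCoef_cases hU hx i with h0 | h0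
  · simp [bDeriv, h0]
  · rw [bDeriv, (h h0).lineDeriv]

theorem hasLineDerivAt_congr (hU : IsModelOpen k U) (hfg : EqOn f g U) {x : Fin m → ℝ} (hx : x ∈ U)
    (i : Fin m) (hi : (i : ℕ) < k → 0 < x i) {a : ℝ} (h : HasLineDerivAt ℝ f a x (Pi.single i 1)) :
    HasLineDerivAt ℝ g a x (Pi.single i 1) := by
  refine HasDerivAt.congr_of_eventuallyEq h ?_
  filter_upwards [hU.eventually_mem hx i hi] with t ht using (hfg ht).symm

theorem bDeriv_congr (hU : IsModelOpen k U) (hfg : EqOn f g U) (i : Fin m) :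
    EqOn (bDeriv k i f) (bDeriv k i g) U := by
  intro x hx
  rcases bCoef_cases hU hx i with h0 | h0
  · simp [bDeriv, h0]
  · have : lineDeriv ℝ f x (Pi.single i 1) = lineDeriv ℝ g x (Pi.single i 1) := by
      unfold lineDeriv
      refine Filter.EventuallyEq.deriv_eq ?_
      filter_upwards [hU.eventually_mem hx i h0] with t ht using hfg ht
    rw [bDeriv, bDeriv, this]

theorem ADifferentiableOn.congr (hU : IsModelOpen k U) (hf : ADifferentiableOn k f U)
    (hfg : EqOn f g U) : ADifferentiableOn k g U where
  continuousOn := hf.continuousOn.congr hfg.symm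
  exists_deriv x hx i hi :=
    (hasLineDerivAt_congr hU hfg hx i hi (hf.exists_deriv x hx i hi).hasLineDerivAt
      ).lineDifferentiableAt
  continuousOn_bDeriv i := (hf.continuousOn_bDeriv i).congr (bDeriv_congr hU hfg i).symm
  decay S hS hSc i hi := by
    obtain ⟨C, hC, α, hα, h⟩ := hf.decay S hS hSc i hi
    exact ⟨C, hC, α, hα, fun x hx => by rw [← bDeriv_congr hU hfg i (hS hx)]; exact h x hx⟩

theorem ASmoothUpTo.congr (hU : IsModelOpen k U) {n : ℕ} (hf : ASmoothUpTo k n f U)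
    (hfg : EqOn f g U) : ASmoothUpTo k n g U := by
  induction n generalizing f g with
  | zero => exact ADifferentiableOn.congr hU hf hfg
  | succ n ih => exact ⟨hf.1.congr hU hfg, fun i => ih (hf.2 i) (bDeriv_congr hU hfg i)⟩

theorem ADifferentiableOn.mono (hf : ADifferentiableOn k f U) (h : V ⊆ U) :
    ADifferentiableOn k f V where
  continuousOn := hf.continuousOn.mono h
  exists_deriv x hx i hi := hf.exists_deriv x (h hx) i hi
  continuousOn_bDeriv i := (hf.continuousOn_bDeriv i).mono h
  decay S hS hSc i hi := hf.decay S (hS.trans h) hSc i hi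

theorem ASmoothOn.mono (hf : ASmoothOn k f U) (h : V ⊆ U) : ASmoothOn k f V :=
  fun l => (hf l).mono h

theorem ASmoothOn.congr (hU : IsModelOpen k U) (hf : ASmoothOn k f U)
    (hfg : EqOn f g U) : ASmoothOn k g U :=
  aSmoothOn_iff.2 fun n => (aSmoothOn_iff.1 hf n).congr hU hfg

/-- Two decay bounds on a compact set can be given a common exponent. -/
theorem decay_combine (hU : IsModelOpen k U) {S : Set (Fin m → ℝ)} (hS : S ⊆ U) (hSc : IsCompact S)
    {i : Fin m} (hi : (i : ℕ) < k) {C α β : ℝ} (hC : 0 < C) (hβ : 0 < β) (hβα : β ≤ α) :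
    ∃ C' > 0, ∀ x ∈ S, C * x i ^ α ≤ C' * x i ^ β := by
  obtain ⟨R, hR⟩ := (hSc.image (continuous_apply i)).isBounded.subset_closedBall 0
  refine ⟨C * (|R| + 1) ^ (α - β), by positivity, fun x hx => ?_⟩
  have hx0 : 0 ≤ x i := hU.nonneg (hS hx) hi
  have hxR : x i ≤ |R| + 1 := by
    have := hR (mem_image_of_mem _ hx)
    simp only [Metric.mem_closedBall, dist_zero_right, Real.norm_eq_abs] at this
    linarith [le_abs_self (x i), le_abs_self R]
  rcases hx0.eq_or_lt with h | h
  · rw [← h, Real.zero_rpow (by linarith), Real.zero_rpow (by linarith)]; simp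
  · have : x i ^ α = x i ^ (α - β) * x i ^ β := by rw [← Real.rpow_add h]; simp
    rw [this, ← mul_assoc]
    gcongr

theorem decay_add_mul (hU : IsModelOpen k U) {S : Set (Fin m → ℝ)} (hS : S ⊆ U) (hSc : IsCompact S)
    {i : Fin m} (hi : (i : ℕ) < k) {p q a b : (Fin m → ℝ) → ℝ}
    (hp : ∃ C > (0 : ℝ), ∃ α > (0 : ℝ), ∀ x ∈ S, |p x| ≤ C * x i ^ α)
    (hq : ∃ C > (0 : ℝ), ∃ α > (0 : ℝ), ∀ x ∈ S, |q x| ≤ C * x i ^ α)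
    (ha : ContinuousOn a U) (hb : ContinuousOn b U) :
    ∃ C > (0 : ℝ), ∃ α > (0 : ℝ), ∀ x ∈ S, |a x * p x + b x * q x| ≤ C * x i ^ α := by
  obtain ⟨C, hC, α, hα, h1⟩ := hp
  obtain ⟨D, hD, β, hβ, h2⟩ := hq
  obtain ⟨C', hC', h1'⟩ := decay_combine (α := α) (β := min α β) hU hS hSc hi hC (lt_min hα hβ) (min_le_left α β)
  obtain ⟨D', hD', h2'⟩ := decay_combine (α := β) (β := min α β) hU hS hSc hi hD (lt_min hα hβ) (min_le_right α β)
  obtain ⟨A, hA⟩ := hSc.exists_bound_of_continuousOn (ha.mono hS)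
  obtain ⟨B, hB⟩ := hSc.exists_bound_of_continuousOn (hb.mono hS)
  refine ⟨(|A| + 1) * C' + (|B| + 1) * D', by positivity, min α β, lt_min hα hβ, fun x hx => ?_⟩
  have hx0 : 0 ≤ x i := hU.nonneg (hS hx) hi
  have hA' : |a x| ≤ |A| + 1 := by have := hA x hx; rw [Real.norm_eq_abs] at this; linarith [le_abs_self A]
  have hB' : |b x| ≤ |B| + 1 := by have := hB x hx; rw [Real.norm_eq_abs] at this; linarith [le_abs_self B]
  calc |a x * p x + b x * q x| ≤ |a x| * |p x| + |b x| * |q x| := by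
        rw [← abs_mul, ← abs_mul]; exact abs_add_le _ _
    _ ≤ (|A| + 1) * (C' * x i ^ min α β) + (|B| + 1) * (D' * x i ^ min α β) := by
        have := (h1 x hx).trans (h1' x hx)
        have := (h2 x hx).trans (h2' x hx)
        gcongr
    _ = _ := by ring

theorem hasLineDerivAt_add {x v : Fin m → ℝ} {a b : ℝ} (hf : HasLineDerivAt ℝ f a x v)
    (hg : HasLineDerivAt ℝ g b x v) : HasLineDerivAt ℝ (fun x => f x + g x) (a + b) x v :=
  HasDerivAt.fun_add hf hg

theorem hasLineDerivAt_mul {x v : Fin m → ℝ} {a b : ℝ} (hf : HasLineDerivAt ℝ f a x v)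
    (hg : HasLineDerivAt ℝ g b x v) :
    HasLineDerivAt ℝ (fun x => f x * g x) (a * g x + f x * b) x v := by
  have := HasDerivAt.fun_mul (show HasDerivAt (fun t : ℝ => f (x + t • v)) a 0 from hf)
    (show HasDerivAt (fun t : ℝ => g (x + t • v)) b 0 from hg)
  rw [zero_smul, add_zero] at this
  exact this

theorem hasLineDerivAt_comp {x v : Fin m → ℝ} {a : ℝ} {φ : ℝ → ℝ} (hf : HasLineDerivAt ℝ f a x v)
    (hφ : ContDiffAt ℝ ∞ φ (f x)) :
    HasLineDerivAt ℝ (fun x => φ (f x)) (deriv φ (f x) * a) x v := by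
  have h2 : HasDerivAt φ (deriv φ (f x)) (f (x + (0 : ℝ) • v)) := by
    simpa using (hφ.differentiableAt (by simp)).hasDerivAt
  exact HasDerivAt.comp (0 : ℝ) h2 hf

theorem continuousOn_deriv_comp {φ : ℝ → ℝ} (hf : ContinuousOn f U)
    (hφ : ∀ x ∈ U, ContDiffAt ℝ ∞ φ (f x)) : ContinuousOn (fun x => deriv φ (f x)) U := fun x hx =>
  ((hφ x hx).derivWithin (m := ∞) (by simp)).continuousAt.comp_continuousWithinAt (hf x hx)

theorem ADifferentiableOn.bDeriv_add (hU : IsModelOpen k U) (hf : ADifferentiableOn k f U)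
    (hg : ADifferentiableOn k g U) (i : Fin m) :
    EqOn (fun x => bDeriv k i f x + bDeriv k i g x) (bDeriv k i (fun x => f x + g x)) U := by
  intro x hx
  rw [bDeriv_eq (a := lineDeriv ℝ f x (Pi.single i 1) + lineDeriv ℝ g x (Pi.single i 1)) hU hx i
    fun hi => ?_]
  · simp only [bDeriv]; ring
  · exact hasLineDerivAt_add (hf.exists_deriv x hx i hi).hasLineDerivAt
      (hg.exists_deriv x hx i hi).hasLineDerivAt

theorem ADifferentiableOn.bDeriv_mul (hU : IsModelOpen k U) (hf : ADifferentiableOn k f U)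
    (hg : ADifferentiableOn k g U) (i : Fin m) :
    EqOn (fun x => f x * bDeriv k i g x + g x * bDeriv k i f x)
      (bDeriv k i (fun x => f x * g x)) U := by
  intro x hx
  rw [bDeriv_eq (a := lineDeriv ℝ f x (Pi.single i 1) * g x + f x * lineDeriv ℝ g x (Pi.single i 1))
    hU hx i fun hi => ?_]
  · simp only [bDeriv]; ring
  · exact hasLineDerivAt_mul (hf.exists_deriv x hx i hi).hasLineDerivAt
      (hg.exists_deriv x hx i hi).hasLineDerivAt

theorem ADifferentiableOn.bDeriv_comp (hU : IsModelOpen k U) (hf : ADifferentiableOn k f U)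
    {φ : ℝ → ℝ} (hφ : ∀ x ∈ U, ContDiffAt ℝ ∞ φ (f x)) (i : Fin m) :
    EqOn (fun x => deriv φ (f x) * bDeriv k i f x) (bDeriv k i (fun x => φ (f x))) U := by
  intro x hx
  rw [bDeriv_eq (a := deriv φ (f x) * lineDeriv ℝ f x (Pi.single i 1))
    hU hx i fun hi => ?_]
  · simp only [bDeriv]; ring
  · exact hasLineDerivAt_comp (hf.exists_deriv x hx i hi).hasLineDerivAt (hφ x hx)

theorem ADifferentiableOn.add (hU : IsModelOpen k U) (hf : ADifferentiableOn k f U)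
    (hg : ADifferentiableOn k g U) : ADifferentiableOn k (fun x => f x + g x) U where
  continuousOn := hf.continuousOn.add hg.continuousOn
  exists_deriv x hx i hi := (hasLineDerivAt_add (hf.exists_deriv x hx i hi).hasLineDerivAt
      (hg.exists_deriv x hx i hi).hasLineDerivAt).lineDifferentiableAt
  continuousOn_bDeriv i := ((hf.continuousOn_bDeriv i).add (hg.continuousOn_bDeriv i)).congr
    (hf.bDeriv_add hU hg i).symm
  decay S hS hSc i hi := by
    obtain ⟨C, hC, α, hα, h⟩ := decay_add_mul (a := fun _ => 1) (b := fun _ => 1) hU hS hSc hi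
      (hf.decay S hS hSc i hi) (hg.decay S hS hSc i hi) continuousOn_const continuousOn_const
    refine ⟨C, hC, α, hα, fun x hx => ?_⟩
    rw [← hf.bDeriv_add hU hg i (hS hx)]
    simpa using h x hx

theorem ADifferentiableOn.mul (hU : IsModelOpen k U) (hf : ADifferentiableOn k f U)
    (hg : ADifferentiableOn k g U) : ADifferentiableOn k (fun x => f x * g x) U where
  continuousOn := hf.continuousOn.mul hg.continuousOn
  exists_deriv x hx i hi := (hasLineDerivAt_mul (hf.exists_deriv x hx i hi).hasLineDerivAt
      (hg.exists_deriv x hx i hi).hasLineDerivAt).lineDifferentiableAt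
  continuousOn_bDeriv i := ((hf.continuousOn.mul (hg.continuousOn_bDeriv i)).add
    (hg.continuousOn.mul (hf.continuousOn_bDeriv i))).congr (hf.bDeriv_mul hU hg i).symm
  decay S hS hSc i hi := by
    obtain ⟨C, hC, α, hα, h⟩ := decay_add_mul (a := f) (b := g) hU hS hSc hi
      (hg.decay S hS hSc i hi) (hf.decay S hS hSc i hi) hf.continuousOn hg.continuousOn
    refine ⟨C, hC, α, hα, fun x hx => ?_⟩
    rw [← hf.bDeriv_mul hU hg i (hS hx)]
    exact h x hx

theorem ADifferentiableOn.comp (hU : IsModelOpen k U) (hf : ADifferentiableOn k f U)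
    {φ : ℝ → ℝ} (hφ : ∀ x ∈ U, ContDiffAt ℝ ∞ φ (f x)) :
    ADifferentiableOn k (fun x => φ (f x)) U where
  continuousOn x hx := (hφ x hx).continuousAt.comp_continuousWithinAt (hf.continuousOn x hx)
  exists_deriv x hx i hi := (hasLineDerivAt_comp (hf.exists_deriv x hx i hi).hasLineDerivAt
    (hφ x hx)).lineDifferentiableAt
  continuousOn_bDeriv i := ((continuousOn_deriv_comp hf.continuousOn hφ).mul
    (hf.continuousOn_bDeriv i)).congr (hf.bDeriv_comp hU hφ i).symm
  decay S hS hSc i hi := by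
    obtain ⟨C, hC, α, hα, h⟩ := decay_add_mul (a := fun x => deriv φ (f x)) (b := fun _ => 0)
      hU hS hSc hi (hf.decay S hS hSc i hi) (hf.decay S hS hSc i hi)
      (continuousOn_deriv_comp hf.continuousOn hφ) continuousOn_const
    refine ⟨C, hC, α, hα, fun x hx => ?_⟩
    rw [← hf.bDeriv_comp hU hφ i (hS hx)]
    simpa using h x hx

theorem ASmoothUpTo.add (hU : IsModelOpen k U) {n : ℕ} (hf : ASmoothUpTo k n f U)
    (hg : ASmoothUpTo k n g U) : ASmoothUpTo k n (fun x => f x + g x) U := by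
  induction n generalizing f g with
  | zero => exact ADifferentiableOn.add hU hf hg
  | succ n ih => exact ⟨hf.1.add hU hg.1, fun i =>
      (ih (hf.2 i) (hg.2 i)).congr hU (hf.1.bDeriv_add hU hg.1 i)⟩

theorem ASmoothUpTo.mul (hU : IsModelOpen k U) {n : ℕ} (hf : ASmoothUpTo k n f U)
    (hg : ASmoothUpTo k n g U) : ASmoothUpTo k n (fun x => f x * g x) U := by
  induction n generalizing f g with
  | zero => exact ADifferentiableOn.mul hU hf hg
  | succ n ih => exact ⟨hf.1.mul hU hg.1, fun i =>
      (ASmoothUpTo.add hU (ih hf.pred (hg.2 i)) (ih hg.pred (hf.2 i))).congr hU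
        (hf.1.bDeriv_mul hU hg.1 i)⟩

theorem ASmoothUpTo.comp (hU : IsModelOpen k U) {n : ℕ} (hf : ASmoothUpTo k n f U)
    {φ : ℝ → ℝ} (hφ : ∀ x ∈ U, ContDiffAt ℝ ∞ φ (f x)) :
    ASmoothUpTo k n (fun x => φ (f x)) U := by
  induction n generalizing φ with
  | zero => exact ADifferentiableOn.comp hU hf hφ
  | succ n ih => exact ⟨hf.1.comp hU hφ, fun i =>
      (ASmoothUpTo.mul hU (ih hf.pred fun x hx => (hφ x hx).derivWithin (by simp)) (hf.2 i)).congr hU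
        (hf.1.bDeriv_comp hU hφ i)⟩

theorem ASmoothOn.add (hU : IsModelOpen k U) (hf : ASmoothOn k f U) (hg : ASmoothOn k g U) :
    ASmoothOn k (fun x => f x + g x) U :=
  aSmoothOn_iff.2 fun n => (aSmoothOn_iff.1 hf n).add hU (aSmoothOn_iff.1 hg n)

theorem ASmoothOn.mul (hU : IsModelOpen k U) (hf : ASmoothOn k f U) (hg : ASmoothOn k g U) :
    ASmoothOn k (fun x => f x * g x) U :=
  aSmoothOn_iff.2 fun n => (aSmoothOn_iff.1 hf n).mul hU (aSmoothOn_iff.1 hg n)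

theorem ASmoothOn.comp (hU : IsModelOpen k U) (hf : ASmoothOn k f U)
    {φ : ℝ → ℝ} (hφ : ∀ x ∈ U, ContDiffAt ℝ ∞ φ (f x)) : ASmoothOn k (fun x => φ (f x)) U :=
  aSmoothOn_iff.2 fun n => (aSmoothOn_iff.1 hf n).comp hU hφ

theorem bDeriv_const (i : Fin m) (c : ℝ) : bDeriv k i (fun _ => c) = fun _ => 0 := by
  funext x; simp [bDeriv, lineDeriv]

theorem aSmoothOn_const (c : ℝ) : ASmoothOn k (fun _ => c) U := by
  rw [aSmoothOn_iff]
  have h0 : ∀ c : ℝ, ADifferentiableOn k (fun _ : Fin m → ℝ => c) U := fun c =>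
    { continuousOn := continuousOn_const
      exists_deriv := fun x _ i _ => by
        exact DifferentiableAt.lineDifferentiableAt (by fun_prop)
      continuousOn_bDeriv := fun i => by rw [bDeriv_const]; exact continuousOn_const
      decay := fun S hS hSc i hi => by
        refine ⟨1, one_pos, 2, two_pos, fun x hx => ?_⟩
        rw [bDeriv_const]
        simp only [abs_zero, one_mul]
        rw [Real.rpow_two]; positivity }
  intro n
  induction n generalizing c with
  | zero => exact h0 c
  | succ n ih => exact ⟨h0 c, fun i => by rw [bDeriv_const]; exact ih 0⟩

theorem bDeriv_coord (i j : Fin m) :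
    bDeriv k i (fun x => x j) = fun x => if i = j then bCoef k i x else 0 := by
  funext x
  have : HasLineDerivAt ℝ (fun x : Fin m → ℝ => x j) ((Pi.single i 1 : Fin m → ℝ) j) x
      (Pi.single i 1) := by
    have := ((hasDerivAt_id (0 : ℝ)).mul_const ((Pi.single i 1 : Fin m → ℝ) j)).const_add (x j)
    simpa [HasLineDerivAt] using this
  rw [bDeriv, this.lineDeriv]
  by_cases h : i = j <;> simp [h, eq_comm]

theorem aSmoothOn_coord (hU : IsModelOpen k U) (j : Fin m) : ASmoothOn k (fun x => x j) U := by
  rw [aSmoothOn_iff]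
  have h0 : ADifferentiableOn k (fun x : Fin m → ℝ => x j) U :=
    { continuousOn := by fun_prop
      exists_deriv := fun x _ i _ =>
        DifferentiableAt.lineDifferentiableAt (by fun_prop)
      continuousOn_bDeriv := fun i => by
        rw [bDeriv_coord]
        by_cases h : i = j <;> by_cases h' : (i : ℕ) < k <;> simp only [h, bCoef] <;>
          split_ifs <;> fun_prop
      decay := fun S hS hSc i hi => by
        refine ⟨1, one_pos, 1, one_pos, fun x hx => ?_⟩
        have := hU.nonneg (hS hx) hi
        rw [bDeriv_coord]
        by_cases h : i = j
        · simp only [h, if_true, bCoef]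
          rw [if_pos (h ▸ hi), abs_of_nonneg (h ▸ this)]; simp
        · simpa [h] using this }
  intro n
  induction n with
  | zero => exact h0
  | succ n ih =>
    refine ⟨h0, fun i => ?_⟩
    rw [bDeriv_coord]
    by_cases h : i = j
    · by_cases h' : (i : ℕ) < k
      · simpa [h, bCoef, h ▸ h'] using ih
      · simpa [h, bCoef, h ▸ h'] using aSmoothOn_iff.1 (aSmoothOn_const 1) n
    · simpa [h] using aSmoothOn_iff.1 (aSmoothOn_const 0) n

theorem ADifferentiableOn.of_local (hU : IsModelOpen k U)
    (h : ∀ u ∈ U, ∃ V, IsOpen V ∧ u ∈ V ∧ ADifferentiableOn k f (V ∩ U)) :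
    ADifferentiableOn k f U where
  continuousOn x hx := by
    obtain ⟨V, hV, hxV, h⟩ := h x hx
    have := h.continuousOn x ⟨hxV, hx⟩
    rwa [inter_comm, continuousWithinAt_inter (hV.mem_nhds hxV)] at this
  exists_deriv x hx i hi := by
    obtain ⟨V, hV, hxV, h⟩ := h x hx
    exact h.exists_deriv x ⟨hxV, hx⟩ i hi
  continuousOn_bDeriv i x hx := by
    obtain ⟨V, hV, hxV, h⟩ := h x hx
    have := h.continuousOn_bDeriv i x ⟨hxV, hx⟩
    rwa [inter_comm, continuousWithinAt_inter (hV.mem_nhds hxV)] at this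
  decay S hS hSc i hi := by
    have key : ∃ C > (0 : ℝ), ∃ α > (0 : ℝ), ∀ x ∈ S ∩ S, |bDeriv k i f x| ≤ C * x i ^ α := by
      refine hSc.induction_on (p := fun T => ∃ C > (0 : ℝ), ∃ α > (0 : ℝ), ∀ x ∈ T ∩ S,
        |bDeriv k i f x| ≤ C * x i ^ α) ⟨1, one_pos, 1, one_pos, by simp⟩ ?_ ?_ ?_
      · rintro T T' hT ⟨C, hC, α, hα, h⟩
        exact ⟨C, hC, α, hα, fun x hx => h x ⟨hT hx.1, hx.2⟩⟩
      · rintro T T' ⟨C, hC, α, hα, h1⟩ ⟨D, hD, β, hβ, h2⟩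
        obtain ⟨C', hC', h1'⟩ := decay_combine (α := α) (β := min α β) hU hS hSc hi hC
          (lt_min hα hβ) (min_le_left α β)
        obtain ⟨D', hD', h2'⟩ := decay_combine (α := β) (β := min α β) hU hS hSc hi hD
          (lt_min hα hβ) (min_le_right α β)
        refine ⟨C' + D', by positivity, min α β, lt_min hα hβ, ?_⟩
        rintro x ⟨hx, hxS⟩
        have hp : 0 ≤ x i ^ min α β := Real.rpow_nonneg (hU.nonneg (hS hxS) hi) _
        rcases hx with hx | hx
        · nlinarith [h1 x ⟨hx, hxS⟩, h1' x hxS, mul_nonneg hD'.le hp]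
        · nlinarith [h2 x ⟨hx, hxS⟩, h2' x hxS, mul_nonneg hC'.le hp]
      · intro x hx
        obtain ⟨V, hV, hxV, h⟩ := h x (hS hx)
        obtain ⟨ε, hε, hb⟩ := Metric.nhds_basis_closedBall.mem_iff.1 (hV.mem_nhds hxV)
        obtain ⟨C, hC, α, hα, h'⟩ := h.decay (Metric.closedBall x ε ∩ S)
          (fun y hy => ⟨hb hy.1, hS hy.2⟩)
          (hSc.inter_left Metric.isClosed_closedBall) i hi
        exact ⟨Metric.closedBall x ε, mem_nhdsWithin_of_mem_nhds (Metric.closedBall_mem_nhds x hε),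
          C, hC, α, hα, h'⟩
    simpa using key

theorem ASmoothOn.of_local (hU : IsModelOpen k U)
    (h : ∀ u ∈ U, ∃ V, IsOpen V ∧ u ∈ V ∧ ASmoothOn k f (V ∩ U)) : ASmoothOn k f U := fun l =>
  ADifferentiableOn.of_local hU fun u hu => by
    obtain ⟨V, hV, huV, h⟩ := h u hu
    exact ⟨V, hV, huV, h l⟩

theorem ASmoothOn.continuousOn (h : ASmoothOn k f U) : ContinuousOn f U := (h []).continuousOn

theorem ASmoothOn.sum (hU : IsModelOpen k U) {ι : Type*} (s : Finset ι)
    {f : ι → (Fin m → ℝ) → ℝ} (h : ∀ i ∈ s, ASmoothOn k (f i) U) :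
    ASmoothOn k (fun x => ∑ i ∈ s, f i x) U := by
  classical
  induction s using Finset.induction_on with
  | empty => simpa using aSmoothOn_const 0
  | insert i s hi ih =>
    simp only [Finset.sum_insert hi]
    exact (h i (by simp)).add hU (ih fun j hj => h j (by simp [hj]))

end Closure

/-! ### Manifolds with a-corners -/

/-- An a-chart of dimension `m` on `X`: a homeomorphism `φ` from an open subset `U = source` of
`⟦0,∞)^k × ℝ^(m-k)` onto an open subset `φ(U) = target` of `X`. -/
structure AChart (m : ℕ) (X : Type*) [TopologicalSpace X] extends PartialEquiv (Fin m → ℝ) X where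
  k : ℕ
  k_le : k ≤ m
  modelOpen_source : IsModelOpen k source
  isOpen_target : IsOpen target
  continuousOn_toFun : ContinuousOn toFun source
  continuousOn_invFun : ContinuousOn invFun target

section Charts

variable {m : ℕ} {X : Type*} [TopologicalSpace X]

/-- The part of the domain of a chart where all boundary coordinates are positive; this is an open
subset of `ℝ^m`. -/
def AChart.interior (c : AChart m X) : Set (Fin m → ℝ) :=
  {u ∈ c.source | ∀ i : Fin m, (i : ℕ) < c.k → 0 < u i}

/-- The domain, in the coordinates of `c`, of the change of coordinates from `c` to `c'`. -/
def AChart.overlap (c c' : AChart m X) : Set (Fin m → ℝ) :=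
  c.source ∩ c.toPartialEquiv ⁻¹' c'.target

/-- The change of coordinates from the chart `c` to the chart `c'`. -/
def AChart.change (c c' : AChart m X) (u : Fin m → ℝ) : Fin m → ℝ :=
  c'.toPartialEquiv.symm (c.toPartialEquiv u)

/-- Two a-charts are compatible if the change of coordinates is an a-diffeomorphism. -/
def AChart.Compatible (c c' : AChart m X) : Prop :=
  ASmoothMapOn c.k c'.k (c.change c') (c.overlap c') ∧
    ASmoothMapOn c'.k c.k (c'.change c) (c'.overlap c)

end Charts

/-- An `m`-dimensional manifold with a-corners structure on `X`: a maximal a-atlas. -/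
structure AManifold (m : ℕ) (X : Type*) [TopologicalSpace X] where
  atlas : Set (AChart m X)
  cover : ∀ x, ∃ c ∈ atlas, x ∈ c.target
  compatible : ∀ c ∈ atlas, ∀ c' ∈ atlas, c.Compatible c'
  maximal : ∀ c : AChart m X, (∀ c' ∈ atlas, c.Compatible c') → c ∈ atlas

section Manifold

variable {m : ℕ} {X : Type*} [TopologicalSpace X]

/-- The interior `X°`: the points of depth zero. -/
def AManifold.interior (M : AManifold m X) : Set X :=
  {x | ∃ c ∈ M.atlas, ∃ u ∈ c.interior, c.toPartialEquiv u = x}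

/-- The real function `f` on `X` is a-smooth on the open set `W`. -/
def AManifold.SmoothOn (M : AManifold m X) (f : X → ℝ) (W : Set X) : Prop :=
  ∀ c ∈ M.atlas, ASmoothOn c.k (fun u => f (c.toPartialEquiv u)) (c.source ∩ c.toPartialEquiv ⁻¹' W)

/-- The matrix of the change of basis of the b-tangent bundle from the chart `c` to the chart `c'`,
at an interior point with coordinates `u` in `c`: the `i`-th basis b-vector field of `c` is the sum
over `j` of `bJacobian c c' u j i` times the `j`-th basis b-vector field of `c'`. -/
def AChart.bJacobian (c c' : AChart m X) (u : Fin m → ℝ) : Matrix (Fin m) (Fin m) ℝ :=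
  Matrix.of fun j i => (bCoef c'.k j (c.change c' u))⁻¹ * bDeriv c.k i (fun v => c.change c' v j) u

/-! #### Facts on charts -/

theorem AChart.modelOpen_preimage (c : AChart m X) {W : Set X} (hW : IsOpen W) :
    IsModelOpen c.k (c.source ∩ c.toPartialEquiv ⁻¹' W) := by
  obtain ⟨O, hO, h⟩ := (continuousOn_iff'.1 c.continuousOn_toFun) W hW
  have : c.source ∩ c.toPartialEquiv ⁻¹' W = O ∩ c.source := by
    rw [inter_comm]; exact h
  rw [this]
  exact c.modelOpen_source.inter_open hO

theorem AChart.modelOpen_overlap (c c' : AChart m X) : IsModelOpen c.k (c.overlap c') :=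
  c.modelOpen_preimage c'.isOpen_target

theorem AChart.isOpen_image (c : AChart m X) {O : Set (Fin m → ℝ)} (hO : IsOpen O) :
    IsOpen (c.toPartialEquiv '' (O ∩ c.source)) := by
  have h := c.continuousOn_invFun.isOpen_inter_preimage c.isOpen_target hO
  convert h using 1
  ext x
  constructor
  · rintro ⟨u, ⟨hu, hus⟩, rfl⟩
    refine ⟨c.map_source hus, ?_⟩
    change c.toPartialEquiv.symm (c.toPartialEquiv u) ∈ O
    rwa [c.left_inv hus]
  · rintro ⟨hx, hxO⟩
    exact ⟨c.toPartialEquiv.symm x, ⟨hxO, c.map_target hx⟩, c.right_inv hx⟩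

/-- Pushing a point of a model-open set into the interior. -/
theorem IsModelOpen.eventually_push {k : ℕ} {U : Set (Fin m → ℝ)} (hU : IsModelOpen k U)
    {u : Fin m → ℝ} (hu : u ∈ U) :
    ∀ᶠ t : ℝ in 𝓝[>] 0, (fun i => u i + t) ∈ U ∧ ∀ i : Fin m, (i : ℕ) < k → 0 < u i + t := by
  have hn := fun (i : Fin m) (hi : (i : ℕ) < k) => hU.nonneg hu hi
  obtain ⟨O, hO, rfl⟩ := hU
  have hc : Continuous fun t : ℝ => (fun i => u i + t : Fin m → ℝ) := by fun_prop
  have h1 : ∀ᶠ t : ℝ in 𝓝 0, (fun i => u i + t : Fin m → ℝ) ∈ O :=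
    hc.continuousAt.eventually_mem (hO.mem_nhds (by
      have : (fun i => u i + 0 : Fin m → ℝ) = u := by ext; simp
      rw [this]; exact hu.1))
  filter_upwards [h1.filter_mono nhdsWithin_le_nhds, self_mem_nhdsWithin] with t ht ht0
  have hpos : ∀ i : Fin m, (i : ℕ) < k → 0 < u i + t := fun i hi => by
    have := hn i hi
    have : 0 < t := ht0
    linarith
  exact ⟨⟨ht, fun i hi => (hpos i hi).le⟩, hpos⟩

theorem IsMonomialOn.mono {k : ℕ} {f : (Fin m → ℝ) → ℝ} {u : Fin m → ℝ} {W W' : Set (Fin m → ℝ)}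
    {F : (Fin m → ℝ) → ℝ} {a : Fin m → ℝ} (h : IsMonomialOn k f u W F a) (hW : W' ⊆ W) :
    IsMonomialOn k f u W' F a :=
  ⟨h.smooth.mono hW, fun x hx => h.pos x (hW hx), h.exp_nonneg, h.exp_eq_zero,
    fun x hx => h.eq x (hW hx)⟩

theorem ASmoothMapOn.mono {n k l : ℕ} {f : (Fin m → ℝ) → (Fin n → ℝ)} {U V : Set (Fin m → ℝ)}
    (h : ASmoothMapOn k l f U) (hV : V ⊆ U) : ASmoothMapOn k l f V where
  continuousOn := h.continuousOn.mono hV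
  mapsTo := h.mapsTo.mono_left hV
  smooth j hj := (h.smooth j hj).mono hV
  face j hj u hu := by
    obtain ⟨W, hW, huW, h'⟩ := h.face j hj u (hV hu)
    refine ⟨W, hW, huW, h'.imp ?_ ?_⟩
    · rintro ⟨F, a, hF⟩
      exact ⟨F, a, hF.mono (inter_subset_inter_right _ hV)⟩
    · exact fun h x hx => h x (inter_subset_inter_right _ hV hx)

theorem AChart.change_mem (c c' : AChart m X) {u : Fin m → ℝ} (hu : u ∈ c.overlap c') :
    c.change c' u ∈ c'.source :=
  c'.map_target hu.2

theorem AChart.apply_change (c c' : AChart m X) {u : Fin m → ℝ} (hu : u ∈ c.overlap c') :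
    c'.toPartialEquiv (c.change c' u) = c.toPartialEquiv u :=
  c'.right_inv hu.2

/-- A boundary coordinate of one chart does not vanish identically on an open set. -/
theorem AChart.exists_pos (c c' : AChart m X) {u : Fin m → ℝ} (hu : u ∈ c.overlap c')
    {V : Set (Fin m → ℝ)} (hV : IsOpen V) (huV : u ∈ V) {j : Fin m} (hj : (j : ℕ) < c'.k) :
    ∃ v ∈ V ∩ c.overlap c', 0 < c.change c' v j := by
  have hW := c.isOpen_image hV
  have hmem : c.change c' u ∈ c'.source ∩ c'.toPartialEquiv ⁻¹' (c.toPartialEquiv '' (V ∩ c.source)) :=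
    ⟨c.change_mem c' hu, by
      rw [mem_preimage, c.apply_change c' hu]; exact mem_image_of_mem _ ⟨huV, hu.1⟩⟩
  obtain ⟨t, ⟨ht1, ht2⟩, ht3⟩ := (((c'.modelOpen_preimage hW).eventually_push hmem).and
    self_mem_nhdsWithin).exists
  obtain ⟨v, ⟨hvV, hvs⟩, hv⟩ := ht1.2
  have hvo : v ∈ c.overlap c' := ⟨hvs, by
    rw [mem_preimage, hv]; exact c'.map_source ht1.1⟩
  refine ⟨v, ⟨hvV, hvo⟩, ?_⟩
  have : c.change c' v = fun i => c.change c' u i + t := by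
    rw [AChart.change, hv, c'.left_inv ht1.1]
  rw [this]
  exact ht2 j hj

variable {M : AManifold m X}

theorem AManifold.exists_monomial {c c' : AChart m X} (hc : c ∈ M.atlas) (hc' : c' ∈ M.atlas)
    {u : Fin m → ℝ} (hu : u ∈ c.overlap c') :
    ∃ V, IsOpen V ∧ u ∈ V ∧ ∃ (F : Fin m → (Fin m → ℝ) → ℝ) (a : Fin m → Fin m → ℝ),
      ∀ j : Fin m, (j : ℕ) < c'.k →
        IsMonomialOn c.k (fun v => c.change c' v j) u (V ∩ c.overlap c') (F j) (a j) := by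
  have h : ∀ j : Fin m, ∃ V, IsOpen V ∧ u ∈ V ∧ ∃ (F : (Fin m → ℝ) → ℝ) (a : Fin m → ℝ),
      (j : ℕ) < c'.k → IsMonomialOn c.k (fun v => c.change c' v j) u (V ∩ c.overlap c') F a := by
    intro j
    by_cases hj : (j : ℕ) < c'.k
    · obtain ⟨V, hV, huV, ⟨F, a, h⟩ | h⟩ := (M.compatible c hc c' hc').1.face j hj u hu
      · exact ⟨V, hV, huV, F, a, fun _ => h⟩
      · obtain ⟨v, hv, hpos⟩ := c.exists_pos c' hu hV huV hj
        exact absurd (h v hv) hpos.ne'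
    · exact ⟨univ, isOpen_univ, mem_univ _, 0, 0, fun h => absurd h hj⟩
  choose V hV huV F a h using h
  exact ⟨⋂ j, V j, isOpen_iInter_of_finite hV, mem_iInter.2 huV, F, a, fun j hj =>
    (h j hj).mono (inter_subset_inter_left _ (iInter_subset V j))⟩

theorem AManifold.change_interior {c c' : AChart m X} (hc : c ∈ M.atlas) (hc' : c' ∈ M.atlas)
    {u : Fin m → ℝ} (hu : u ∈ c.overlap c') (hui : u ∈ c.interior) : c.change c' u ∈ c'.interior := by
  obtain ⟨V, hV, huV, F, a, h⟩ := AManifold.exists_monomial hc hc' hu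
  refine ⟨c.change_mem c' hu, fun j hj => ?_⟩
  have := (h j hj).eq u ⟨huV, hu⟩
  rw [this]
  refine mul_pos ((h j hj).pos u ⟨huV, hu⟩) (Finset.prod_pos fun i _ => ?_)
  rw [(h j hj).exp_eq_zero i, Real.rpow_zero]
  · exact one_pos
  · rintro ⟨hi, h0⟩
    exact (hui.2 i hi).ne' h0

theorem AManifold.mem_interior_iff {c : AChart m X} (hc : c ∈ M.atlas) {u : Fin m → ℝ}
    (hu : u ∈ c.source) : c.toPartialEquiv u ∈ M.interior ↔ u ∈ c.interior := by
  refine ⟨?_, fun h => ⟨c, hc, u, h, rfl⟩⟩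
  rintro ⟨c', hc', v, hv, hvu⟩
  have hvo : v ∈ c'.overlap c := ⟨hv.1, by rw [mem_preimage, hvu]; exact c.map_source hu⟩
  have := AManifold.change_interior hc' hc hvo hv
  rwa [AChart.change, hvu, c.left_inv hu] at this

theorem AManifold.nhdsWithin_interior_neBot (M : AManifold m X) (x : X) :
    (𝓝[M.interior] x).NeBot := by
  obtain ⟨c, hc, hx⟩ := M.cover x
  obtain ⟨u, hu, rfl⟩ : ∃ u ∈ c.source, c.toPartialEquiv u = x :=
    ⟨_, c.map_target hx, c.right_inv hx⟩
  have h := c.modelOpen_source.eventually_push hu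
  have hc0 : Tendsto (fun t : ℝ => (fun i => u i + t : Fin m → ℝ)) (𝓝[>] 0) (𝓝[c.source] u) := by
    refine tendsto_nhdsWithin_iff.2 ⟨?_, h.mono fun t ht => ht.1⟩
    have : Continuous fun t : ℝ => (fun i => u i + t : Fin m → ℝ) := by fun_prop
    have h0 : (fun i => u i + 0 : Fin m → ℝ) = u := by ext; simp
    have := this.tendsto 0
    rw [h0] at this
    exact this.mono_left nhdsWithin_le_nhds
  have h1 : Tendsto (fun t : ℝ => c.toPartialEquiv (fun i => u i + t)) (𝓝[>] 0)
      (𝓝[M.interior] (c.toPartialEquiv u)) :=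
    tendsto_nhdsWithin_iff.2 ⟨(c.continuousOn_toFun u hu).tendsto.comp hc0,
      h.mono fun t ht => (AManifold.mem_interior_iff hc ht.1).2 ht⟩
  exact h1.neBot

/-- The restriction of a chart to a smaller open set. -/
def AChart.restrict (c : AChart m X) (O : Set (Fin m → ℝ)) (hO : IsOpen O) : AChart m X where
  toPartialEquiv := c.toPartialEquiv.restr O
  k := c.k
  k_le := c.k_le
  modelOpen_source := by
    rw [PartialEquiv.restr_source, inter_comm]; exact c.modelOpen_source.inter_open hO
  isOpen_target := c.continuousOn_invFun.isOpen_inter_preimage c.isOpen_target hO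
  continuousOn_toFun := c.continuousOn_toFun.mono inter_subset_left
  continuousOn_invFun := c.continuousOn_invFun.mono inter_subset_left

theorem AManifold.restrict_mem {c : AChart m X} (hc : c ∈ M.atlas) {O : Set (Fin m → ℝ)}
    (hO : IsOpen O) : c.restrict O hO ∈ M.atlas := by
  refine M.maximal _ fun c' hc' => ⟨?_, ?_⟩
  · exact (M.compatible c hc c' hc').1.mono fun u hu => ⟨hu.1.1, hu.2⟩
  · exact (M.compatible c hc c' hc').2.mono fun u hu => ⟨hu.1, hu.2.1⟩

/-- `c` is the restriction of the chart `c'` to a smaller domain. -/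
structure AChart.IsRestriction (c c' : AChart m X) : Prop where
  k_eq : c.k = c'.k
  source_subset : c.source ⊆ c'.source
  eqOn : EqOn c.toPartialEquiv c'.toPartialEquiv c.source

theorem AChart.restrict_isRestriction (c : AChart m X) {O : Set (Fin m → ℝ)} (hO : IsOpen O) :
    (c.restrict O hO).IsRestriction c :=
  ⟨rfl, inter_subset_left, fun _ _ => rfl⟩

end Manifold

/-! ### Vector bundles -/

/-- A vector bundle chart of rank `r` for a family of vector spaces `E x`: an a-chart of the base
together with a linear coordinate system of each fibre `E x`, for `x` in the image of the a-chart
(the values of `frame` at other points are irrelevant). -/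
structure VBChart (m r : ℕ) {X : Type*} [TopologicalSpace X] (E : X → Type*)
    [∀ x, AddCommGroup (E x)] [∀ x, Module ℝ (E x)] where
  chart : AChart m X
  frame : ∀ x, E x ≃ₗ[ℝ] (Fin r → ℝ)

section

variable {m r : ℕ} {X : Type*} [TopologicalSpace X] {E : X → Type*}
  [∀ x, AddCommGroup (E x)] [∀ x, Module ℝ (E x)]

/-- The fibre coordinates, as a function of the base coordinates, of a section `s`. -/
def VBChart.coords (κ : VBChart m r E) (s : ∀ x, E x) (u : Fin m → ℝ) : Fin r → ℝ :=
  κ.frame (κ.chart.toPartialEquiv u) (s (κ.chart.toPartialEquiv u))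

/-- The `b`-th local basis section of the bundle given by a vector bundle chart. -/
def VBChart.basisSection (κ : VBChart m r E) (b : Fin r) (x : X) : E x :=
  (κ.frame x).symm (Pi.single b 1)

end

/-- A rank `r` vector bundle over a manifold with a-corners: a family of fibres with an atlas of
vector bundle charts which cover, and whose transition functions are a-smooth. -/
structure AVectorBundle.{u, v} {m : ℕ} {X : Type u} [TopologicalSpace X] (M : AManifold m X)
    (r : ℕ) where
  Fiber : X → Type v
  [instAddCommGroup : ∀ x, AddCommGroup (Fiber x)]
  [instModule : ∀ x, Module ℝ (Fiber x)]
  atlas : Set (VBChart m r Fiber)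
  chart_mem : ∀ κ ∈ atlas, κ.chart ∈ M.atlas
  cover : ∀ x, ∃ κ ∈ atlas, x ∈ κ.chart.target
  smooth_transition : ∀ κ ∈ atlas, ∀ κ' ∈ atlas, ∀ a b : Fin r,
    ASmoothOn κ'.chart.k (fun u => κ'.coords (κ.basisSection b) u a) (κ'.chart.overlap κ.chart)

attribute [instance] AVectorBundle.instAddCommGroup AVectorBundle.instModule

/-! ### Weights and the line bundles `L_λ` -/

/-- A weight on `M`: for every a-chart `c` of the atlas and every boundary coordinate `i`, a locally
constant function `coef c i` on the boundary face `{x_i = 0}` of the domain of `c`, in such a way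
that the local exponents transform by `λ_i = ∑_j a_(i,j) λ'_j` under a change of coordinates
`x'_j = F_j(x) · x_1^(a_(1,j)) ⋯ x_k^(a_(k,j))`.
(The values of `coef c i` away from the face `{x_i = 0}` are irrelevant.) -/
structure Weight {m : ℕ} {X : Type*} [TopologicalSpace X] (M : AManifold m X) where
  coef : AChart m X → Fin m → (Fin m → ℝ) → ℝ
  locallyConstant : ∀ c ∈ M.atlas, ∀ i : Fin m, (i : ℕ) < c.k → ∀ u ∈ c.source, u i = 0 →
    ∀ᶠ v in 𝓝[c.source ∩ {v | v i = 0}] u, coef c i v = coef c i u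
  change : ∀ c ∈ M.atlas, ∀ c' ∈ M.atlas, ∀ u ∈ c.overlap c',
    ∀ V, IsOpen V → u ∈ V → ∀ (F : Fin m → (Fin m → ℝ) → ℝ) (a : Fin m → Fin m → ℝ),
    (∀ j : Fin m, (j : ℕ) < c'.k →
      IsMonomialOn c.k (fun v => c.change c' v j) u (V ∩ c.overlap c') (F j) (a j)) →
    ∀ i : Fin m, (i : ℕ) < c.k → u i = 0 →
      coef c i u = ∑ j : Fin m, if (j : ℕ) < c'.k then a j i * coef c' j (c.change c' u) else 0

section Weights

variable {m : ℕ} {X : Type*} [TopologicalSpace X] {M : AManifold m X}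

/-- The weight has the constant exponents `ℓ` in the chart `c`: on each face `{x_i = 0}` of the
domain of `c` it equals `ℓ i`, and `ℓ i = 0` if there is no such face. -/
structure Weight.Adapted (w : Weight M) (c : AChart m X) (ℓ : Fin m → ℝ) : Prop where
  eq_coef : ∀ i : Fin m, (i : ℕ) < c.k → ∀ u ∈ c.source, u i = 0 → w.coef c i u = ℓ i
  eq_zero : ∀ i : Fin m, (¬ ∃ u ∈ c.source, (i : ℕ) < c.k ∧ u i = 0) → ℓ i = 0

/-- The logarithm of `x_1^(ℓ_1) ⋯ x_k^(ℓ_k)`, as a function on the image of the chart. -/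
def AChart.logMonomial (c : AChart m X) (ℓ : Fin m → ℝ) (y : X) : ℝ :=
  ∑ i, ℓ i * Real.log (c.toPartialEquiv.symm y i)

/-- The local exponents do not change when a chart is restricted. -/
theorem Weight.coef_restrict (w : Weight M) {c : AChart m X} (hc : c ∈ M.atlas)
    {O : Set (Fin m → ℝ)} (hO : IsOpen O) {i : Fin m} (hi : (i : ℕ) < c.k) {v : Fin m → ℝ}
    (hv : v ∈ (c.restrict O hO).source) (hv0 : v i = 0) :
    w.coef (c.restrict O hO) i v = w.coef c i v := by
  have hid : ∀ x ∈ (c.restrict O hO).overlap c, (c.restrict O hO).change c x = x := fun x hx =>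
    c.left_inv hx.1.1
  have hvo : v ∈ (c.restrict O hO).overlap c := ⟨hv, c.map_source hv.1⟩
  have hmo := (c.restrict O hO).modelOpen_overlap c
  have := w.change (c.restrict O hO) (AManifold.restrict_mem hc hO) c hc v hvo
    {x | ∀ j, 0 < v j → 0 < x j} ?_ (fun j hj => hj)
    (fun j x => if v j = 0 then 1 else x j) (fun j i => if i = j ∧ v j = 0 then 1 else 0) ?_ i hi hv0
  · rw [this, Finset.sum_eq_single i]
    · simp [hi, hv0, hid v hvo]
    · intro j _ hj
      simp [Ne.symm hj]
    · simp
  · have : {x : Fin m → ℝ | ∀ j, 0 < v j → 0 < x j} = ⋂ j, {x : Fin m → ℝ | 0 < v j → 0 < x j} := by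
      ext; simp
    rw [this]
    refine isOpen_iInter_of_finite fun j => ?_
    by_cases h : 0 < v j
    · simpa [h] using isOpen_lt continuous_const (continuous_apply j)
    · simp [h]
  · intro j hj
    have hvj : 0 ≤ v j := hmo.nonneg hvo (i := j) hj
    refine ⟨?_, fun x hx => ?_, fun i => ?_, fun i hi => ?_, fun x hx => ?_⟩
    · by_cases h : v j = 0
      · simpa [h] using aSmoothOn_const 1
      · simpa [h] using (aSmoothOn_coord hmo j).mono inter_subset_right
    · by_cases h : v j = 0
      · simp [h]
      · simpa [h] using hx.1 j (lt_of_le_of_ne hvj (Ne.symm h))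
    · split_ifs <;> norm_num
    · rw [if_neg]
      rintro ⟨rfl, h⟩
      exact hi ⟨hj, h⟩
    · rw [hid x hx.2]
      by_cases h : v j = 0
      · rw [if_pos h, one_mul, Finset.prod_eq_single j]
        · simp [h]
        · intro i _ hij
          simp [hij]
        · simp
      · simp [h]

/-- Near every point there are charts in which the weight has constant exponents. -/
theorem Weight.exists_adapted_restrict (w : Weight M) {c : AChart m X} (hc : c ∈ M.atlas)
    {u : Fin m → ℝ} (hu : u ∈ c.source) :
    ∃ (O : Set (Fin m → ℝ)) (hO : IsOpen O) (ℓ : Fin m → ℝ), u ∈ O ∧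
      w.Adapted (c.restrict O hO) ℓ := by
  have h : ∀ i : Fin m, ∃ (V : Set (Fin m → ℝ)) (l : ℝ), IsOpen V ∧ u ∈ V ∧
      (∀ v ∈ c.source, v ∈ V → (i : ℕ) < c.k → v i = 0 → w.coef c i v = l) ∧
      (¬ ((i : ℕ) < c.k ∧ u i = 0) → l = 0) := by
    intro i
    by_cases hi : (i : ℕ) < c.k
    · by_cases h0 : u i = 0
      · obtain ⟨V, hV, huV, h⟩ := mem_nhdsWithin.1 (w.locallyConstant c hc i hi u hu h0)
        exact ⟨V, w.coef c i u, hV, huV, fun v hv hvV _ hv0 => h ⟨hvV, hv, hv0⟩,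
          fun h => absurd ⟨hi, h0⟩ h⟩
      · exact ⟨{v | v i ≠ 0}, 0, isOpen_ne_fun (by fun_prop) (by fun_prop), h0,
          fun v _ hvV _ hv0 => absurd hv0 hvV, fun _ => rfl⟩
    · exact ⟨univ, 0, isOpen_univ, mem_univ _, fun v _ _ h => absurd h hi, fun _ => rfl⟩
  choose V ℓ hV huV h1 h2 using h
  refine ⟨⋂ i, V i, isOpen_iInter_of_finite hV, ℓ, mem_iInter.2 huV, ?_, ?_⟩
  · intro i hi v hv hv0
    rw [w.coef_restrict hc _ hi hv hv0, h1 i v hv.1 (mem_iInter.1 hv.2 i) hi hv0]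
  · exact fun i hi => h2 i fun h => hi ⟨u, ⟨hu, mem_iInter.2 huV⟩, h⟩

theorem Weight.exists_adapted (w : Weight M) (x : X) :
    ∃ c ∈ M.atlas, x ∈ c.target ∧ ∃ ℓ, w.Adapted c ℓ := by
  obtain ⟨c, hc, hx⟩ := M.cover x
  obtain ⟨O, hO, ℓ, hu, h⟩ := w.exists_adapted_restrict hc (c.map_target hx)
  exact ⟨c.restrict O hO, AManifold.restrict_mem hc hO, ⟨hx, hu⟩, ℓ, h⟩

/-- A chart at `x` in which the weight has constant exponents. -/
def Weight.chartAt (w : Weight M) (x : X) : AChart m X := (w.exists_adapted x).choose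

/-- The exponents of the weight in `w.chartAt x`. -/
def Weight.expAt (w : Weight M) (x : X) : Fin m → ℝ := (w.exists_adapted x).choose_spec.2.2.choose

/-- The fibre at `x` of the line bundle `L_λ`. It is a copy of `ℝ`: for `x` in the interior
through the canonical isomorphism of `L_λ` with the trivial bundle over `X°`, and for `x` in the
boundary through the basis vector `e_c`, where `c = w.chartAt x`. -/
def Weight.Line (_ : Weight M) (_ : X) : Type := ℝ

instance (w : Weight M) (x : X) : AddCommGroup (w.Line x) := inferInstanceAs (AddCommGroup ℝ)
instance (w : Weight M) (x : X) : Module ℝ (w.Line x) := inferInstanceAs (Module ℝ ℝ)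

/-- The vector of the fibre of `L_λ` at `x` that corresponds to `1`; over the interior this is the
canonical section. -/
def Weight.one (w : Weight M) (x : X) : w.Line x := (1 : ℝ)

open Classical in
/-- The logarithm of the basis section of `L_λ` used to trivialise the fibre at `x`, as a function on
the interior near `x`. -/
def Weight.refLog (w : Weight M) (x : X) : X → ℝ :=
  if x ∈ M.interior then fun _ => 0 else (w.chartAt x).logMonomial (w.expAt x)

/-- The coordinate of `w.one x` with respect to the basis vector `e_c` of `L_λ` at `x`, where `c` is
a chart in which the weight has the constant exponents `ℓ`, and `e_c = x_1^(ℓ_1) ⋯ x_k^(ℓ_k)` over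
the interior. At an interior point it is `x_1^(-ℓ_1) ⋯ x_k^(-ℓ_k)`; at a boundary point it is the
limit, from the interior, of the quotient of the two basis sections. -/
def Weight.scale (w : Weight M) (c : AChart m X) (ℓ : Fin m → ℝ) (x : X) : ℝ :=
  Real.exp (limUnder (𝓝[M.interior] x) fun y => w.refLog x y - c.logMonomial ℓ y)

theorem Weight.scale_pos (w : Weight M) (c : AChart m X) (ℓ : Fin m → ℝ) (x : X) :
    0 < w.scale c ℓ x := Real.exp_pos _

/-- The linear coordinate of the fibre of `L_λ` at `x` given by the basis vector `e_c`. -/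
def Weight.lineFrame (w : Weight M) (c : AChart m X) (ℓ : Fin m → ℝ) (x : X) : w.Line x ≃ₗ[ℝ] ℝ :=
  LinearEquiv.smulOfNeZero ℝ ℝ (w.scale c ℓ x) (w.scale_pos c ℓ x).ne'

end Weights

/-- The vector bundle chart of `E ⊗ L_λ` from a vector bundle chart of `E` and a chart in which the
weight has the constant exponents `ℓ`. -/
def VBChart.twist {m r : ℕ} {X : Type*} [TopologicalSpace X] {M : AManifold m X} {E : X → Type*}
    [∀ x, AddCommGroup (E x)] [∀ x, Module ℝ (E x)] (κ : VBChart m r E) (w : Weight M)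
    (c : AChart m X) (ℓ : Fin m → ℝ) : VBChart m r (fun x => E x ⊗[ℝ] w.Line x) where
  chart := c
  frame x := (TensorProduct.congr (κ.frame x) (w.lineFrame c ℓ x)).trans (TensorProduct.rid ℝ _)

section Twist

variable {m r : ℕ} {X : Type*} [TopologicalSpace X] {M : AManifold m X} {E : X → Type*}
    [∀ x, AddCommGroup (E x)] [∀ x, Module ℝ (E x)]

theorem VBChart.twist_frame (κ : VBChart m r E) (w : Weight M)
    (c : AChart m X) (ℓ : Fin m → ℝ) (x : X) (e : E x) (a : Fin r) :
    (κ.twist w c ℓ).frame x (e ⊗ₜ w.one x) a = w.scale c ℓ x * κ.frame x e a := by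
  have : w.lineFrame c ℓ x (w.one x) = w.scale c ℓ x := by
    change w.scale c ℓ x • (1 : ℝ) = _
    simp
  simp [VBChart.twist, this]

theorem VBChart.twist_basisSection (κ : VBChart m r E) (w : Weight M)
    (c : AChart m X) (ℓ : Fin m → ℝ) (x : X) (b : Fin r) :
    (κ.twist w c ℓ).basisSection b x = ((w.scale c ℓ x)⁻¹ • κ.basisSection b x) ⊗ₜ w.one x := by
  rw [VBChart.basisSection, LinearEquiv.symm_apply_eq]
  ext a
  rw [VBChart.twist_frame]
  simp [VBChart.basisSection, (w.scale_pos c ℓ x).ne']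

end Twist

section TwistBundle

variable {m r : ℕ} {X : Type*} [TopologicalSpace X] {M : AManifold m X}

theorem AChart.logMonomial_apply (c : AChart m X) (ℓ : Fin m → ℝ) {u : Fin m → ℝ}
    (hu : u ∈ c.source) : c.logMonomial ℓ (c.toPartialEquiv u) = ∑ i, ℓ i * Real.log (u i) := by
  unfold AChart.logMonomial
  rw [c.left_inv hu]

theorem Weight.Adapted.eq_zero_of_le {w : Weight M} {c : AChart m X} {ℓ : Fin m → ℝ}
    (h : w.Adapted c ℓ) {i : Fin m} (hi : ¬ (i : ℕ) < c.k) : ℓ i = 0 :=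
  h.eq_zero i fun ⟨_, _, h, _⟩ => hi h

/-- The quotient of two local basis sections of `L_λ` is positive and a-smooth. -/
theorem Weight.exists_quotient (w : Weight M) {c c' : AChart m X} (hc : c ∈ M.atlas)
    (hc' : c' ∈ M.atlas) {ℓ ℓ' : Fin m → ℝ} (h : w.Adapted c ℓ) (h' : w.Adapted c' ℓ')
    {u : Fin m → ℝ} (hu : u ∈ c.overlap c') :
    ∃ V, IsOpen V ∧ u ∈ V ∧ ∃ Q : (Fin m → ℝ) → ℝ, ASmoothOn c.k Q (V ∩ c.overlap c') ∧
      ∀ x ∈ V ∩ c.overlap c', x ∈ c.interior →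
        c.logMonomial ℓ (c.toPartialEquiv x) - c'.logMonomial ℓ' (c.toPartialEquiv x) = Q x := by
  obtain ⟨V, hV, huV, F, a, hF⟩ := AManifold.exists_monomial hc hc' hu
  have hmo := c.modelOpen_overlap c'
  set P : Set (Fin m → ℝ) := {x | ∀ j, 0 < u j → 0 < x j} with hP
  have hPo : IsOpen P := by
    have : P = ⋂ j, {x : Fin m → ℝ | 0 < u j → 0 < x j} := by
      ext; simp [hP]
    rw [this]
    refine isOpen_iInter_of_finite fun j => ?_
    by_cases h : 0 < u j
    · simpa [h] using isOpen_lt continuous_const (continuous_apply j)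
    · simp [h]
  have hVP : IsModelOpen c.k ((V ∩ P) ∩ c.overlap c') := hmo.inter_open (hV.inter hPo)
  have hlog : ∀ t : ℝ, 0 < t → ContDiffAt ℝ ∞ (fun s => Real.log s) t := fun t ht =>
    Real.contDiffAt_log.2 ht.ne'
  have hexp : ∀ i : Fin m, (i : ℕ) < c.k → u i = 0 →
      ℓ i = ∑ j : Fin m, if (j : ℕ) < c'.k then a j i * ℓ' j else 0 := by
    intro i hi h0
    rw [← h.eq_coef i hi u hu.1 h0, w.change c hc c' hc' u hu V hV huV F a hF i hi h0]
    refine Finset.sum_congr rfl fun j _ => ?_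
    split_ifs with hj
    · by_cases hz : c.change c' u j = 0
      · rw [h'.eq_coef j hj _ (c.change_mem c' hu) hz]
      · have he := (hF j hj).eq u ⟨huV, hu⟩
        have : a j i = 0 := by
          by_contra hne
          apply hz
          change c.change c' u j = _ at he
          rw [he, Finset.prod_eq_zero (Finset.mem_univ i), mul_zero]
          rw [h0, Real.zero_rpow hne]
        simp [this]
    · rfl
  refine ⟨V ∩ P, hV.inter hPo, ⟨huV, fun _ h => h⟩,
    fun x => (∑ i, if 0 < u i then ℓ i * Real.log (x i) else 0) +
      ∑ j : Fin m, if (j : ℕ) < c'.k then -ℓ' j * Real.log (F j x) else 0, ?_, ?_⟩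
  · refine ASmoothOn.add hVP (ASmoothOn.sum hVP _ fun i _ => ?_)
      (ASmoothOn.sum hVP _ fun j _ => ?_)
    · by_cases hi : 0 < u i
      · simp only [hi, if_true]
        exact (aSmoothOn_const _).mul hVP
          ((aSmoothOn_coord hVP i).comp hVP fun x hx => hlog _ (hx.1.2 i hi))
      · simp only [hi, if_false]; exact aSmoothOn_const 0
    · by_cases hj : (j : ℕ) < c'.k
      · simp only [hj, if_true]
        exact (aSmoothOn_const _).mul hVP
          (((hF j hj).smooth.mono (inter_subset_inter_left _ inter_subset_left)).comp hVP
            fun x hx => hlog _ ((hF j hj).pos x ⟨hx.1.1, hx.2⟩))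
      · simp only [hj, if_false]; exact aSmoothOn_const 0
  · rintro x ⟨⟨hxV, hxP⟩, hxo⟩ hxi
    rw [c.logMonomial_apply ℓ hxo.1]
    have e2 : c'.logMonomial ℓ' (c.toPartialEquiv x) =
        ∑ j : Fin m, if (j : ℕ) < c'.k then
          ℓ' j * (Real.log (F j x) + ∑ i, a j i * Real.log (x i)) else 0 := by
      unfold AChart.logMonomial
      refine Finset.sum_congr rfl fun j _ => ?_
      split_ifs with hj
      · have he := (hF j hj).eq x ⟨hxV, hxo⟩
        have hpos : ∀ i, 0 < x i ^ a j i := fun i => by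
          by_cases hi : (i : ℕ) < c.k
          · exact Real.rpow_pos_of_pos (hxi.2 i hi) _
          · rw [(hF j hj).exp_eq_zero i fun h => hi h.1, Real.rpow_zero]; exact one_pos
        change c'.toPartialEquiv.symm (c.toPartialEquiv x) j = _ at he
        rw [he, Real.log_mul ((hF j hj).pos x ⟨hxV, hxo⟩).ne'
          (Finset.prod_pos fun i _ => hpos i).ne', Real.log_prod (fun i _ => (hpos i).ne')]
        congr 2
        refine Finset.sum_congr rfl fun i _ => ?_
        by_cases hi : (i : ℕ) < c.k
        · rw [Real.log_rpow (hxi.2 i hi)]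
        · rw [(hF j hj).exp_eq_zero i fun h => hi h.1]; simp
      · rw [h'.eq_zero_of_le hj, zero_mul]
    have e3 : (∑ j : Fin m, if (j : ℕ) < c'.k then
          ℓ' j * (Real.log (F j x) + ∑ i, a j i * Real.log (x i)) else 0) =
        (∑ j : Fin m, if (j : ℕ) < c'.k then ℓ' j * Real.log (F j x) else 0) +
        ∑ i, (∑ j : Fin m, if (j : ℕ) < c'.k then a j i * ℓ' j else 0) * Real.log (x i) := by
      simp_rw [Finset.sum_mul]
      rw [Finset.sum_comm, ← Finset.sum_add_distrib]
      refine Finset.sum_congr rfl fun j _ => ?_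
      split_ifs with hj
      · rw [mul_add, Finset.mul_sum]
        congr 1
        exact Finset.sum_congr rfl fun i _ => by ring
      · simp
    have e4 : (∑ i, (∑ j : Fin m, if (j : ℕ) < c'.k then a j i * ℓ' j else 0) * Real.log (x i)) =
        ∑ i, if 0 < u i then 0 else ℓ i * Real.log (x i) := by
      refine Finset.sum_congr rfl fun i _ => ?_
      by_cases hi : (i : ℕ) < c.k ∧ u i = 0
      · rw [if_neg (by rw [hi.2]; exact lt_irrefl _), ← hexp i hi.1 hi.2]
      · have hz : (∑ j : Fin m, if (j : ℕ) < c'.k then a j i * ℓ' j else 0) = 0 :=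
          Finset.sum_eq_zero fun j _ => by
            split_ifs with hj
            · rw [(hF j hj).exp_eq_zero i hi, zero_mul]
            · rfl
        rw [hz, zero_mul]
        by_cases hk : (i : ℕ) < c.k
        · rw [if_pos]
          exact lt_of_le_of_ne (hmo.nonneg hu hk) fun h0 => hi ⟨hk, h0.symm⟩
        · rw [h.eq_zero_of_le hk]; simp
    have e5 : (∑ i, ℓ i * Real.log (x i)) = (∑ i, if 0 < u i then ℓ i * Real.log (x i) else 0) +
        ∑ i, if 0 < u i then 0 else ℓ i * Real.log (x i) := by
      rw [← Finset.sum_add_distrib]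
      refine Finset.sum_congr rfl fun i _ => ?_
      split_ifs <;> simp
    have e6 : (∑ j : Fin m, if (j : ℕ) < c'.k then -ℓ' j * Real.log (F j x) else 0) =
        -∑ j : Fin m, if (j : ℕ) < c'.k then ℓ' j * Real.log (F j x) else 0 := by
      rw [← Finset.sum_neg_distrib]
      refine Finset.sum_congr rfl fun j _ => ?_
      split_ifs <;> simp
    beta_reduce
    rw [e2, e3, e4, e5, e6]
    ring

theorem AChart.tendsto_quotient {c c' : AChart m X} (hc : c ∈ M.atlas)
    {ℓ ℓ' : Fin m → ℝ} {u : Fin m → ℝ} (hu : u ∈ c.overlap c') {V : Set (Fin m → ℝ)}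
    (hV : IsOpen V) (huV : u ∈ V) {Q : (Fin m → ℝ) → ℝ} (hQ : ASmoothOn c.k Q (V ∩ c.overlap c'))
    (h : ∀ x ∈ V ∩ c.overlap c', x ∈ c.interior →
        c.logMonomial ℓ (c.toPartialEquiv x) - c'.logMonomial ℓ' (c.toPartialEquiv x) = Q x) :
    Tendsto (fun y => c.logMonomial ℓ y - c'.logMonomial ℓ' y)
      (𝓝[M.interior] (c.toPartialEquiv u)) (𝓝 (Q u)) := by
  have hsymm : ContinuousAt c.toPartialEquiv.symm (c.toPartialEquiv u) :=
    c.continuousOn_invFun.continuousAt (c.isOpen_target.mem_nhds (c.map_source hu.1))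
  have hsu : c.toPartialEquiv.symm (c.toPartialEquiv u) = u := c.left_inv hu.1
  have hev : ∀ᶠ y in 𝓝 (c.toPartialEquiv u), y ∈ c.target ∧ y ∈ c'.target ∧
      c.toPartialEquiv.symm y ∈ V :=
    (c.isOpen_target.eventually_mem (c.map_source hu.1)).and
      ((c'.isOpen_target.eventually_mem hu.2).and
        (hsymm.eventually_mem (by rw [hsu]; exact hV.mem_nhds huV)))
  have hmem : ∀ y, (y ∈ c.target ∧ y ∈ c'.target ∧ c.toPartialEquiv.symm y ∈ V) →
      c.toPartialEquiv.symm y ∈ V ∩ c.overlap c' := fun y hy =>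
    ⟨hy.2.2, c.map_target hy.1, by rw [mem_preimage, c.right_inv hy.1]; exact hy.2.1⟩
  have hT : Tendsto c.toPartialEquiv.symm (𝓝[M.interior] (c.toPartialEquiv u))
      (𝓝[V ∩ c.overlap c'] u) := by
    refine tendsto_nhdsWithin_iff.2 ⟨?_, ?_⟩
    · have := hsymm.tendsto
      rw [hsu] at this
      exact this.mono_left nhdsWithin_le_nhds
    · exact (hev.filter_mono nhdsWithin_le_nhds).mono hmem
  refine ((hQ.continuousOn u ⟨huV, hu⟩).tendsto.comp hT).congr' ?_
  filter_upwards [hev.filter_mono nhdsWithin_le_nhds, self_mem_nhdsWithin] with y hy hyi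
  have := h _ (hmem y hy) ((AManifold.mem_interior_iff hc (c.map_target hy.1)).1 (by
    rw [c.right_inv hy.1]; exact hyi))
  rw [c.right_inv hy.1] at this
  exact this.symm

/-- The limit in the definition of `Weight.scale` exists. -/
theorem Weight.exists_tendsto (w : Weight M) {c : AChart m X} (hc : c ∈ M.atlas)
    {ℓ : Fin m → ℝ} (h : w.Adapted c ℓ) {x : X} (hx : x ∈ c.target) :
    ∃ l, Tendsto (fun y => w.refLog x y - c.logMonomial ℓ y) (𝓝[M.interior] x) (𝓝 l) := by
  by_cases hxi : x ∈ M.interior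
  · have hu : c.toPartialEquiv.symm x ∈ c.interior := by
      rw [← AManifold.mem_interior_iff hc (c.map_target hx), c.right_inv hx]; exact hxi
    have hsymm : ContinuousAt c.toPartialEquiv.symm x :=
      c.continuousOn_invFun.continuousAt (c.isOpen_target.mem_nhds hx)
    simp only [Weight.refLog, hxi, if_true, zero_sub]
    refine ⟨-c.logMonomial ℓ x, (Tendsto.neg (l := 𝓝 x) ?_).mono_left nhdsWithin_le_nhds⟩
    unfold AChart.logMonomial
    refine tendsto_finsetSum _ fun i _ => ?_
    by_cases hi : (i : ℕ) < c.k
    · exact ((continuousAt_pi.1 hsymm i).tendsto.log (hu.2 i hi).ne').const_mul _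
    · rw [h.eq_zero_of_le hi]; simp
  · have hs := (w.exists_adapted x).choose_spec
    have hc0 : w.chartAt x ∈ M.atlas := hs.1
    have hx0 : x ∈ (w.chartAt x).target := hs.2.1
    have ha0 : w.Adapted (w.chartAt x) (w.expAt x) := hs.2.2.choose_spec
    have hxe := (w.chartAt x).right_inv hx0
    have hu : (w.chartAt x).toPartialEquiv.symm x ∈ (w.chartAt x).overlap c :=
      ⟨(w.chartAt x).map_target hx0, by rw [mem_preimage, hxe]; exact hx⟩
    obtain ⟨V, hV, huV, Q, hQ, h3⟩ := w.exists_quotient hc0 hc ha0 h hu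
    have := AChart.tendsto_quotient hc0 hu hV huV hQ h3
    rw [hxe] at this
    simp only [Weight.refLog, hxi, if_false]
    exact ⟨_, this⟩

theorem Weight.scale_quotient (w : Weight M) {c c' : AChart m X} (hc : c ∈ M.atlas)
    {ℓ ℓ' : Fin m → ℝ} (h : w.Adapted c ℓ) {l : ℝ} {x : X} (hx : x ∈ c.target)
    (hl : Tendsto (fun y => c.logMonomial ℓ y - c'.logMonomial ℓ' y) (𝓝[M.interior] x) (𝓝 l)) :
    w.scale c' ℓ' x = w.scale c ℓ x * Real.exp l := by
  have := M.nhdsWithin_interior_neBot x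
  obtain ⟨l1, h1⟩ := w.exists_tendsto hc h hx
  have h2 : Tendsto (fun y => w.refLog x y - c'.logMonomial ℓ' y) (𝓝[M.interior] x)
      (𝓝 (l1 + l)) := (h1.add hl).congr fun y => by ring
  rw [Weight.scale, Weight.scale, h1.limUnder_eq, h2.limUnder_eq, Real.exp_add]

theorem Weight.aSmoothOn_scale (w : Weight M) {c c' : AChart m X} (hc : c ∈ M.atlas)
    (hc' : c' ∈ M.atlas) {ℓ ℓ' : Fin m → ℝ} (h : w.Adapted c ℓ) (h' : w.Adapted c' ℓ') :
    ASmoothOn c.k (fun u => w.scale c' ℓ' (c.toPartialEquiv u) *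
      (w.scale c ℓ (c.toPartialEquiv u))⁻¹) (c.overlap c') := by
  refine ASmoothOn.of_local (c.modelOpen_overlap c') fun u hu => ?_
  obtain ⟨V, hV, huV, Q, hQ, h3⟩ := w.exists_quotient hc hc' h h' hu
  have hmo := (c.modelOpen_overlap c').inter_open hV
  refine ⟨V, hV, huV, (hQ.comp hmo (φ := Real.exp) fun x _ => Real.contDiff_exp.contDiffAt).congr hmo
    fun x hx => ?_⟩
  have := AChart.tendsto_quotient hc hx.2 hV hx.1 hQ h3
  rw [w.scale_quotient hc h (c.map_source hx.2.1) this]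
  field_simp [(w.scale_pos c ℓ (c.toPartialEquiv x)).ne']

end TwistBundle

/-- The vector bundle `E ⊗ L_λ`. -/
def AVectorBundle.twist.{u, v} {m r : ℕ} {X : Type u} [TopologicalSpace X] {M : AManifold m X}
    (E : AVectorBundle.{u, v} M r) (w : Weight M) : AVectorBundle.{u, v} M r where
  Fiber x := E.Fiber x ⊗[ℝ] w.Line x
  atlas := {κ' | ∃ κ ∈ E.atlas, ∃ c ∈ M.atlas, ∃ ℓ, w.Adapted c ℓ ∧ c.IsRestriction κ.chart ∧
    κ' = κ.twist w c ℓ}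
  chart_mem := by
    rintro _ ⟨κ, hκ, c, hc, ℓ, h, hr, rfl⟩
    exact hc
  cover x := by
    obtain ⟨κ, hκ, hx⟩ := E.cover x
    obtain ⟨O, hO, ℓ, hu, h⟩ := w.exists_adapted_restrict (E.chart_mem κ hκ) (κ.chart.map_target hx)
    exact ⟨_, ⟨κ, hκ, _, AManifold.restrict_mem (E.chart_mem κ hκ) hO, ℓ, h,
      κ.chart.restrict_isRestriction hO, rfl⟩, hx, hu⟩
  smooth_transition := by
    rintro _ ⟨κ, hκ, c, hc, ℓ, h, hr, rfl⟩ _ ⟨κ', hκ', c', hc', ℓ', h', hr', rfl⟩ a b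
    have hmo := c'.modelOpen_overlap c
    have htar : c.target ⊆ κ.chart.target := fun x hx => by
      have h1 := c.map_target hx
      have h2 := hr.eqOn h1
      rw [c.right_inv hx] at h2
      rw [h2]
      exact κ.chart.map_source (hr.source_subset h1)
    have hsub : c'.overlap c ⊆ κ'.chart.overlap κ.chart := fun u hu =>
      ⟨hr'.source_subset hu.1, by rw [mem_preimage, ← hr'.eqOn hu.1]; exact htar hu.2⟩
    have hE := E.smooth_transition κ hκ κ' hκ' a b
    rw [← hr'.k_eq] at hE
    have hpos : ∀ x, 0 < w.scale c ℓ (c'.toPartialEquiv x) *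
        (w.scale c' ℓ' (c'.toPartialEquiv x))⁻¹ := fun x =>
      mul_pos (w.scale_pos _ _ _) (inv_pos.2 (w.scale_pos _ _ _))
    refine ASmoothOn.congr hmo (ASmoothOn.mul hmo ((w.aSmoothOn_scale hc' hc h' h).comp hmo
      (φ := fun t => t⁻¹) fun x _ => contDiffAt_inv ℝ (hpos x).ne') (hE.mono hsub)) fun u hu => ?_
    change _ = (κ'.twist w c' ℓ').frame (c'.toPartialEquiv u)
      ((κ.twist w c ℓ).basisSection b (c'.toPartialEquiv u)) a
    rw [VBChart.twist_basisSection, VBChart.twist_frame, map_smul, VBChart.coords,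
      ← hr'.eqOn hu.1, Pi.smul_apply, smul_eq_mul, mul_inv_rev, inv_inv, mul_assoc]

/-! ### b-metrics, fibre metrics and b-connections -/

section Geometry

variable {m r : ℕ} {X : Type*} [TopologicalSpace X] {M : AManifold m X}

/-- The section `s` of `E` is a-smooth on the open set `W`. -/
def AVectorBundle.SmoothOn (E : AVectorBundle M r) (s : ∀ x, E.Fiber x) (W : Set X) : Prop :=
  ∀ κ ∈ E.atlas, ∀ a : Fin r,
    ASmoothOn κ.chart.k (fun u => κ.coords s u a)
      (κ.chart.source ∩ κ.chart.toPartialEquiv ⁻¹' W)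

/-- A b-metric, that is, an a-smooth positive definite section of `S²(ᵇT*X)`, through its components
`comp c u i j = g(v_i, v_j)`, where `v_1, …, v_m` is the basis of b-vector fields of the chart `c`
(`v_i = x_i ∂/∂x_i` for boundary coordinates, `v_i = ∂/∂x_i` for the others). The law of
transformation is imposed in the interior; it extends to the boundary by continuity. The values
`comp c u` for `c` outside the atlas or `u` outside the domain of `c` are irrelevant. -/
structure BMetric (M : AManifold m X) where
  comp : AChart m X → (Fin m → ℝ) → Matrix (Fin m) (Fin m) ℝ
  smooth : ∀ c ∈ M.atlas, ∀ i j, ASmoothOn c.k (fun u => comp c u i j) c.source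
  posDef : ∀ c ∈ M.atlas, ∀ u ∈ c.source, (comp c u).PosDef
  change : ∀ c ∈ M.atlas, ∀ c' ∈ M.atlas, ∀ u ∈ c.overlap c', u ∈ c.interior →
    comp c u = (c.bJacobian c' u)ᵀ * comp c' (c.change c' u) * c.bJacobian c' u

/-- An a-smooth metric on the fibres of `E`. -/
structure FibreMetric (E : AVectorBundle M r) where
  form : ∀ x, E.Fiber x →ₗ[ℝ] E.Fiber x →ₗ[ℝ] ℝ
  symm : ∀ x e f, form x e f = form x f e
  pos : ∀ x e, e ≠ 0 → 0 < form x e e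
  smooth : ∀ κ ∈ E.atlas, ∀ a b : Fin r,
    ASmoothOn κ.chart.k (fun u => form (κ.chart.toPartialEquiv u)
      (κ.basisSection a (κ.chart.toPartialEquiv u)) (κ.basisSection b (κ.chart.toPartialEquiv u)))
      κ.chart.source

/-- A b-connection on `E`. Here `toFun c i s` is the covariant derivative `∇_(v_i) s` of the section
`s` along the `i`-th basis b-vector field `v_i` of the chart `c`; its values matter only in the image
of `c` and at points near which `s` is a-smooth. Over every open set the operator maps a-smooth
sections of `E` to a-smooth sections of `E ⊗ ᵇT*X`, is additive and satisfies the Leibniz rule (so it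
is local and linear over `ℝ`). -/
structure BConnection (E : AVectorBundle M r) where
  toFun : AChart m X → Fin m → (∀ x, E.Fiber x) → ∀ x, E.Fiber x
  smooth : ∀ c ∈ M.atlas, ∀ i, ∀ W, IsOpen W → ∀ s, E.SmoothOn s W →
    E.SmoothOn (toFun c i s) (W ∩ c.target)
  map_add : ∀ c ∈ M.atlas, ∀ i, ∀ W, IsOpen W → ∀ s t, E.SmoothOn s W → E.SmoothOn t W →
    ∀ x ∈ W ∩ c.target, toFun c i (s + t) x = toFun c i s x + toFun c i t x
  leibniz : ∀ c ∈ M.atlas, ∀ i, ∀ W, IsOpen W → ∀ (f : X → ℝ) (s : ∀ x, E.Fiber x),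
    M.SmoothOn f W → E.SmoothOn s W → ∀ x ∈ W ∩ c.target,
      toFun c i (fun y => f y • s y) x = f x • toFun c i s x +
        bDeriv c.k i (fun u => f (c.toPartialEquiv u)) (c.toPartialEquiv.symm x) • s x
  change : ∀ c ∈ M.atlas, ∀ c' ∈ M.atlas, ∀ W, IsOpen W → ∀ s, E.SmoothOn s W →
    ∀ u ∈ c.overlap c', u ∈ c.interior → c.toPartialEquiv u ∈ W → ∀ i,
      toFun c i s (c.toPartialEquiv u) =
        ∑ j, c.bJacobian c' u j i • toFun c' j s (c.toPartialEquiv u)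

/-- The Christoffel symbols `Γ^l_(ij)` of the Levi-Civita b-connection in a chart:
`∇_(v_i) v_j = ∑_l Γ^l_(ij) v_l`, where `v_1, …, v_m` are the basis b-vector fields of the chart,
which commute. -/
def BMetric.christoffel (g : BMetric M) (c : AChart m X) (u : Fin m → ℝ) (l i j : Fin m) : ℝ :=
  2⁻¹ * ∑ q, (g.comp c u)⁻¹ l q *
    (bDeriv c.k i (fun v => g.comp c v j q) u + bDeriv c.k j (fun v => g.comp c v i q) u
      - bDeriv c.k q (fun v => g.comp c v i j) u)

/-- The density of the volume measure of `g` on the interior, in the coordinates of a chart. -/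
def BMetric.density (g : BMetric M) (c : AChart m X) (u : Fin m → ℝ) : ℝ :=
  √(g.comp c u).det * ∏ i, (bCoef c.k i u)⁻¹

/-- The components of a fibre metric in a vector bundle chart. -/
def FibreMetric.comp {E : AVectorBundle M r} (h : FibreMetric E) (κ : VBChart m r E.Fiber)
    (u : Fin m → ℝ) : Matrix (Fin r) (Fin r) ℝ :=
  Matrix.of fun a b => h.form (κ.chart.toPartialEquiv u)
    (κ.basisSection a (κ.chart.toPartialEquiv u)) (κ.basisSection b (κ.chart.toPartialEquiv u))

/-- The connection matrices of a b-connection in a vector bundle chart: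
`∇_(v_i) e_b = ∑_a (connForm κ i u) a b • e_a`, where `e_1, …, e_r` are the local basis sections. -/
def BConnection.connForm {E : AVectorBundle M r} (D : BConnection E) (κ : VBChart m r E.Fiber)
    (i : Fin m) (u : Fin m → ℝ) : Matrix (Fin r) (Fin r) ℝ :=
  Matrix.of fun a b => κ.coords (D.toFun κ.chart i (κ.basisSection b)) u a

end Geometry

/-! ### Sections over the interior, and their weak covariant derivatives -/

section Sections

variable {m r : ℕ} {X : Type*} [TopologicalSpace X] {M : AManifold m X}

/-- Sections (not necessarily continuous) of `E` over the interior. -/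
abbrev AVectorBundle.InteriorSection (E : AVectorBundle M r) := ∀ x : M.interior, E.Fiber x

open Classical in
/-- The fibre coordinates of a section over the interior, as functions on `κ.chart.interior`
(extended by zero). -/
def VBChart.interiorCoords {E : AVectorBundle M r} (κ : VBChart m r E.Fiber)
    (e : E.InteriorSection) : (Fin m → ℝ) → Fin r → ℝ :=
  κ.coords fun x => if h : x ∈ M.interior then e ⟨x, h⟩ else 0

/-- `v` is the weak partial derivative `∂f/∂x_i` on the open subset `Ω` of `ℝ^m`, where `f` and `v`
are locally integrable on `Ω`. -/
structure HasWeakPartial {m : ℕ} (Ω : Set (Fin m → ℝ)) (i : Fin m) (f v : (Fin m → ℝ) → ℝ) :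
    Prop where
  locallyIntegrableOn : LocallyIntegrableOn f Ω
  locallyIntegrableOn_deriv : LocallyIntegrableOn v Ω
  integral_eq : ∀ φ : (Fin m → ℝ) → ℝ, ContDiff ℝ ∞ φ → HasCompactSupport φ → tsupport φ ⊆ Ω →
    ∫ x in Ω, f x * lineDeriv ℝ φ x (Pi.single i 1) = -∫ x in Ω, v x * φ x

/-- The indices of the components of a section of `E ⊗ ⨂^j ᵇT*X`. -/
abbrev TIdx (r m j : ℕ) : Type := Fin r × (Fin j → Fin m)

/-- The components of a section of `E ⊗ ⨂^j ᵇT*X` in a vector bundle chart. -/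
abbrev TComp (r m j : ℕ) : Type := TIdx r m j → (Fin m → ℝ) → ℝ

/-- The zeroth order part of the covariant derivative along the `i`-th basis b-vector field on
`E ⊗ ⨂^j ᵇT*X`: the connection matrices of `D` act on the index of `E`, and minus the Christoffel
symbols of `g` act on each of the indices of `ᵇT*X`. -/
def connTerm {E : AVectorBundle M r} (g : BMetric M) (D : BConnection E) (κ : VBChart m r E.Fiber)
    {j : ℕ} (i : Fin m) (t : TComp r m j) (I : TIdx r m j) (u : Fin m → ℝ) : ℝ :=
  (∑ b, D.connForm κ i u I.1 b * t (b, I.2) u) -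
    ∑ s, ∑ l, g.christoffel κ.chart u l i (I.2 s) * t (I.1, Function.update I.2 s l) u

/-- In the vector bundle chart `κ`, the section `e` is `k` times weakly differentiable and, for
`j ≤ k`, the functions `t j` are the components of its `j`-th covariant derivative `∇^j e`, a section
of `E ⊗ ⨂^j ᵇT*X` over the interior. (The index of the last derivative comes last.) -/
structure IsWeakJet {E : AVectorBundle M r} (g : BMetric M) (D : BConnection E)
    (κ : VBChart m r E.Fiber) (k : ℕ) (e : E.InteriorSection) (t : ∀ j, TComp r m j) : Prop where
  zero : ∀ᵐ u ∂volume.restrict κ.chart.interior, ∀ I, t 0 I u = κ.interiorCoords e u I.1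
  locallyIntegrableOn : ∀ j ≤ k, ∀ I, LocallyIntegrableOn (t j I) κ.chart.interior
  succ : ∀ j < k, ∀ (I : TIdx r m j) (i : Fin m), ∃ v,
    HasWeakPartial κ.chart.interior i (t j I) v ∧
    ∀ᵐ u ∂volume.restrict κ.chart.interior, t (j + 1) (I.1, Fin.snoc I.2 i) u =
      bCoef κ.chart.k i u * v u + connTerm g D κ i (t j) I u

/-- The components of the metric on the fibres of `E ⊗ ⨂^j ᵇT*X` which is induced by the metric `h`
on `E` and the inverse of `g`. -/
def tensorMetric {E : AVectorBundle M r} (g : BMetric M) (h : FibreMetric E)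
    (κ : VBChart m r E.Fiber) (j : ℕ) (u : Fin m → ℝ) : Matrix (TIdx r m j) (TIdx r m j) ℝ :=
  Matrix.of fun I J => h.comp κ u I.1 J.1 * ∏ s, (g.comp κ.chart u)⁻¹ (I.2 s) (J.2 s)

/-- The pointwise norm of a section of `E ⊗ ⨂^j ᵇT*X`. -/
def tensorNorm {E : AVectorBundle M r} (g : BMetric M) (h : FibreMetric E)
    (κ : VBChart m r E.Fiber) (j : ℕ) (t : TComp r m j) (u : Fin m → ℝ) : ℝ :=
  √(∑ I, ∑ J, tensorMetric g h κ j u I J * t I u * t J u)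

end Sections

/-! ### Integration over the interior -/

/-- A finite cover of `X` by compact subsets of the images of vector bundle charts. -/
structure AVectorBundle.Pieces {m r : ℕ} {X : Type*} [TopologicalSpace X] {M : AManifold m X}
    (E : AVectorBundle M r) where
  card : ℕ
  triv : Fin card → VBChart m r E.Fiber
  triv_mem : ∀ n, triv n ∈ E.atlas
  compact : Fin card → Set X
  isCompact : ∀ n, IsCompact (compact n)
  subset : ∀ n, compact n ⊆ (triv n).chart.target
  cover : ⋃ n, compact n = univ

section Integration

variable {m r : ℕ} {X : Type*} [TopologicalSpace X] {M : AManifold m X}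

theorem AVectorBundle.nonempty_pieces [T2Space X] [CompactSpace X] (E : AVectorBundle M r) :
    Nonempty E.Pieces := by
  choose κ hκ hx using E.cover
  have h : ∀ x, ∃ K, IsCompact K ∧ K ⊆ (κ x).chart.target ∧ K ∈ 𝓝 x := fun x => by
    obtain ⟨K, hK, hKs, hKc⟩ := LocallyCompactSpace.local_compact_nhds x _
      ((κ x).chart.isOpen_target.mem_nhds (hx x))
    exact ⟨K, hKc, hKs, hK⟩
  choose K hKc hKs hK using h
  obtain ⟨t, ht⟩ := CompactSpace.elim_nhds_subcover K hK
  let f : Fin t.card ≃ t := t.equivFin.symm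
  exact ⟨⟨t.card, fun n => κ (f n), fun n => hκ _, fun n => K (f n), fun n => hKc _,
    fun n => hKs _, by
      refine eq_univ_of_forall fun x => ?_
      have hx : x ∈ ⋃ y ∈ t, K y := by rw [ht]; trivial
      obtain ⟨y, hy, hxy⟩ := mem_iUnion₂.1 hx
      exact mem_iUnion.2 ⟨f.symm ⟨y, hy⟩, by simpa using hxy⟩⟩⟩

/-- Once and for all, a finite cover of `X` by compact subsets of the images of charts of `E`. It
serves only to split integrals over the interior into integrals in charts. -/
def AVectorBundle.pieces [T2Space X] [CompactSpace X] (E : AVectorBundle M r) : E.Pieces :=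
  Classical.choice E.nonempty_pieces

/-- The points of the interior which lie in the `n`-th set of the cover, but not in an earlier one,
in the coordinates of the `n`-th chart. -/
def AVectorBundle.Pieces.domain {E : AVectorBundle M r} (P : E.Pieces) (n : Fin P.card) :
    Set (Fin m → ℝ) :=
  {u ∈ (P.triv n).chart.interior | (P.triv n).chart.toPartialEquiv u ∈ P.compact n ∧
    ∀ i < n, (P.triv n).chart.toPartialEquiv u ∉ P.compact i}

/-- The integral over the interior, with respect to the volume measure of `g`, of the function given
by `f n` in the coordinates of the `n`-th chart of `P`. -/
def AVectorBundle.Pieces.integral {E : AVectorBundle M r} (P : E.Pieces) (g : BMetric M)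
    (f : Fin P.card → (Fin m → ℝ) → ℝ) : ℝ≥0∞ :=
  ∑ n, ∫⁻ u in P.domain n, ENNReal.ofReal (f n u * g.density (P.triv n).chart u)

/-- The integral `∫ |t|^p dV` over the interior, for a section `t` of `E ⊗ ⨂^j ᵇT*X` with the
components `t n` in the `n`-th chart of `P`. -/
def AVectorBundle.Pieces.normIntegral {E : AVectorBundle M r} (P : E.Pieces) (g : BMetric M)
    (h : FibreMetric E) (p : ℝ) (j : ℕ) (t : Fin P.card → TComp r m j) : ℝ≥0∞ :=
  P.integral g fun n u => tensorNorm g h (P.triv n) j (t n) u ^ p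

/-- The norm `(∫ |e|^p dV)^(1/p)` of a section over the interior. -/
def lpNorm [T2Space X] [CompactSpace X] {E : AVectorBundle M r} (g : BMetric M) (h : FibreMetric E)
    (p : ℝ) (e : E.InteriorSection) : ℝ≥0∞ :=
  (E.pieces.normIntegral g h p 0 fun n I u => (E.pieces.triv n).interiorCoords e u I.1) ^ (1 / p)

/-- The norm `(∑_(j ≤ k) ∫ |∇^j e|^p dV)^(1/p)` of a section over the interior; it is `∞` if `e` is
not `k` times weakly differentiable. The infimum is over all versions `t n` of the weak derivatives
of `e` in the `n`-th chart of the cover; they agree almost everywhere, and give the same value. -/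
def sobolevNorm [T2Space X] [CompactSpace X] {E : AVectorBundle M r} (g : BMetric M)
    (h : FibreMetric E) (D : BConnection E) (p : ℝ) (k : ℕ) (e : E.InteriorSection) : ℝ≥0∞ :=
  (⨅ (t : ∀ _ : Fin E.pieces.card, ∀ j, TComp r m j)
    (_ : ∀ n, IsWeakJet g D (E.pieces.triv n) k e (t n)),
    ∑ j ∈ Finset.range (k + 1), E.pieces.normIntegral g h p j fun n => t n j) ^ (1 / p)

end Integration

/-! ### Facts that make the spaces below well defined -/

section Facts

variable {m r : ℕ} {X : Type*} [TopologicalSpace X] {M : AManifold m X} {E : AVectorBundle M r}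

theorem AChart.isOpen_interior (c : AChart m X) : IsOpen c.interior := by
  obtain ⟨O, hO, h⟩ := c.modelOpen_source
  have : c.interior = O ∩ ⋂ i : Fin m, {u : Fin m → ℝ | (i : ℕ) < c.k → 0 < u i} := by
    ext u
    simp only [AChart.interior, h, quadrant, mem_inter_iff, mem_ofPred_eq, mem_iInter]
    exact ⟨fun hu => ⟨hu.1.1, hu.2⟩, fun hu => ⟨⟨hu.1, fun i hi => (hu.2 i hi).le⟩, hu.2⟩⟩
  rw [this]
  refine hO.inter (isOpen_iInter_of_finite fun i => ?_)
  by_cases hi : (i : ℕ) < c.k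
  · simpa [hi] using isOpen_lt continuous_const (continuous_apply i)
  · simp [hi]

theorem VBChart.interiorCoords_eq (κ : VBChart m r E.Fiber) (e : E.InteriorSection)
    {u : Fin m → ℝ} (hu : κ.chart.toPartialEquiv u ∈ M.interior) :
    κ.interiorCoords e u = κ.frame (κ.chart.toPartialEquiv u) (e ⟨_, hu⟩) := by
  simp [VBChart.interiorCoords, VBChart.coords, hu]

theorem VBChart.interiorCoords_add (κ : VBChart m r E.Fiber) (e f : E.InteriorSection)
    (u : Fin m → ℝ) : κ.interiorCoords (e + f) u = κ.interiorCoords e u + κ.interiorCoords f u := by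
  unfold VBChart.interiorCoords VBChart.coords
  by_cases h : κ.chart.toPartialEquiv u ∈ M.interior <;> simp [h]

theorem VBChart.interiorCoords_smul (κ : VBChart m r E.Fiber) (a : ℝ) (e : E.InteriorSection)
    (u : Fin m → ℝ) : κ.interiorCoords (a • e) u = a • κ.interiorCoords e u := by
  unfold VBChart.interiorCoords VBChart.coords
  by_cases h : κ.chart.toPartialEquiv u ∈ M.interior <;> simp [h]

theorem VBChart.interiorCoords_zero (κ : VBChart m r E.Fiber) (u : Fin m → ℝ) :
    κ.interiorCoords (0 : E.InteriorSection) u = 0 := by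
  simpa using κ.interiorCoords_smul 0 (0 : E.InteriorSection) u

theorem integrableOn_mul_test {Ω : Set (Fin m → ℝ)} {f ψ : (Fin m → ℝ) → ℝ}
    (hf : LocallyIntegrableOn f Ω) (hψ : Continuous ψ) {K : Set (Fin m → ℝ)} (hK : IsCompact K)
    (hKΩ : K ⊆ Ω) (h0 : ∀ x, x ∉ K → ψ x = 0) : IntegrableOn (fun x => f x * ψ x) Ω := by
  have h1 : IntegrableOn (fun x => f x * ψ x) K :=
    (hf.integrableOn_compact_subset hKΩ hK).mul_continuousOn hψ.continuousOn hK
  exact (h1.integrable_of_forall_notMem_eq_zero fun x hx => by rw [h0 x hx, mul_zero]).integrableOn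

theorem lineDeriv_test {φ : (Fin m → ℝ) → ℝ} (hφ : ContDiff ℝ ∞ φ) (i : Fin m) :
    Continuous (fun x => lineDeriv ℝ φ x (Pi.single i 1)) ∧
      ∀ x, x ∉ tsupport φ → lineDeriv ℝ φ x (Pi.single i 1) = 0 := by
  have h : ∀ x, lineDeriv ℝ φ x (Pi.single i 1) = fderiv ℝ φ x (Pi.single i 1) := fun x =>
    (hφ.differentiable (by simp) x).lineDeriv_eq_fderiv
  constructor
  · simp_rw [h]
    exact (hφ.continuous_fderiv (by simp)).clm_apply continuous_const
  · intro x hx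
    rw [h, fderiv_of_notMem_tsupport (𝕜 := ℝ) hx]
    rfl

theorem HasWeakPartial.add {Ω : Set (Fin m → ℝ)} {i : Fin m} {f f' v v' : (Fin m → ℝ) → ℝ}
    (h : HasWeakPartial Ω i f v) (h' : HasWeakPartial Ω i f' v') :
    HasWeakPartial Ω i (f + f') (v + v') where
  locallyIntegrableOn := h.1.add h'.1
  locallyIntegrableOn_deriv := h.2.add h'.2
  integral_eq φ hφ hc hs := by
    obtain ⟨c1, c2⟩ := lineDeriv_test hφ i
    have z : ∀ x, x ∉ tsupport φ → φ x = 0 := fun x hx => image_eq_zero_of_notMem_tsupport hx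
    simp only [Pi.add_apply, add_mul]
    rw [integral_add (integrableOn_mul_test h.1 c1 hc hs c2)
      (integrableOn_mul_test h'.1 c1 hc hs c2),
      integral_add (integrableOn_mul_test h.2 hφ.continuous hc hs z)
      (integrableOn_mul_test h'.2 hφ.continuous hc hs z), h.3 φ hφ hc hs, h'.3 φ hφ hc hs]
    ring

theorem HasWeakPartial.smul {Ω : Set (Fin m → ℝ)} {i : Fin m} {f v : (Fin m → ℝ) → ℝ}
    (h : HasWeakPartial Ω i f v) (a : ℝ) : HasWeakPartial Ω i (a • f) (a • v) where
  locallyIntegrableOn := h.1.smul a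
  locallyIntegrableOn_deriv := h.2.smul a
  integral_eq φ hφ hc hs := by
    simp only [Pi.smul_apply, smul_eq_mul, mul_assoc]
    rw [integral_const_mul, integral_const_mul, h.3 φ hφ hc hs]
    ring

theorem connTerm_add (g : BMetric M) (D : BConnection E) (κ : VBChart m r E.Fiber)
    {j : ℕ} (i : Fin m) (t t' : TComp r m j) (I : TIdx r m j) (u : Fin m → ℝ) :
    connTerm g D κ i (t + t') I u = connTerm g D κ i t I u + connTerm g D κ i t' I u := by
  simp only [connTerm, Pi.add_apply, mul_add, Finset.sum_add_distrib]
  ring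

theorem connTerm_smul (g : BMetric M) (D : BConnection E) (κ : VBChart m r E.Fiber)
    {j : ℕ} (i : Fin m) (a : ℝ) (t : TComp r m j) (I : TIdx r m j) (u : Fin m → ℝ) :
    connTerm g D κ i (a • t) I u = a * connTerm g D κ i t I u := by
  simp only [connTerm, Pi.smul_apply, smul_eq_mul, mul_sub, Finset.mul_sum]
  congr 1
  · exact Finset.sum_congr rfl fun _ _ => by ring
  · exact Finset.sum_congr rfl fun _ _ => Finset.sum_congr rfl fun _ _ => by ring

variable {g : BMetric M} {h : FibreMetric E} {D : BConnection E} {κ : VBChart m r E.Fiber} {k : ℕ}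

theorem IsWeakJet.add {e e' : E.InteriorSection} {t t' : ∀ j, TComp r m j}
    (ht : IsWeakJet g D κ k e t) (ht' : IsWeakJet g D κ k e' t') :
    IsWeakJet g D κ k (e + e') (t + t') where
  zero := by
    filter_upwards [ht.zero, ht'.zero] with u hu hu' I
    simp [hu, hu', VBChart.interiorCoords_add]
  locallyIntegrableOn j hj I := (ht.2 j hj I).add (ht'.2 j hj I)
  succ j hj I i := by
    obtain ⟨v, hv, he⟩ := ht.3 j hj I i
    obtain ⟨v', hv', he'⟩ := ht'.3 j hj I i
    refine ⟨v + v', hv.add hv', ?_⟩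
    filter_upwards [he, he'] with u hu hu'
    simp only [Pi.add_apply, hu, hu', connTerm_add]
    ring

theorem IsWeakJet.smul {e : E.InteriorSection} {t : ∀ j, TComp r m j}
    (ht : IsWeakJet g D κ k e t) (a : ℝ) : IsWeakJet g D κ k (a • e) (a • t) where
  zero := by
    filter_upwards [ht.zero] with u hu I
    simp [hu, VBChart.interiorCoords_smul]
  locallyIntegrableOn j hj I := (ht.2 j hj I).smul a
  succ j hj I i := by
    obtain ⟨v, hv, he⟩ := ht.3 j hj I i
    refine ⟨a • v, hv.smul a, ?_⟩
    filter_upwards [he] with u hu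
    simp only [Pi.smul_apply, smul_eq_mul, hu, connTerm_smul]
    ring

theorem isWeakJet_zero : IsWeakJet g D κ k (0 : E.InteriorSection) 0 where
  zero := by simp [VBChart.interiorCoords_zero]
  locallyIntegrableOn j hj I := locallyIntegrableOn_zero
  succ j hj I i := by
    refine ⟨0, ⟨locallyIntegrableOn_zero, locallyIntegrableOn_zero, by simp⟩, ?_⟩
    simp [connTerm]

/-! #### The pointwise norms -/

theorem FibreMetric.posSemidef_comp (h : FibreMetric E) (κ : VBChart m r E.Fiber)
    (u : Fin m → ℝ) : (h.comp κ u).PosSemidef := by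
  refine Matrix.PosSemidef.of_dotProduct_mulVec_nonneg ?_ fun x => ?_
  · ext a b
    exact h.symm _ _ _
  · obtain ⟨y, hy⟩ : ∃ y, y = ∑ a, x a • κ.basisSection a (κ.chart.toPartialEquiv u) := ⟨_, rfl⟩
    have h0 : 0 ≤ h.form (κ.chart.toPartialEquiv u) y y := by
      by_cases hy0 : y = 0
      · simp [hy0]
      · exact (h.pos _ _ hy0).le
    have h1 : h.form (κ.chart.toPartialEquiv u) y y = star x ⬝ᵥ h.comp κ u *ᵥ x := by
      simp only [hy, dotProduct, Matrix.mulVec, FibreMetric.comp, Finset.mul_sum, map_sum, map_smul,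
        LinearMap.sum_apply, LinearMap.smul_apply, smul_eq_mul, Matrix.of_apply, Pi.star_apply,
        star_trivial]
      rw [Finset.sum_comm]
      exact Finset.sum_congr rfl fun a _ => Finset.sum_congr rfl fun b _ => by ring
    rwa [← h1]

open scoped MatrixOrder in
theorem exists_factor {n : ℕ} {H : Matrix (Fin n) (Fin n) ℝ} (hH : H.PosSemidef) :
    ∃ B : Matrix (Fin n) (Fin n) ℝ, H = Bᴴ * B :=
  CStarAlgebra.nonneg_iff_eq_star_mul_self.1 hH.nonneg

theorem sum_mul_prod_nonneg {j : ℕ} {H : Matrix (Fin r) (Fin r) ℝ} {K : Matrix (Fin m) (Fin m) ℝ}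
    (hH : H.PosSemidef) (hK : K.PosSemidef) (t : TIdx r m j → ℝ) :
    0 ≤ ∑ I : TIdx r m j, ∑ J : TIdx r m j,
      (H I.1 J.1 * ∏ s, K (I.2 s) (J.2 s)) * t I * t J := by
  obtain ⟨B, rfl⟩ := exists_factor hH
  obtain ⟨C, rfl⟩ := exists_factor hK
  have key : (∑ I : TIdx r m j, ∑ J : TIdx r m j,
      ((Bᴴ * B) I.1 J.1 * ∏ s, (Cᴴ * C) (I.2 s) (J.2 s)) * t I * t J) =
      ∑ c : Fin r, ∑ l : Fin j → Fin m,
        (∑ I : TIdx r m j, (B c I.1 * ∏ s, C (l s) (I.2 s)) * t I) ^ 2 := by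
    have h1 : ∀ I J : TIdx r m j, ((Bᴴ * B) I.1 J.1 * ∏ s, (Cᴴ * C) (I.2 s) (J.2 s)) * t I * t J =
        ∑ c : Fin r, ∑ l : Fin j → Fin m, ((B c I.1 * ∏ s, C (l s) (I.2 s)) * t I) *
          ((B c J.1 * ∏ s, C (l s) (J.2 s)) * t J) := by
      intro I J
      have h2 : ∏ s, (Cᴴ * C) (I.2 s) (J.2 s) =
          ∑ l : Fin j → Fin m, (∏ s, C (l s) (I.2 s)) * ∏ s, C (l s) (J.2 s) := by
        simp only [Matrix.mul_apply, Matrix.conjTranspose_apply, star_trivial]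
        rw [Finset.prod_univ_sum, Fintype.piFinset_univ]
        exact Finset.sum_congr rfl fun l _ => Finset.prod_mul_distrib
      rw [h2, Matrix.mul_apply]
      simp only [Matrix.conjTranspose_apply, star_trivial, Finset.sum_mul, Finset.mul_sum]
      rw [Finset.sum_comm]
      exact Finset.sum_congr rfl fun c _ => Finset.sum_congr rfl fun l _ => by ring
    simp_rw [h1, pow_two, Finset.sum_mul_sum]
    calc _ = ∑ I : TIdx r m j, ∑ c : Fin r, ∑ J : TIdx r m j, _ :=
          Finset.sum_congr rfl fun I _ => Finset.sum_comm
      _ = ∑ c : Fin r, ∑ I : TIdx r m j, ∑ J : TIdx r m j, _ := Finset.sum_comm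
      _ = ∑ c : Fin r, ∑ I : TIdx r m j, ∑ l : Fin j → Fin m, ∑ J : TIdx r m j, _ :=
          Finset.sum_congr rfl fun c _ => Finset.sum_congr rfl fun I _ => Finset.sum_comm
      _ = _ := Finset.sum_congr rfl fun c _ => Finset.sum_comm
  rw [key]
  positivity

theorem tensorNorm_add_le (g : BMetric M) (h : FibreMetric E) (hκ : κ ∈ E.atlas) {j : ℕ}
    (t t' : TComp r m j) {u : Fin m → ℝ} (hu : u ∈ κ.chart.source) {p : ℝ} (hp : 0 ≤ p) :
    tensorNorm g h κ j (t + t') u ^ p ≤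
      2 ^ p * (tensorNorm g h κ j t u ^ p + tensorNorm g h κ j t' u ^ p) := by
  set q : TComp r m j → ℝ := fun t => ∑ I, ∑ J, tensorMetric g h κ j u I J * t I u * t J u with hq
  have h0 : ∀ t, 0 ≤ q t := fun t => sum_mul_prod_nonneg (h.posSemidef_comp κ u)
    (g.posDef _ (E.chart_mem κ hκ) u hu).inv.posSemidef fun I => t I u
  have h1 : q (t + t') + q (t - t') = 2 * q t + 2 * q t' := by
    simp only [hq, Finset.mul_sum, ← Finset.sum_add_distrib, Pi.add_apply, Pi.sub_apply]
    exact Finset.sum_congr rfl fun I _ => Finset.sum_congr rfl fun J _ => by ring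
  have h2 : q (t + t') ≤ 2 * q t + 2 * q t' := by linarith [h0 (t - t')]
  have h3 : √(q (t + t')) ≤ 2 * max √(q t) √(q t') := by
    rw [Real.sqrt_le_left (by positivity), mul_pow]
    have e1 : q t ≤ max √(q t) √(q t') ^ 2 := by
      rw [← Real.sqrt_le_left (by positivity)]; exact le_max_left _ _
    have e2 : q t' ≤ max √(q t) √(q t') ^ 2 := by
      rw [← Real.sqrt_le_left (by positivity)]; exact le_max_right _ _
    linarith
  change √(q (t + t')) ^ p ≤ 2 ^ p * (√(q t) ^ p + √(q t') ^ p)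
  refine (Real.rpow_le_rpow (Real.sqrt_nonneg _) h3 hp).trans ?_
  rw [Real.mul_rpow two_pos.le (by positivity)]
  gcongr
  rcases max_choice √(q t) √(q t') with h | h <;> rw [h]
  · linarith [Real.rpow_nonneg (Real.sqrt_nonneg (q t')) p]
  · linarith [Real.rpow_nonneg (Real.sqrt_nonneg (q t)) p]

theorem tensorNorm_smul (g : BMetric M) (h : FibreMetric E) {j : ℕ} (a : ℝ)
    (t : TComp r m j) (u : Fin m → ℝ) {p : ℝ} :
    tensorNorm g h κ j (a • t) u ^ p = |a| ^ p * tensorNorm g h κ j t u ^ p := by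
  have : tensorNorm g h κ j (a • t) u = |a| * tensorNorm g h κ j t u := by
    unfold tensorNorm
    rw [← Real.sqrt_sq_eq_abs, ← Real.sqrt_mul (sq_nonneg a), Finset.mul_sum]
    congr 1
    refine Finset.sum_congr rfl fun I _ => ?_
    rw [Finset.mul_sum]
    exact Finset.sum_congr rfl fun J _ => by simp only [Pi.smul_apply, smul_eq_mul]; ring
  rw [this]
  exact Real.mul_rpow (abs_nonneg a) (Real.sqrt_nonneg _)

theorem tensorNorm_zero (g : BMetric M) (h : FibreMetric E) {j : ℕ} (u : Fin m → ℝ) :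
    tensorNorm g h κ j 0 u = 0 := by simp [tensorNorm]

theorem BMetric.density_nonneg (g : BMetric M) (c : AChart m X) {u : Fin m → ℝ}
    (hu : u ∈ c.interior) : 0 ≤ g.density c u := by
  refine mul_nonneg (Real.sqrt_nonneg _) (Finset.prod_nonneg fun i _ => inv_nonneg.2 ?_)
  unfold bCoef
  split_ifs with hi
  · exact (hu.2 i hi).le
  · exact zero_le_one

theorem BMetric.continuousOn_comp (g : BMetric M) {c : AChart m X} (hc : c ∈ M.atlas) :
    ContinuousOn (g.comp c) c.source :=
  continuousOn_pi.2 fun i => continuousOn_pi.2 fun j => (g.smooth c hc i j).continuousOn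

theorem BMetric.continuousOn_inv (g : BMetric M) {c : AChart m X} (hc : c ∈ M.atlas) :
    ContinuousOn (fun u => (g.comp c u)⁻¹) c.source := by
  have h1 := g.continuousOn_comp hc
  have h2 : ContinuousOn (fun u => (g.comp c u).det) c.source :=
    (Continuous.matrix_det continuous_id).comp_continuousOn h1
  have h3 : ContinuousOn (fun u => (g.comp c u).adjugate) c.source :=
    (Continuous.matrix_adjugate continuous_id).comp_continuousOn h1
  simp_rw [Matrix.inv_def, Ring.inverse_eq_inv']
  exact (h2.inv₀ fun u hu => (g.posDef c hc u hu).det_pos.ne').smul h3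

theorem aemeasurable_norm (g : BMetric M) (h : FibreMetric E) (hκ : κ ∈ E.atlas) {j : ℕ}
    {t : TComp r m j} (ht : ∀ I, LocallyIntegrableOn (t I) κ.chart.interior) (p : ℝ) :
    AEMeasurable (fun u => ENNReal.ofReal (tensorNorm g h κ j t u ^ p * g.density κ.chart u))
      (volume.restrict κ.chart.interior) := by
  have hc := E.chart_mem κ hκ
  have hsub : κ.chart.interior ⊆ κ.chart.source := fun u hu => hu.1
  have hms := κ.chart.isOpen_interior.measurableSet
  have a1 : ∀ I, AEMeasurable (t I) (volume.restrict κ.chart.interior) := fun I =>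
    (ht I).aestronglyMeasurable.aemeasurable
  have a2 : ∀ I J, AEMeasurable (fun u => tensorMetric g h κ j u I J)
      (volume.restrict κ.chart.interior) := fun I J => by
    refine ContinuousOn.aemeasurable ?_ hms
    refine ContinuousOn.mul ((h.smooth κ hκ I.1 J.1).continuousOn.mono hsub) ?_
    refine continuousOn_finsetProd _ fun s _ => ?_
    exact (continuousOn_pi.1 (continuousOn_pi.1 (g.continuousOn_inv hc) (I.2 s)) (J.2 s)).mono hsub
  have a3 : AEMeasurable (fun u => (g.comp κ.chart u).det) (volume.restrict κ.chart.interior) :=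
    (((Continuous.matrix_det continuous_id).comp_continuousOn
      (g.continuousOn_comp hc)).mono hsub).aemeasurable hms
  have a4 : Measurable fun u : Fin m → ℝ => ∏ i, (bCoef κ.chart.k i u)⁻¹ := by
    refine Finset.measurable_fun_prod _ fun i _ => Measurable.inv ?_
    unfold bCoef
    split_ifs
    · exact measurable_pi_apply i
    · exact measurable_const
  refine ((AEMeasurable.pow_const ?_ p).mul (a3.sqrt.mul a4.aemeasurable)).ennreal_ofReal
  refine AEMeasurable.sqrt ?_
  refine Finset.aemeasurable_fun_sum _ fun I _ => Finset.aemeasurable_fun_sum _ fun J _ => ?_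
  exact ((a2 I J).mul (a1 I)).mul (a1 J)

/-! #### The integrals -/

variable (P : E.Pieces)

theorem AVectorBundle.Pieces.restrict_le (n : Fin P.card) : volume.restrict (P.domain n) ≤
    volume.restrict (P.triv n).chart.interior :=
  Measure.restrict_mono (fun _ hu => hu.1) le_rfl

theorem AVectorBundle.Pieces.normIntegral_add_le (g : BMetric M) (h : FibreMetric E) {p : ℝ} (hp : 0 ≤ p) {j : ℕ}
    {t t' : Fin P.card → TComp r m j}
    (ht : ∀ n I, LocallyIntegrableOn (t n I) (P.triv n).chart.interior) :
    P.normIntegral g h p j (t + t') ≤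
      ENNReal.ofReal (2 ^ p) * (P.normIntegral g h p j t + P.normIntegral g h p j t') := by
  unfold AVectorBundle.Pieces.normIntegral AVectorBundle.Pieces.integral
  rw [← Finset.sum_add_distrib, Finset.mul_sum]
  refine Finset.sum_le_sum fun n _ => ?_
  have hm := (aemeasurable_norm g h (P.triv_mem n) (ht n) p).mono_measure (P.restrict_le n)
  rw [← lintegral_add_left' hm, ← lintegral_const_mul' _ _ ENNReal.ofReal_ne_top]
  refine lintegral_mono_ae ?_
  have hmem : ∀ᵐ u ∂volume.restrict (P.domain n), u ∈ (P.triv n).chart.interior :=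
    ae_mono (P.restrict_le n)
      (ae_restrict_mem (P.triv n).chart.isOpen_interior.measurableSet)
  filter_upwards [hmem] with u hu
  have hd := g.density_nonneg _ hu
  have h1 : ∀ t : TComp r m j, 0 ≤ tensorNorm g h (P.triv n) j t u ^ p := fun t =>
    Real.rpow_nonneg (Real.sqrt_nonneg _) p
  rw [← ENNReal.ofReal_add (mul_nonneg (h1 _) hd) (mul_nonneg (h1 _) hd),
    ← ENNReal.ofReal_mul (by positivity)]
  refine ENNReal.ofReal_le_ofReal ?_
  rw [← add_mul, ← mul_assoc]
  exact mul_le_mul_of_nonneg_right (tensorNorm_add_le g h (P.triv_mem n) _ _ hu.1 hp) hd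

theorem AVectorBundle.Pieces.normIntegral_smul (g : BMetric M) (h : FibreMetric E) {p : ℝ} {j : ℕ} (a : ℝ)
    (t : Fin P.card → TComp r m j) :
    P.normIntegral g h p j (a • t) = ENNReal.ofReal (|a| ^ p) * P.normIntegral g h p j t := by
  unfold AVectorBundle.Pieces.normIntegral AVectorBundle.Pieces.integral
  rw [Finset.mul_sum]
  refine Finset.sum_congr rfl fun n _ => ?_
  rw [← lintegral_const_mul' _ _ ENNReal.ofReal_ne_top]
  refine lintegral_congr fun u => ?_
  rw [← ENNReal.ofReal_mul (by positivity), ← mul_assoc]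
  congr 2
  exact tensorNorm_smul g h a (t n) u

theorem AVectorBundle.Pieces.normIntegral_zero (g : BMetric M) (h : FibreMetric E) {p : ℝ} (hp : 0 < p) (j : ℕ) :
    P.normIntegral g h p j 0 = 0 := by
  simp [AVectorBundle.Pieces.normIntegral, AVectorBundle.Pieces.integral, tensorNorm_zero, Real.zero_rpow hp.ne']

theorem AVectorBundle.Pieces.normIntegral_congr (g : BMetric M) (h : FibreMetric E) (p : ℝ) {j : ℕ}
    {t t' : Fin P.card → TComp r m j}
    (ht : ∀ n, ∀ᵐ u ∂volume.restrict (P.triv n).chart.interior, ∀ I, t n I u = t' n I u) :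
    P.normIntegral g h p j t = P.normIntegral g h p j t' := by
  unfold AVectorBundle.Pieces.normIntegral AVectorBundle.Pieces.integral
  refine Finset.sum_congr rfl fun n _ => lintegral_congr_ae ?_
  filter_upwards [ae_mono (P.restrict_le n) (ht n)] with u hu
  simp only [tensorNorm, hu]

end Facts

/-! ### The spaces -/

section Spaces

variable {m r : ℕ} {X : Type*} [TopologicalSpace X] {M : AManifold m X}

/-- The sections over the interior which vanish almost everywhere. -/
def AVectorBundle.nullSections (E : AVectorBundle M r) : Submodule ℝ E.InteriorSection where
  carrier := {e | ∀ κ ∈ E.atlas, ∀ᵐ u ∂volume.restrict κ.chart.interior, κ.interiorCoords e u = 0}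
  zero_mem' κ _ := Eventually.of_forall fun u => κ.interiorCoords_zero u
  add_mem' {e f} he hf κ hκ := by
    filter_upwards [he κ hκ, hf κ hκ] with u h1 h2
    rw [VBChart.interiorCoords_add, h1, h2, add_zero]
  smul_mem' a e he κ hκ := by
    filter_upwards [he κ hκ] with u h1
    rw [VBChart.interiorCoords_smul, h1, smul_zero]

/-- Sections of `E` over the interior, up to equality almost everywhere. -/
abbrev AVectorBundle.AESection (E : AVectorBundle M r) := E.InteriorSection ⧸ E.nullSections

theorem AVectorBundle.ae_eq_of_sub_mem {E : AVectorBundle M r} {e f : E.InteriorSection}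
    (h : -e + f ∈ E.nullSections) {κ : VBChart m r E.Fiber} (hκ : κ ∈ E.atlas) :
    ∀ᵐ u ∂volume.restrict κ.chart.interior, κ.interiorCoords e u = κ.interiorCoords f u := by
  filter_upwards [h κ hκ] with u hu
  have h1 := κ.interiorCoords_add (-e) f u
  have h2 := κ.interiorCoords_smul (-1) e u
  rw [neg_one_smul, neg_one_smul] at h2
  rw [hu, h2] at h1
  rwa [eq_comm, neg_add_eq_zero] at h1

/-- The section `e` over the interior is locally integrable. -/
def AVectorBundle.LocallyIntegrable (E : AVectorBundle M r) (e : E.InteriorSection) : Prop :=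
  ∀ κ ∈ E.atlas, ∀ a, LocallyIntegrableOn (fun u => κ.interiorCoords e u a) κ.chart.interior

/-- The section `e` over the interior is locally integrable, and `k` times weakly differentiable (with
locally integrable weak derivatives). -/
def AVectorBundle.WeaklyDifferentiable (E : AVectorBundle M r) (g : BMetric M) (D : BConnection E)
    (k : ℕ) (e : E.InteriorSection) : Prop :=
  ∀ κ ∈ E.atlas, ∃ t, IsWeakJet g D κ k e t

/-- A space of elements of a vector space `V`: a linear subspace of `V` with a
topology. -/
structure TopSubspace (V : Type*) [AddCommGroup V] [Module ℝ V] where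
  carrier : Submodule ℝ V
  topology : TopologicalSpace carrier

/-- The topology on a linear subspace given by a norm: a set is open if with every point it contains
a ball around that point. -/
abbrev normTopology {V : Type*} [AddCommGroup V] [Module ℝ V] (S : Submodule ℝ V) (N : V → ℝ≥0∞) :
    TopologicalSpace S where
  IsOpen U := ∀ x ∈ U, ∃ ε > 0, ∀ y : S, N (y - x : V) < ε → y ∈ U
  isOpen_univ x _ := ⟨1, one_pos, fun _ _ => mem_univ _⟩
  isOpen_inter U U' h h' x hx := by
    obtain ⟨ε, hε, h1⟩ := h x hx.1
    obtain ⟨ε', hε', h1'⟩ := h' x hx.2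
    exact ⟨min ε ε', lt_min hε hε', fun y hy =>
      ⟨h1 y (hy.trans_le (min_le_left _ _)), h1' y (hy.trans_le (min_le_right _ _))⟩⟩
  isOpen_sUnion s hs x := by
    rintro ⟨U, hU, hx⟩
    obtain ⟨ε, hε, h⟩ := hs U hU x hx
    exact ⟨ε, hε, fun y hy => ⟨U, hU, h y hy⟩⟩

/-- The inverse image under a linear map. -/
def TopSubspace.comap {V V' : Type*} [AddCommGroup V] [Module ℝ V] [AddCommGroup V'] [Module ℝ V']
    (f : V →ₗ[ℝ] V') (S : TopSubspace V') : TopSubspace V where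
  carrier := S.carrier.comap f
  topology := S.topology.induced fun x => ⟨f x, x.2⟩

variable [T2Space X] [CompactSpace X] {E : AVectorBundle M r}

/-- The sections `e` of `E` over the interior which are locally integrable and have finite `L^p` norm
(before passing to classes of sections which agree almost everywhere). -/
def lpSections (g : BMetric M) (h : FibreMetric E) (p : ℝ) (hp : 1 < p) :
    Submodule ℝ E.InteriorSection where
  carrier := {e | E.LocallyIntegrable e ∧ lpNorm g h p e < ⊤}
  zero_mem' := by
    refine ⟨fun κ _ a => by simp only [VBChart.interiorCoords_zero]; exact locallyIntegrableOn_zero, ?_⟩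
    simp only [lpNorm, VBChart.interiorCoords_zero]
    have := E.pieces.normIntegral_zero g h (zero_lt_one.trans hp) 0
    refine ENNReal.rpow_lt_top_of_nonneg (by positivity) ?_
    change E.pieces.normIntegral g h p 0 0 ≠ ⊤
    rw [this]; simp
  add_mem' {e f} he hf := by
    have hp0 : 0 < p := zero_lt_one.trans hp
    refine ⟨fun κ hκ a => ?_, ?_⟩
    · simp only [VBChart.interiorCoords_add]
      exact (he.1 κ hκ a).add (hf.1 κ hκ a)
    · have h1 := he.2
      have h2 := hf.2
      simp only [lpNorm, ENNReal.rpow_lt_top_iff_of_pos (one_div_pos.2 hp0)] at h1 h2 ⊢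
      simp only [VBChart.interiorCoords_add]
      exact (E.pieces.normIntegral_add_le g h hp0.le fun n I =>
        he.1 _ (E.pieces.triv_mem n) I.1).trans_lt
        (ENNReal.mul_lt_top ENNReal.ofReal_lt_top (ENNReal.add_lt_top.2 ⟨h1, h2⟩))
  smul_mem' a e he := by
    have hp0 : 0 < p := zero_lt_one.trans hp
    refine ⟨fun κ hκ b => ?_, ?_⟩
    · simp only [VBChart.interiorCoords_smul]
      exact (he.1 κ hκ b).smul a
    · have h1 := he.2
      simp only [lpNorm, ENNReal.rpow_lt_top_iff_of_pos (one_div_pos.2 hp0)] at h1 ⊢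
      simp only [VBChart.interiorCoords_smul]
      exact (E.pieces.normIntegral_smul g h a _).trans_lt
        (ENNReal.mul_lt_top ENNReal.ofReal_lt_top h1)

/-- The sections `e` of `E` over the interior which are locally integrable, `k` times weakly
differentiable, and have finite `L^p_k` norm (before passing to classes of sections which agree almost
everywhere). -/
def sobolevSections (g : BMetric M) (h : FibreMetric E) (D : BConnection E) (p : ℝ) (hp : 1 < p)
    (k : ℕ) : Submodule ℝ E.InteriorSection where
  carrier := {e | E.WeaklyDifferentiable g D k e ∧ sobolevNorm g h D p k e < ⊤}
  zero_mem' := by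
    have hp0 : 0 < p := zero_lt_one.trans hp
    refine ⟨fun κ _ => ⟨0, isWeakJet_zero⟩, ?_⟩
    simp only [sobolevNorm, ENNReal.rpow_lt_top_iff_of_pos (one_div_pos.2 hp0)]
    refine (iInf₂_le (fun _ => 0) fun n => isWeakJet_zero).trans_lt ?_
    refine ENNReal.sum_lt_top.2 fun j _ => ?_
    exact (E.pieces.normIntegral_zero g h hp0 j).trans_lt ENNReal.zero_lt_top
  add_mem' {e f} he hf := by
    have hp0 : 0 < p := zero_lt_one.trans hp
    refine ⟨fun κ hκ => ?_, ?_⟩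
    · obtain ⟨t, ht⟩ := he.1 κ hκ
      obtain ⟨t', ht'⟩ := hf.1 κ hκ
      exact ⟨_, ht.add ht'⟩
    · have h1 := he.2
      have h2 := hf.2
      simp only [sobolevNorm, ENNReal.rpow_lt_top_iff_of_pos (one_div_pos.2 hp0)] at h1 h2 ⊢
      simp only [iInf_lt_iff] at h1 h2
      obtain ⟨t, ht, h1⟩ := h1
      obtain ⟨t', ht', h2⟩ := h2
      refine (iInf₂_le (fun n => t n + t' n) fun n => (ht n).add (ht' n)).trans_lt ?_
      refine ENNReal.sum_lt_top.2 fun j hj => ?_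
      exact (E.pieces.normIntegral_add_le g h hp0.le fun n I =>
        (ht n).2 j (Nat.lt_succ_iff.1 (Finset.mem_range.1 hj)) I).trans_lt
        (ENNReal.mul_lt_top ENNReal.ofReal_lt_top
          (ENNReal.add_lt_top.2 ⟨ENNReal.sum_lt_top.1 h1 j hj, ENNReal.sum_lt_top.1 h2 j hj⟩))
  smul_mem' a e he := by
    have hp0 : 0 < p := zero_lt_one.trans hp
    refine ⟨fun κ hκ => ?_, ?_⟩
    · obtain ⟨t, ht⟩ := he.1 κ hκ
      exact ⟨_, ht.smul a⟩
    · have h1 := he.2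
      simp only [sobolevNorm, ENNReal.rpow_lt_top_iff_of_pos (one_div_pos.2 hp0)] at h1 ⊢
      simp only [iInf_lt_iff] at h1
      obtain ⟨t, ht, h1⟩ := h1
      refine (iInf₂_le (fun n => a • t n) fun n => (ht n).smul a).trans_lt ?_
      refine ENNReal.sum_lt_top.2 fun j hj => ?_
      exact (E.pieces.normIntegral_smul g h a _).trans_lt
        (ENNReal.mul_lt_top ENNReal.ofReal_lt_top (ENNReal.sum_lt_top.1 h1 j hj))

theorem lpNorm_congr (g : BMetric M) (h : FibreMetric E) (p : ℝ) {e f : E.InteriorSection}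
    (hef : -e + f ∈ E.nullSections) : lpNorm g h p e = lpNorm g h p f := by
  have := E.pieces.normIntegral_congr g h p (j := 0)
    (t := fun n I u => (E.pieces.triv n).interiorCoords e u I.1)
    (t' := fun n I u => (E.pieces.triv n).interiorCoords f u I.1) fun n => by
      filter_upwards [AVectorBundle.ae_eq_of_sub_mem hef (E.pieces.triv_mem n)] with u hu I
      rw [hu]
  rw [lpNorm, lpNorm, this]

theorem sobolevNorm_congr (g : BMetric M) (h : FibreMetric E) (D : BConnection E) (p : ℝ) (k : ℕ)
    {e f : E.InteriorSection} (hef : -e + f ∈ E.nullSections) :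
    sobolevNorm g h D p k e = sobolevNorm g h D p k f := by
  have key : ∀ (n : Fin E.pieces.card) t, IsWeakJet g D (E.pieces.triv n) k e t ↔
      IsWeakJet g D (E.pieces.triv n) k f t := fun n t => by
    have hu := AVectorBundle.ae_eq_of_sub_mem hef (E.pieces.triv_mem n)
    constructor
    · refine fun ht => ⟨?_, ht.2, ht.3⟩
      filter_upwards [ht.zero, hu] with u h1 h2 I
      rw [h1, h2]
    · refine fun ht => ⟨?_, ht.2, ht.3⟩
      filter_upwards [ht.zero, hu] with u h1 h2 I
      rw [h1, h2]
  simp only [sobolevNorm, key]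

/-- The `L^p` norm of a class of sections. -/
def lpNormAE (g : BMetric M) (h : FibreMetric E) (p : ℝ) (q : E.AESection) : ℝ≥0∞ :=
  Quotient.liftOn' q (lpNorm g h p) fun _ _ hef =>
    lpNorm_congr g h p (QuotientAddGroup.leftRel_apply.1 hef)

/-- The `L^p_k` norm of a class of sections. -/
def sobolevNormAE (g : BMetric M) (h : FibreMetric E) (D : BConnection E) (p : ℝ) (k : ℕ)
    (q : E.AESection) : ℝ≥0∞ :=
  Quotient.liftOn' q (sobolevNorm g h D p k) fun _ _ hef =>
    sobolevNorm_congr g h D p k (QuotientAddGroup.leftRel_apply.1 hef)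

/-- The Lebesgue space `L^p(E)`. -/
def lpSpace (g : BMetric M) (h : FibreMetric E) (p : ℝ) (hp : 1 < p) : TopSubspace E.AESection where
  carrier := (lpSections g h p hp).map E.nullSections.mkQ
  topology := normTopology _ (lpNormAE g h p)

/-- The Sobolev space `L^p_k(E)`. -/
def sobolevSpace (g : BMetric M) (h : FibreMetric E) (D : BConnection E) (p : ℝ) (hp : 1 < p)
    (k : ℕ) : TopSubspace E.AESection where
  carrier := (sobolevSections g h D p hp k).map E.nullSections.mkQ
  topology := normTopology _ (sobolevNormAE g h D p k)

end Spaces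

section WeightedSpaces

variable {m r : ℕ} {X : Type*} [TopologicalSpace X] {M : AManifold m X}

/-- The identification of sections of `E` with sections of `E ⊗ L_λ` over the interior, where `L_λ`
is canonically trivial. -/
def AVectorBundle.twistSection (E : AVectorBundle M r) (w : Weight M) :
    E.InteriorSection →ₗ[ℝ] (E.twist w).InteriorSection where
  toFun e x := e x ⊗ₜ[ℝ] w.one (x : X)
  map_add' _ _ := funext fun _ => TensorProduct.add_tmul _ _ _
  map_smul' _ _ := funext fun _ => (TensorProduct.smul_tmul' _ _ _).symm

theorem AVectorBundle.nullSections_le_comap (E : AVectorBundle M r) (w : Weight M) :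
    E.nullSections ≤ (E.twist w).nullSections.comap (E.twistSection w) := by
  rintro e he _ ⟨κ, hκ, c, hc, ℓ, h, hr, rfl⟩
  have hsub : c.interior ⊆ κ.chart.interior := fun u hu =>
    ⟨hr.source_subset hu.1, fun i hi => hu.2 i (hr.k_eq ▸ hi)⟩
  have h1 := ae_mono (Measure.restrict_mono hsub (le_refl volume)) (he κ hκ)
  have h2 := ae_restrict_mem (μ := volume) c.isOpen_interior.measurableSet
  filter_upwards [h1, h2] with u hu hui
  have hx : c.toPartialEquiv u ∈ M.interior := ⟨c, hc, u, hui, rfl⟩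
  have hx' : κ.chart.toPartialEquiv u ∈ M.interior := hr.eqOn hui.1 ▸ hx
  rw [VBChart.interiorCoords_eq _ _ hx'] at hu
  ext a
  refine (congrFun (VBChart.interiorCoords_eq (κ.twist w c ℓ) (E.twistSection w e) hx) a).trans ?_
  refine (VBChart.twist_frame κ w c ℓ _ _ a).trans ?_
  have h3 : ∀ y (hy : y ∈ M.interior), κ.chart.toPartialEquiv u = y → κ.frame y (e ⟨y, hy⟩) = 0 := by
    rintro y hy rfl
    exact hu
  have h4 := h3 _ hx (hr.eqOn hui.1).symm
  exact mul_eq_zero_of_right _ (congrFun h4 a)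

/-- The identification of sections of `E` with sections of `E ⊗ L_λ` over the interior, up to
equality almost everywhere. -/
def AVectorBundle.twistAESection (E : AVectorBundle M r) (w : Weight M) :
    E.AESection →ₗ[ℝ] (E.twist w).AESection :=
  E.nullSections.mapQ (E.twist w).nullSections (E.twistSection w) (E.nullSections_le_comap w)

variable [T2Space X] [CompactSpace X] {E : AVectorBundle M r} {w : Weight M}

/-- The weighted Lebesgue space `L^p(E)_λ = L^p(E ⊗ L_λ)`, as a space of sections of `E` over the
interior. -/
def weightedLpSpace (g : BMetric M) (h : FibreMetric (E.twist w)) (p : ℝ) (hp : 1 < p) :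
    TopSubspace E.AESection :=
  (lpSpace g h p hp).comap (E.twistAESection w)

/-- The weighted Sobolev space `L^p_k(E)_λ = L^p_k(E ⊗ L_λ)`, as a space of sections of `E` over the
interior. -/
def weightedSobolevSpace (g : BMetric M) (h : FibreMetric (E.twist w)) (D : BConnection (E.twist w))
    (p : ℝ) (hp : 1 < p) (k : ℕ) : TopSubspace E.AESection :=
  (sobolevSpace g h D p hp k).comap (E.twistAESection w)

/-- The norm of `L^p(E)_λ`. -/
def weightedLpNorm (g : BMetric M) (h : FibreMetric (E.twist w)) (p : ℝ) (q : E.AESection) :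
    ℝ≥0∞ :=
  lpNormAE g h p (E.twistAESection w q)

/-- The norm of `L^p_k(E)_λ`. -/
def weightedSobolevNorm (g : BMetric M) (h : FibreMetric (E.twist w)) (D : BConnection (E.twist w))
    (p : ℝ) (k : ℕ) (q : E.AESection) : ℝ≥0∞ :=
  sobolevNormAE g h D p k (E.twistAESection w q)

end WeightedSpaces

/-- Two norms agree up to bounded factors. -/
def EquivalentNorms {V : Type*} (N N' : V → ℝ≥0∞) : Prop :=
  ∃ C : ℝ≥0, 0 < C ∧ ∀ v, N' v ≤ C * N v ∧ N v ≤ C * N' v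

end ACorners

end

open ACorners

/-! The comparison is made in one chart at a time, and compactness makes the constants uniform. In a
fixed vector bundle chart, the components of the covariant derivatives of order at most `j` for one
choice of b-metric and b-connection determine those of order `j` for any other choice: the latter
are linear combinations of the former, with coefficients that are a-smooth on the whole domain of
the chart, boundary points included. This follows by induction on `j`. The defining equation of the
jet expresses a b-derivative of a component as a component of one order more minus connection terms;
the product rule then differentiates combinations, and adding the connection terms of the new choice
gives the next covariant derivative. The induction is carried by `JetCombination`,
`JetCombination.exists_derivative` and `exists_jetTransform`. The combinations are operators on
jets, fixed before any section is chosen, so the resulting constants do not depend on the section.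

The product rule for weak derivatives needs coefficients that are smooth in the ordinary sense over
the interior. A-smoothness only speaks of iterated coordinate derivatives, so one first shows that
continuous partial derivatives of all orders imply smoothness (`ASmoothOn.contDiffOn`).

Analytically, three bounds hold on a compact subset of the domain of a chart, even up to the
boundary. A-smooth coefficients are bounded because they are continuous. Each pointwise norm is
comparable to the sup norm of the components, because the induced metric on the tensor bundle is
continuous and positive definite there (`exists_tensorNorm_bounds`). The quotient of two volume
densities is bounded, because the factors `1 / x_i`, singular at the boundary, are common to both
(`exists_density_bound`).

The integrals over the interior are finite sums over pieces that lie in such compact sets, and the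
pieces depend on the bundle alone. Combining the bounds with the power mean inequality gives an
inequality of norms in one direction; exchanging the two choices gives the other. Equality of the
spaces and of their topologies is then formal. The weighted spaces are inverse images of the spaces
of the bundle `E ⊗ L_λ`, to which the unweighted result applies. -/

namespace ACorners

/-! ### A-smooth functions are smooth where the boundary coordinates are positive. -/

section Regularity

variable {m k : ℕ}

/-- The increment of `f` is split into moves along one coordinate at a time, and each move is
compared with its linear part by the mean value inequality. The set `s` of coordinates already moved
is the induction variable; the case of all coordinates is differentiability at `x`. -/
theorem isLittleO_sub_sum_partial {f : (Fin m → ℝ) → ℝ} {g : Fin m → (Fin m → ℝ) → ℝ}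
    {x : Fin m → ℝ} (hf : ∀ᶠ y in 𝓝 x, ∀ i, HasLineDerivAt ℝ f (g i y) y (Pi.single i 1))
    (hg : ∀ i, ContinuousAt (g i) x) (s : Finset (Fin m)) :
    (fun h : Fin m → ℝ => f (x + ∑ i ∈ s, h i • (Pi.single i 1 : Fin m → ℝ)) - f x
      - ∑ i ∈ s, h i * g i x) =o[𝓝 0] fun h => h := by
  classical
  induction s using Finset.induction_on with
  | empty => simp
  | insert a s ha ih =>
    -- The error made by moving in the direction `a` alone, after the coordinates in `s` have been
    -- moved.
    have key : (fun h : Fin m → ℝ =>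
        f (x + ∑ i ∈ s, h i • (Pi.single i 1 : Fin m → ℝ) + h a • (Pi.single a 1 : Fin m → ℝ))
        - f (x + ∑ i ∈ s, h i • (Pi.single i 1 : Fin m → ℝ)) - h a * g a x) =o[𝓝 0]
        fun h => h := by
      rw [Asymptotics.isLittleO_iff]
      intro ε hε
      have h1 : ∀ᶠ y in 𝓝 x, (∀ i, HasLineDerivAt ℝ f (g i y) y (Pi.single i 1)) ∧
          |g a y - g a x| ≤ ε := by
        refine hf.and ?_
        filter_upwards [Metric.continuousAt_iff'.1 (hg a) ε hε] with y hy
        rw [Real.dist_eq] at hy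
        exact hy.le
      obtain ⟨δ, hδ, hball⟩ := Metric.eventually_nhds_iff_ball.1 h1
      filter_upwards [Metric.ball_mem_nhds (0 : Fin m → ℝ) hδ] with h hh
      rw [mem_ball_zero_iff] at hh
      set y := x + ∑ i ∈ s, h i • (Pi.single i 1 : Fin m → ℝ) with hy
      -- In the sup norm the segment stays in the ball because its points differ from `x` by at most
      -- `|h j|` in each coordinate `j`; here `a ∉ s` ensures that the direction `a` is used only
      -- once.
      have hmem : ∀ τ : ℝ, |τ| ≤ |h a| → y + τ • (Pi.single a 1 : Fin m → ℝ) ∈ Metric.ball x δ := by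
        intro τ hτ
        rw [Metric.mem_ball, dist_eq_norm]
        refine lt_of_le_of_lt ((pi_norm_le_iff_of_nonneg (norm_nonneg h)).2 fun j => ?_) hh
        simp only [hy, Pi.sub_apply, Pi.add_apply, Finset.sum_apply, Pi.smul_apply, smul_eq_mul,
          Pi.single_apply]
        by_cases hja : j = a
        · subst hja
          rw [Finset.sum_eq_zero]
          · simpa using hτ.trans (norm_le_pi_norm h j)
          · intro i hi
            rw [if_neg, mul_zero]
            rintro rfl
            exact ha hi
        · by_cases hjs : j ∈ s
          · simpa [hja, hjs] using norm_le_pi_norm h j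
          · simp [hja, hjs]
      -- With the linear part `τ * g a x` subtracted, the derivative along the segment is `g a` at
      -- the moving point minus `g a x`, which is at most `ε` in absolute value by continuity.
      have hd : ∀ τ ∈ uIcc 0 (h a), HasDerivWithinAt
          (fun τ : ℝ => f (y + τ • (Pi.single a 1 : Fin m → ℝ)) - τ * g a x)
          (g a (y + τ • (Pi.single a 1 : Fin m → ℝ)) - g a x) (uIcc 0 (h a)) τ := by
        intro τ hτ
        have hτ' : |τ| ≤ |h a| := by
          have := abs_sub_left_of_mem_uIcc hτ
          simpa using this
        have h2 := (hball _ (hmem τ hτ')).1 a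
        have h3 : HasDerivAt (fun τ : ℝ => f (y + τ • (Pi.single a 1 : Fin m → ℝ)))
            (g a (y + τ • (Pi.single a 1 : Fin m → ℝ))) τ := by
          -- A line derivative is a derivative at time `0` along a line based at the point itself;
          -- the base point is moved back to `y` by translating time by `τ`.
          have h4 : HasDerivAt (fun t : ℝ => f (y + τ • (Pi.single a 1 : Fin m → ℝ) +
            t • (Pi.single a 1 : Fin m → ℝ))) (g a (y + τ • (Pi.single a 1 : Fin m → ℝ)))
            (τ - τ) := by rw [sub_self]; exact h2
          have h5 := HasDerivAt.comp_sub_const τ τ h4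
          refine h5.congr_of_eventuallyEq (Eventually.of_forall fun t => ?_)
          change f (y + t • _) = f (y + τ • _ + (t - τ) • _)
          rw [add_assoc y, ← add_smul, add_sub_cancel]
        have h6 := (h3.fun_sub ((hasDerivAt_id' τ).mul_const (g a x))).hasDerivWithinAt
          (s := uIcc 0 (h a))
        rwa [one_mul] at h6
      have hb := Convex.norm_image_sub_le_of_norm_hasDerivWithin_le (C := ε) hd
        (fun τ hτ => by
          have hτ' : |τ| ≤ |h a| := by
            have := abs_sub_left_of_mem_uIcc hτ
            simpa using this
          exact (hball _ (hmem τ hτ')).2) (convex_uIcc 0 (h a)) left_mem_uIcc right_mem_uIcc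
      simp only [zero_smul, add_zero, zero_mul, sub_zero] at hb
      have e1 : f (y + h a • (Pi.single a 1 : Fin m → ℝ)) - f y - h a * g a x =
          f (y + h a • (Pi.single a 1 : Fin m → ℝ)) - h a * g a x - f y := by ring
      rw [e1]
      exact hb.trans (mul_le_mul_of_nonneg_left (norm_le_pi_norm h a) hε.le)
    refine (key.add ih).congr_left fun h => ?_
    rw [Finset.sum_insert ha, Finset.sum_insert ha, add_comm (h a • _), ← add_assoc]
    ring

/-- A function with continuous partial derivatives is differentiable. -/
theorem hasFDerivAt_of_partial {f : (Fin m → ℝ) → ℝ} {g : Fin m → (Fin m → ℝ) → ℝ}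
    {x : Fin m → ℝ} (hf : ∀ᶠ y in 𝓝 x, ∀ i, HasLineDerivAt ℝ f (g i y) y (Pi.single i 1))
    (hg : ∀ i, ContinuousAt (g i) x) :
    HasFDerivAt f (∑ i, g i x • (ContinuousLinearMap.proj i : (Fin m → ℝ) →L[ℝ] ℝ)) x := by
  rw [hasFDerivAt_iff_isLittleO_nhds_zero]
  refine (isLittleO_sub_sum_partial hf hg Finset.univ).congr_left fun h => ?_
  have e : ∑ i, h i • (Pi.single i 1 : Fin m → ℝ) = h := (pi_eq_sum_univ' h).symm
  rw [e]
  simp [mul_comm]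

/-- A family of continuous functions closed under partial derivatives consists of smooth functions.
The induction on the order of differentiability runs over the whole family at once: the Fréchet
derivative of a member is built from other members, to which the previous order applies. -/
theorem contDiffOn_of_iterated_partial {Ω : Set (Fin m → ℝ)} (hΩ : IsOpen Ω)
    (S : Set ((Fin m → ℝ) → ℝ)) (hcont : ∀ f ∈ S, ContinuousOn f Ω)
    (hS : ∀ f ∈ S, ∀ i, ∃ f' ∈ S, ∀ x ∈ Ω, HasLineDerivAt ℝ f (f' x) x (Pi.single i 1))
    {f : (Fin m → ℝ) → ℝ} (hf : f ∈ S) : ContDiffOn ℝ ∞ f Ω := by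
  rw [contDiffOn_infty]
  intro n
  induction n generalizing f with
  | zero => exact contDiffOn_zero.2 (hcont f hf)
  | succ n ih =>
    choose g hgS hg using hS f hf
    have hd : ∀ x ∈ Ω, HasFDerivAt f
        (∑ i, g i x • (ContinuousLinearMap.proj i : (Fin m → ℝ) →L[ℝ] ℝ)) x := fun x hx =>
      hasFDerivAt_of_partial (eventually_of_mem (hΩ.mem_nhds hx) fun y hy i => hg i y hy)
        fun i => (hcont _ (hgS i)).continuousAt (hΩ.mem_nhds hx)
    push_cast
    rw [contDiffOn_succ_iff_fderiv_of_isOpen hΩ]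
    -- The middle condition concerns analyticity and is void at a finite order.
    refine ⟨fun x hx => (hd x hx).differentiableAt.differentiableWithinAt, by simp, ?_⟩
    refine ContDiffOn.congr (f := fun x => ∑ i, g i x • (ContinuousLinearMap.proj i :
      (Fin m → ℝ) →L[ℝ] ℝ)) ?_ fun x hx => (hd x hx).fderiv
    exact ContDiffOn.sum fun i _ => (ih (hgS i)).smul contDiffOn_const

theorem bCoef_ne_zero {i : Fin m} {x : Fin m → ℝ} (hx : (i : ℕ) < k → 0 < x i) :
    bCoef k i x ≠ 0 := by
  unfold bCoef
  split_ifs with h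
  · exact (hx h).ne'
  · exact one_ne_zero

theorem ASmoothOn.bDeriv {f : (Fin m → ℝ) → ℝ} {U : Set (Fin m → ℝ)} (hf : ASmoothOn k f U)
    (i : Fin m) : ASmoothOn k (bDeriv k i f) U := fun l => hf (i :: l)

theorem isModelOpen_of_isOpen {Ω : Set (Fin m → ℝ)} (hΩ : IsOpen Ω)
    (hpos : ∀ x ∈ Ω, ∀ i : Fin m, (i : ℕ) < k → 0 < x i) : IsModelOpen k Ω :=
  ⟨Ω, hΩ, (inter_eq_left.2 fun x hx i hi => (hpos x hx i hi).le).symm⟩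

/-- This factor recovers `∂/∂x_i` from the b-vector field `v_i` away from the boundary. -/
theorem aSmoothOn_inv_bCoef {Ω : Set (Fin m → ℝ)} (hΩ : IsOpen Ω)
    (hpos : ∀ x ∈ Ω, ∀ i : Fin m, (i : ℕ) < k → 0 < x i) (i : Fin m) :
    ASmoothOn k (fun x => (bCoef k i x)⁻¹) Ω := by
  have hmo := isModelOpen_of_isOpen hΩ hpos
  have h : ASmoothOn k (bCoef k i) Ω := by
    unfold bCoef
    split_ifs
    · exact aSmoothOn_coord hmo i
    · exact aSmoothOn_const 1
  exact h.comp hmo (φ := fun t => t⁻¹) fun x hx => contDiffAt_inv ℝ (bCoef_ne_zero (hpos x hx i))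

/-- Where the boundary coordinates are positive, a-smooth functions are smooth. -/
theorem ASmoothOn.contDiffOn {f : (Fin m → ℝ) → ℝ} {Ω : Set (Fin m → ℝ)} (hf : ASmoothOn k f Ω)
    (hΩ : IsOpen Ω) (hpos : ∀ x ∈ Ω, ∀ i : Fin m, (i : ℕ) < k → 0 < x i) :
    ContDiffOn ℝ ∞ f Ω := by
  -- The family is that of all a-smooth functions on `Ω`. The partial derivative of a member is its
  -- b-derivative divided by the nonvanishing coefficient, hence again a member.
  refine contDiffOn_of_iterated_partial hΩ {f | ASmoothOn k f Ω} (fun f hf => hf.continuousOn)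
    (fun f hf i => ⟨fun x => (bCoef k i x)⁻¹ * ACorners.bDeriv k i f x, ?_, fun x hx => ?_⟩) hf
  · exact (aSmoothOn_inv_bCoef hΩ hpos i).mul (isModelOpen_of_isOpen hΩ hpos) (hf.bDeriv i)
  · have := ((hf []).exists_deriv x hx i (hpos x hx i)).hasLineDerivAt
    simp only [ACorners.bDeriv, inv_mul_cancel_left₀ (bCoef_ne_zero (hpos x hx i))]
    exact this

end Regularity

/-! ### The calculus of weak derivatives. -/

section WeakDerivatives

variable {m : ℕ} {Ω : Set (Fin m → ℝ)} {i : Fin m}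

theorem hasWeakPartial_zero : HasWeakPartial Ω i 0 0 :=
  ⟨locallyIntegrableOn_zero, locallyIntegrableOn_zero, by simp⟩

theorem HasWeakPartial.sum {ι : Type*} (s : Finset ι) {f v : ι → (Fin m → ℝ) → ℝ}
    (h : ∀ a ∈ s, HasWeakPartial Ω i (f a) (v a)) :
    HasWeakPartial Ω i (∑ a ∈ s, f a) (∑ a ∈ s, v a) := by
  classical
  induction s using Finset.induction_on with
  | empty => exact hasWeakPartial_zero
  | insert a s ha ih =>
    rw [Finset.sum_insert ha, Finset.sum_insert ha]
    exact (h a (by simp)).add (ih fun b hb => h b (by simp [hb]))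

theorem locallyIntegrableOn_continuousOn_mul {A f : (Fin m → ℝ) → ℝ} (hΩ : IsOpen Ω)
    (hf : LocallyIntegrableOn f Ω) (hA : ContinuousOn A Ω) :
    LocallyIntegrableOn (fun x => A x * f x) Ω :=
  hf.continuousOn_mul hA hΩ.isLocallyClosed

/-- The product rule for weak derivatives. -/
theorem HasWeakPartial.smooth_mul {A f v : (Fin m → ℝ) → ℝ} (hΩ : IsOpen Ω)
    (hA : ContDiffOn ℝ ∞ A Ω) (h : HasWeakPartial Ω i f v) :
    HasWeakPartial Ω i (fun x => A x * f x)
      (fun x => A x * v x + lineDeriv ℝ A x (Pi.single i 1) * f x) := by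
  have hdA : ∀ x ∈ Ω, DifferentiableAt ℝ A x := fun x hx =>
    (hA.contDiffAt (hΩ.mem_nhds hx)).differentiableAt (by simp)
  have hcA : ContinuousOn (fun x => lineDeriv ℝ A x (Pi.single i 1)) Ω := by
    refine ((hA.continuousOn_fderiv_of_isOpen hΩ (by simp)).clm_apply
      (continuousOn_const (c := (Pi.single i 1 : Fin m → ℝ)))).congr fun x hx => ?_
    exact (hdA x hx).lineDeriv_eq_fderiv
  have i1 := locallyIntegrableOn_continuousOn_mul hΩ h.1 hA.continuousOn
  have i2 := locallyIntegrableOn_continuousOn_mul hΩ h.2 hA.continuousOn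
  have i3 := locallyIntegrableOn_continuousOn_mul hΩ h.1 hcA
  refine ⟨i1, i2.add i3, fun φ hφ hc hs => ?_⟩
  obtain ⟨c1, c2⟩ := lineDeriv_test hφ i
  have z : ∀ x, x ∉ tsupport φ → φ x = 0 := fun x hx => image_eq_zero_of_notMem_tsupport hx
  -- The product `A * φ` serves as a test function for `f`. It is smooth on all of `ℝ^m` although
  -- `A` is smooth only on `Ω`, since near a point outside `Ω` the factor `φ` vanishes.
  have hψ : ContDiff ℝ ∞ fun x => A x * φ x := by
    rw [contDiff_iff_contDiffAt]
    intro x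
    by_cases hx : x ∈ Ω
    · exact (hA.contDiffAt (hΩ.mem_nhds hx)).mul hφ.contDiffAt
    · have hx' : x ∉ tsupport φ := fun h => hx (hs h)
      refine (contDiffAt_const (c := (0 : ℝ))).congr_of_eventuallyEq ?_
      filter_upwards [(isClosed_tsupport φ).isOpen_compl.mem_nhds hx'] with y hy
      rw [z y hy, mul_zero]
  have hsub : tsupport (fun x => A x * φ x) ⊆ tsupport φ :=
    closure_mono fun x hx hx0 => hx (by simp [hx0])
  have hψc : HasCompactSupport fun x => A x * φ x := hc.mono fun x hx hx0 => hx (by simp [hx0])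
  have key := h.3 _ hψ hψc (hsub.trans hs)
  -- The classical product rule for `A * φ` splits this integral into the wanted one and the term
  -- with the derivative of `A`, which goes to the other side.
  have e1 : ∫ x in Ω, f x * lineDeriv ℝ (fun x => A x * φ x) x (Pi.single i 1) =
      (∫ x in Ω, A x * f x * lineDeriv ℝ φ x (Pi.single i 1)) +
      ∫ x in Ω, lineDeriv ℝ A x (Pi.single i 1) * f x * φ x := by
    rw [← integral_add (integrableOn_mul_test i1 c1 hc hs c2)
      (integrableOn_mul_test i3 hφ.continuous hc hs z)]
    refine setIntegral_congr_fun hΩ.measurableSet fun x hx => ?_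
    have := (hasLineDerivAt_mul (hdA x hx).lineDifferentiableAt.hasLineDerivAt
      ((hφ.differentiable (by simp) x).lineDifferentiableAt
        (v := (Pi.single i 1 : Fin m → ℝ))).hasLineDerivAt).lineDeriv
    simp only [this]
    ring
  have e2 : ∫ x in Ω, (A x * v x + lineDeriv ℝ A x (Pi.single i 1) * f x) * φ x =
      (∫ x in Ω, v x * (A x * φ x)) + ∫ x in Ω, lineDeriv ℝ A x (Pi.single i 1) * f x * φ x := by
    have e3 : ∫ x in Ω, v x * (A x * φ x) = ∫ x in Ω, A x * v x * φ x :=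
      integral_congr_ae (Eventually.of_forall fun x => by simp only; ring)
    rw [e3, ← integral_add (integrableOn_mul_test i2 hφ.continuous hc hs z)
      (integrableOn_mul_test i3 hφ.continuous hc hs z)]
    exact integral_congr_ae (Eventually.of_forall fun x => by simp only; ring)
  rw [e2]
  rw [e1] at key
  linarith

end WeakDerivatives

/-! ### A-smoothness of determinants and inverse matrices. -/

section ASmoothMatrices

variable {m k : ℕ} {U : Set (Fin m → ℝ)}

theorem ASmoothOn.const_mul (hU : IsModelOpen k U) {f : (Fin m → ℝ) → ℝ} (hf : ASmoothOn k f U)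
    (c : ℝ) : ASmoothOn k (fun x => c * f x) U :=
  (aSmoothOn_const c).mul hU hf

theorem ASmoothOn.sub (hU : IsModelOpen k U) {f g : (Fin m → ℝ) → ℝ} (hf : ASmoothOn k f U)
    (hg : ASmoothOn k g U) : ASmoothOn k (fun x => f x - g x) U :=
  (hf.add hU (hg.const_mul hU (-1))).congr hU fun x _ => by ring

theorem ASmoothOn.prod (hU : IsModelOpen k U) {ι : Type*} (s : Finset ι)
    {f : ι → (Fin m → ℝ) → ℝ} (h : ∀ i ∈ s, ASmoothOn k (f i) U) :
    ASmoothOn k (fun x => ∏ i ∈ s, f i x) U := by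
  classical
  induction s using Finset.induction_on with
  | empty => simpa using aSmoothOn_const 1
  | insert i s hi ih =>
    simp only [Finset.prod_insert hi]
    exact (h i (by simp)).mul hU (ih fun j hj => h j (by simp [hj]))

theorem aSmoothOn_det (hU : IsModelOpen k U) {n : ℕ}
    {A : (Fin m → ℝ) → Matrix (Fin n) (Fin n) ℝ} (hA : ∀ i j, ASmoothOn k (fun x => A x i j) U) :
    ASmoothOn k (fun x => (A x).det) U := by
  simp only [Matrix.det_apply']
  exact ASmoothOn.sum hU _ fun σ _ => (aSmoothOn_const _).mul hU
    (ASmoothOn.prod hU _ fun i _ => hA _ _)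

theorem aSmoothOn_adjugate (hU : IsModelOpen k U) {n : ℕ}
    {A : (Fin m → ℝ) → Matrix (Fin n) (Fin n) ℝ} (hA : ∀ i j, ASmoothOn k (fun x => A x i j) U)
    (i j : Fin n) : ASmoothOn k (fun x => (A x).adjugate i j) U := by
  simp only [Matrix.adjugate_apply]
  refine aSmoothOn_det hU fun a b => ?_
  simp only [Matrix.updateRow_apply]
  split_ifs
  · exact aSmoothOn_const _
  · exact hA a b

/-- By Cramer's rule the inverse is the adjugate divided by the determinant, and both are polynomial
in the entries. It is applied to the b-metric, whose inverse enters the Christoffel symbols. -/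
theorem aSmoothOn_inv (hU : IsModelOpen k U) {n : ℕ}
    {A : (Fin m → ℝ) → Matrix (Fin n) (Fin n) ℝ} (hA : ∀ i j, ASmoothOn k (fun x => A x i j) U)
    (hdet : ∀ x ∈ U, (A x).det ≠ 0) (i j : Fin n) : ASmoothOn k (fun x => (A x)⁻¹ i j) U := by
  simp only [Matrix.inv_def, Ring.inverse_eq_inv', Matrix.smul_apply, smul_eq_mul]
  exact ((aSmoothOn_det hU hA).comp hU (φ := fun t => t⁻¹) fun x hx =>
    contDiffAt_inv ℝ (hdet x hx)).mul hU (aSmoothOn_adjugate hU hA i j)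

end ASmoothMatrices

/-! ### The coefficients of the connections are a-smooth up to the boundary. -/

section ConnectionCoefficients

variable {m r : ℕ} {X : Type*} [TopologicalSpace X] {M : AManifold m X} {E : AVectorBundle M r}

/-- Only b-derivatives of the components and the inverse of a matrix that is positive definite also
at boundary points occur, so nothing degenerates at the boundary. -/
theorem BMetric.aSmoothOn_christoffel (g : BMetric M) {c : AChart m X} (hc : c ∈ M.atlas)
    (l i j : Fin m) : ASmoothOn c.k (fun u => g.christoffel c u l i j) c.source := by
  have hU := c.modelOpen_source
  unfold BMetric.christoffel
  refine ASmoothOn.const_mul hU (ASmoothOn.sum hU _ fun q _ => ?_) _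
  refine (aSmoothOn_inv hU (g.smooth c hc) (fun u hu => (g.posDef c hc u hu).det_pos.ne') l q).mul
    hU (ASmoothOn.sub hU (ASmoothOn.add hU ?_ ?_) ?_)
  · exact (g.smooth c hc j q).bDeriv i
  · exact (g.smooth c hc i q).bDeriv j
  · exact (g.smooth c hc i j).bDeriv q

theorem AVectorBundle.smoothOn_basisSection {κ : VBChart m r E.Fiber} (hκ : κ ∈ E.atlas)
    (b : Fin r) : E.SmoothOn (κ.basisSection b) κ.chart.target :=
  fun κ' hκ' a => E.smooth_transition κ hκ κ' hκ' a b

/-- The local basis sections are a-smooth over the image of their chart, so their covariant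
derivatives are too; the connection matrices are the coordinates of these derivatives in the same
chart. -/
theorem BConnection.aSmoothOn_connForm (D : BConnection E) {κ : VBChart m r E.Fiber}
    (hκ : κ ∈ E.atlas) (i : Fin m) (a b : Fin r) :
    ASmoothOn κ.chart.k (fun u => D.connForm κ i u a b) κ.chart.source := by
  have h := D.smooth κ.chart (E.chart_mem κ hκ) i κ.chart.target κ.chart.isOpen_target _
    (AVectorBundle.smoothOn_basisSection hκ b) κ hκ a
  refine h.mono fun u hu => ⟨hu, ?_⟩
  rw [inter_self]
  exact κ.chart.map_source hu

end ConnectionCoefficients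

/-! ### Linear combinations of the components of a jet, and the change of connection. -/

section JetCombinations

variable {m r : ℕ} {X : Type*} [TopologicalSpace X] {M : AManifold m X} {E : AVectorBundle M r}

/-- The functions which are linear combinations, with a-smooth coefficients on the domain of the
chart `c`, of the components of order at most `N` of a jet. -/
inductive JetCombination (c : AChart m X) (N : ℕ) :
    ((∀ j, TComp r m j) → (Fin m → ℝ) → ℝ) → Prop
  | component {l : ℕ} (hl : l ≤ N) (J : TIdx r m l) : JetCombination c N fun t => t l J
  | zero : JetCombination c N fun _ _ => 0
  | add {P Q} (hP : JetCombination c N P) (hQ : JetCombination c N Q) :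
      JetCombination c N fun t u => P t u + Q t u
  | mul {A P} (hA : ASmoothOn c.k A c.source) (hP : JetCombination c N P) :
      JetCombination c N fun t u => A u * P t u

namespace JetCombination

variable {c : AChart m X} {N : ℕ} {P : (∀ j, TComp r m j) → (Fin m → ℝ) → ℝ}

theorem mono {N' : ℕ} (h : N ≤ N') (hP : JetCombination c N P) : JetCombination c N' P := by
  induction hP with
  | component hl J => exact component (hl.trans h) J
  | zero => exact zero
  | add _ _ hP hQ => exact add hP hQ
  | mul hA _ hP => exact mul hA hP

theorem sub {Q : (∀ j, TComp r m j) → (Fin m → ℝ) → ℝ} (hP : JetCombination c N P)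
    (hQ : JetCombination c N Q) : JetCombination c N fun t u => P t u - Q t u := by
  simpa [sub_eq_add_neg] using add hP (mul (aSmoothOn_const (-1)) hQ)

theorem sum {ι : Type*} (s : Finset ι) {P : ι → (∀ j, TComp r m j) → (Fin m → ℝ) → ℝ}
    (h : ∀ a ∈ s, JetCombination c N (P a)) :
    JetCombination c N fun t u => ∑ a ∈ s, P a t u := by
  classical
  induction s using Finset.induction_on with
  | empty => simpa using zero
  | insert a s ha ih =>
    simp only [Finset.sum_insert ha]
    exact add (h a (by simp)) (ih fun b hb => h b (by simp [hb]))

/-- Coefficients that are continuous on the open set `c.interior` preserve local integrability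
there. -/
theorem locallyIntegrableOn (hP : JetCombination c N P) {t : ∀ j, TComp r m j}
    (ht : ∀ j ≤ N, ∀ I, LocallyIntegrableOn (t j I) c.interior) :
    LocallyIntegrableOn (P t) c.interior := by
  induction hP with
  | component hl J => exact ht _ hl J
  | zero => exact locallyIntegrableOn_zero
  | add _ _ hP hQ => exact hP.add hQ
  | mul hA _ hP =>
    exact locallyIntegrableOn_continuousOn_mul c.isOpen_interior hP
      (hA.continuousOn.mono fun u hu => hu.1)

/-- The coefficients are continuous on the whole domain of the chart, so they are bounded on `K`
even where it meets the boundary. The constant comes before `t`: the estimate is uniform over all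
jets. -/
theorem exists_bound (hP : JetCombination c N P) {K : Set (Fin m → ℝ)} (hK : IsCompact K)
    (hKc : K ⊆ c.source) : ∃ C : ℝ, 0 ≤ C ∧ ∀ t, ∀ u ∈ K,
      |P t u| ≤ C * ∑ l ∈ Finset.range (N + 1), ‖fun J => t l J u‖ := by
  have h0 : ∀ (t : ∀ j, TComp r m j) (u : Fin m → ℝ),
      0 ≤ ∑ l ∈ Finset.range (N + 1), ‖fun J => t l J u‖ := fun t u =>
    Finset.sum_nonneg fun _ _ => norm_nonneg _
  induction hP with
  | @component l hl J =>
    refine ⟨1, zero_le_one, fun t u _ => ?_⟩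
    rw [one_mul]
    exact (norm_le_pi_norm (fun J => t l J u) J).trans
      (Finset.single_le_sum (f := fun l => ‖fun J => t l J u‖) (fun _ _ => norm_nonneg _)
        (Finset.mem_range.2 (Nat.lt_succ_of_le hl)))
  | zero => exact ⟨0, le_rfl, fun t u _ => by simp⟩
  | add _ _ hP hQ =>
    obtain ⟨C, hC, h1⟩ := hP
    obtain ⟨D, hD, h2⟩ := hQ
    refine ⟨C + D, add_nonneg hC hD, fun t u hu => (abs_add_le _ _).trans ?_⟩
    rw [add_mul]
    exact add_le_add (h1 t u hu) (h2 t u hu)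
  | mul hA _ hP =>
    obtain ⟨C, hC, h1⟩ := hP
    obtain ⟨B, hB⟩ := hK.exists_bound_of_continuousOn (hA.continuousOn.mono hKc)
    refine ⟨|B| * C, by positivity, fun t u hu => ?_⟩
    rw [abs_mul, mul_assoc]
    exact mul_le_mul ((hB u hu).trans (le_abs_self B)) (h1 t u hu) (abs_nonneg _) (abs_nonneg _)

/-- The zeroth order part of a covariant derivative has a-smooth coefficients, so it costs no order.
The metric and connection here need not be those which define the jet. -/
theorem connTerm (g : BMetric M) (D : BConnection E) {κ : VBChart m r E.Fiber} (hκ : κ ∈ E.atlas)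
    {j : ℕ} {P : TIdx r m j → (∀ j, TComp r m j) → (Fin m → ℝ) → ℝ}
    (hP : ∀ I, JetCombination κ.chart N (P I)) (i : Fin m) (I : TIdx r m j) :
    JetCombination κ.chart N fun t u => ACorners.connTerm g D κ i (fun I => P I t) I u := by
  unfold ACorners.connTerm
  refine sub (sum _ fun b _ => mul (D.aSmoothOn_connForm hκ i _ _) (hP _))
    (sum _ fun s _ => sum _ fun l _ => mul ?_ (hP _))
  exact g.aSmoothOn_christoffel (E.chart_mem κ hκ) _ _ _

/-- The derivative of a combination of components of a jet is a combination of one order more. -/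
theorem exists_derivative (g : BMetric M) (D : BConnection E) {κ : VBChart m r E.Fiber}
    (hκ : κ ∈ E.atlas) (hP : JetCombination κ.chart N P) (i : Fin m) :
    ∃ Q : (∀ j, TComp r m j) → (Fin m → ℝ) → ℝ, JetCombination κ.chart (N + 1) Q ∧
      ∀ k e t, N < k → IsWeakJet g D κ k e t →
        ∃ v, HasWeakPartial κ.chart.interior i (P t) v ∧
          ∀ᵐ u ∂volume.restrict κ.chart.interior, bCoef κ.chart.k i u * v u = Q t u := by
  induction hP with
  | @component l hl J =>
    -- The defining equation of the jet, solved for the b-derivative of a component.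
    refine ⟨fun t u => t (l + 1) (J.1, Fin.snoc J.2 i) u -
      ACorners.connTerm g D κ i (fun I => t l I) J u, ?_, fun k e t hk ht => ?_⟩
    · exact sub (component (Nat.succ_le_succ hl) _)
        (connTerm g D hκ (fun I => component (hl.trans N.le_succ) I) i J)
    · obtain ⟨v, hv, he⟩ := ht.succ l (hl.trans_lt hk) J i
      refine ⟨v, hv, ?_⟩
      filter_upwards [he] with u hu
      rw [hu]
      ring
  | zero =>
    exact ⟨_, zero, fun _ _ _ _ _ => ⟨0, hasWeakPartial_zero, by simp⟩⟩
  | add _ _ hP hQ =>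
    obtain ⟨P', hP', h1⟩ := hP
    obtain ⟨Q', hQ', h2⟩ := hQ
    refine ⟨_, add hP' hQ', fun k e t hk ht => ?_⟩
    obtain ⟨v, hv, hv'⟩ := h1 k e t hk ht
    obtain ⟨w, hw, hw'⟩ := h2 k e t hk ht
    refine ⟨_, hv.add hw, ?_⟩
    filter_upwards [hv', hw'] with u hu hu'
    rw [Pi.add_apply, mul_add, hu, hu']
  | @mul A P hA hP ih =>
    obtain ⟨Q, hQ, h1⟩ := ih
    -- The product rule `v_i (A P) = A (v_i P) + (v_i A) P`; the second term has order at most `N`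
    -- and is regarded as one of order `N + 1`.
    refine ⟨_, add (mul hA hQ) (mul (hA.bDeriv i) (hP.mono N.le_succ)), fun k e t hk ht => ?_⟩
    obtain ⟨v, hv, hv'⟩ := h1 k e t hk ht
    have hs := (hA.mono (V := κ.chart.interior) fun u hu => hu.1).contDiffOn
      κ.chart.isOpen_interior fun u hu => hu.2
    refine ⟨_, hv.smooth_mul κ.chart.isOpen_interior hs, ?_⟩
    filter_upwards [hv'] with u hu
    rw [← hu, bDeriv]
    ring

end JetCombination

/-- The covariant derivatives of a section for one choice of metric and connection are combinations
of those for another choice. -/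
theorem exists_jetTransform (g g' : BMetric M) (D D' : BConnection E) {κ : VBChart m r E.Fiber}
    (hκ : κ ∈ E.atlas) :
    ∃ T : ∀ j, TIdx r m j → (∀ j, TComp r m j) → (Fin m → ℝ) → ℝ,
      (∀ j I, JetCombination κ.chart j (T j I)) ∧
      ∀ k e t, IsWeakJet g D κ k e t → IsWeakJet g' D' κ k e fun j I => T j I t := by
  -- The b-derivative of every combination is fixed before any jet is given, so that the
  -- transformation is the same for all sections and all `k`.
  choose Q hQ hQ' using fun (N : ℕ) (P : (∀ j, TComp r m j) → (Fin m → ℝ) → ℝ)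
    (hP : JetCombination κ.chart N P) (i : Fin m) => hP.exists_derivative g D hκ i
  -- The recursion carries the proof that each component is a combination, since `Q` is defined only
  -- for such operators. The step is the covariant derivative for the new choice: the b-derivative
  -- `Q` of the previous components plus the connection term of `g'` and `D'`. The index of the new
  -- derivative is the last entry of the multi-index.
  let S : ∀ j, {P : TIdx r m j → (∀ j, TComp r m j) → (Fin m → ℝ) → ℝ //
      ∀ I, JetCombination κ.chart j (P I)} := fun j =>
    Nat.rec ⟨fun I t => t 0 I, fun I => .component le_rfl I⟩ (fun j P =>
      ⟨fun I t u => Q j _ (P.2 (I.1, Fin.init I.2)) (I.2 (Fin.last j)) t u +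
        connTerm g' D' κ (I.2 (Fin.last j)) (fun J => P.1 J t) (I.1, Fin.init I.2) u,
        fun I => .add (hQ _ _ _ _) ((JetCombination.connTerm g' D' hκ P.2 _ _).mono j.le_succ)⟩) j
  -- In order `0` the jet is left unchanged, so the condition on the components of `e` carries over.
  refine ⟨fun j => (S j).1, fun j => (S j).2, fun k e t ht => ⟨ht.zero, fun j hj I => ?_,
    fun j hj I i => ?_⟩⟩
  · exact ((S j).2 I).locallyIntegrableOn fun l hl => ht.locallyIntegrableOn l (hl.trans hj)
  · obtain ⟨v, hv, hv'⟩ := hQ' j _ ((S j).2 I) i k e t hj ht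
    refine ⟨v, hv, ?_⟩
    filter_upwards [hv'] with u hu
    rw [hu]
    have h1 : ∀ K : TIdx r m (j + 1), (S (j + 1)).1 K t u =
      Q j _ ((S j).2 (K.1, Fin.init K.2)) (K.2 (Fin.last j)) t u +
        connTerm g' D' κ (K.2 (Fin.last j)) (fun J => (S j).1 J t) (K.1, Fin.init K.2) u :=
      fun _ => rfl
    rw [h1]
    simp only [Fin.init_snoc, Fin.snoc_last]

end JetCombinations

/-! ### Uniform bounds for a continuous family of positive definite forms. -/

section QuadraticForms

variable {Y ι : Type*} [TopologicalSpace Y] [Fintype ι]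

theorem quadForm_smul (A : Matrix ι ι ℝ) (a : ℝ) (v : ι → ℝ) :
    ∑ I, ∑ J, A I J * (a • v) I * (a • v) J = a ^ 2 * ∑ I, ∑ J, A I J * v I * v J := by
  simp only [Finset.mul_sum, Pi.smul_apply, smul_eq_mul]
  exact Finset.sum_congr rfl fun I _ => Finset.sum_congr rfl fun J _ => by ring

/-- On the compact product of `K` and the unit sphere, the square root of the form is continuous and
positive, so both it and its reciprocal are bounded. Homogeneity extends the bounds to all vectors.
-/
theorem exists_sqrt_quadForm_bounds {K : Set Y} (hK : IsCompact K) {A : Y → Matrix ι ι ℝ}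
    (hA : ContinuousOn A K) (hpos : ∀ u ∈ K, (A u).PosDef) :
    ∃ C > 0, ∀ u ∈ K, ∀ v : ι → ℝ,
      √(∑ I, ∑ J, A u I J * v I * v J) ≤ C * ‖v‖ ∧
      ‖v‖ ≤ C * √(∑ I, ∑ J, A u I J * v I * v J) := by
  set q : Y × (ι → ℝ) → ℝ := fun z => √(∑ I, ∑ J, A z.1 I J * z.2 I * z.2 J) with hq
  have hS : IsCompact (K ×ˢ Metric.sphere (0 : ι → ℝ) 1) := hK.prod (isCompact_sphere _ _)
  have hqc : ContinuousOn q (K ×ˢ Metric.sphere (0 : ι → ℝ) 1) := by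
    refine ContinuousOn.sqrt (continuousOn_finsetSum _ fun I _ => continuousOn_finsetSum _
      fun J _ => ContinuousOn.mul (ContinuousOn.mul ?_ ?_) ?_)
    · exact (continuousOn_pi.1 (continuousOn_pi.1 hA I) J).comp continuousOn_fst fun z hz => hz.1
    · fun_prop
    · fun_prop
  have hqpos : ∀ z ∈ K ×ˢ Metric.sphere (0 : ι → ℝ) 1, 0 < q z := by
    rintro ⟨u, v⟩ ⟨hu, hv⟩
    have hv0 : v ≠ 0 := by
      rintro rfl
      simp at hv
    have := (hpos u hu).dotProduct_mulVec_pos hv0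
    refine Real.sqrt_pos.2 (this.trans_eq ?_)
    simp only [dotProduct, Matrix.mulVec, Finset.mul_sum, Pi.star_apply, star_trivial]
    exact Finset.sum_congr rfl fun I _ => Finset.sum_congr rfl fun J _ => by ring
  obtain ⟨B, hB⟩ := hS.exists_bound_of_continuousOn hqc
  obtain ⟨B', hB'⟩ := hS.exists_bound_of_continuousOn (hqc.inv₀ fun z hz => (hqpos z hz).ne')
  -- The `1` makes the constant positive even if the product with the sphere is empty and `B`, `B'`
  -- are arbitrary.
  refine ⟨max 1 (max B B'), lt_max_of_lt_left one_pos, fun u hu v => ?_⟩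
  by_cases hv : v = 0
  · simp [hv]
  have hn : 0 < ‖v‖ := norm_pos_iff.2 hv
  have hmem : (u, ‖v‖⁻¹ • v) ∈ K ×ˢ Metric.sphere (0 : ι → ℝ) 1 :=
    ⟨hu, by simp [norm_smul, hn.ne']⟩
  -- Reduction to the unit vector `v / ‖v‖`.
  have h1 : √(∑ I, ∑ J, A u I J * v I * v J) = ‖v‖ * q (u, ‖v‖⁻¹ • v) := by
    have h2 := quadForm_smul (A u) ‖v‖ (‖v‖⁻¹ • v)
    rw [smul_inv_smul₀ hn.ne'] at h2
    rw [h2, Real.sqrt_mul (sq_nonneg _), Real.sqrt_sq hn.le]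
  have hp := hqpos _ hmem
  have b1 := hB _ hmem
  have b2 := hB' _ hmem
  rw [Real.norm_of_nonneg hp.le] at b1
  rw [Pi.inv_apply, Real.norm_of_nonneg (inv_nonneg.2 hp.le)] at b2
  rw [h1]
  constructor
  · rw [mul_comm]
    gcongr
    exact b1.trans ((le_max_left _ _).trans (le_max_right _ _))
  · have b3 : (q (u, ‖v‖⁻¹ • v))⁻¹ ≤ max 1 (max B B') :=
      b2.trans ((le_max_right _ _).trans (le_max_right _ _))
    have b4 : 1 ≤ max 1 (max B B') * q (u, ‖v‖⁻¹ • v) := by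
      rwa [inv_le_iff_one_le_mul₀ hp] at b3
    nlinarith

end QuadraticForms

/-! ### Comparison of pointwise norms and volume densities on compact sets. -/

section TensorNorms

variable {m r : ℕ} {X : Type*} [TopologicalSpace X] {M : AManifold m X} {E : AVectorBundle M r}

/-- The frame is a linear isomorphism, so a nonzero coefficient vector is a nonzero element of the
fibre, on which the metric is positive. -/
theorem FibreMetric.posDef_comp (h : FibreMetric E) (κ : VBChart m r E.Fiber) (u : Fin m → ℝ) :
    (h.comp κ u).PosDef := by
  refine Matrix.PosDef.of_dotProduct_mulVec_pos (h.posSemidef_comp κ u).isHermitian fun x hx => ?_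
  set y := κ.chart.toPartialEquiv u
  have hy0 : (κ.frame y).symm x ≠ 0 := by simpa using hx
  have hy : (κ.frame y).symm x = ∑ a, x a • κ.basisSection a y := by
    simp only [VBChart.basisSection, ← map_smul, ← map_sum]
    rw [← pi_eq_sum_univ' x]
  refine (h.pos _ _ hy0).trans_eq ?_
  simp only [hy, dotProduct, Matrix.mulVec, FibreMetric.comp, Finset.mul_sum, map_sum, map_smul,
    LinearMap.sum_apply, LinearMap.smul_apply, smul_eq_mul, Matrix.of_apply, Pi.star_apply,
    star_trivial]
  rw [Finset.sum_comm]
  exact Finset.sum_congr rfl fun a _ => Finset.sum_congr rfl fun b _ => by ring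

/-- Multiplicativity of `H ⊗ K^{⊗j}`: a product of sums expands into a sum over multi-indices. With
`tensorPower_one`, it shows that the induced metric can be inverted factor by factor. -/
theorem tensorPower_mul {j : ℕ} (H H' : Matrix (Fin r) (Fin r) ℝ) (K K' : Matrix (Fin m) (Fin m) ℝ) :
    (Matrix.of fun I J : TIdx r m j => H I.1 J.1 * ∏ s, K (I.2 s) (J.2 s)) *
      (Matrix.of fun I J : TIdx r m j => H' I.1 J.1 * ∏ s, K' (I.2 s) (J.2 s)) =
    Matrix.of fun I J : TIdx r m j => (H * H') I.1 J.1 * ∏ s, (K * K') (I.2 s) (J.2 s) := by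
  ext I J
  simp only [Matrix.mul_apply, Matrix.of_apply]
  rw [Finset.prod_univ_sum, Fintype.piFinset_univ, Fintype.sum_prod_type, Finset.sum_mul_sum]
  refine Finset.sum_congr rfl fun a _ => Finset.sum_congr rfl fun b _ => ?_
  rw [Finset.prod_mul_distrib]
  ring

theorem tensorPower_one {j : ℕ} :
    (Matrix.of fun I J : TIdx r m j => (1 : Matrix (Fin r) (Fin r) ℝ) I.1 J.1 *
      ∏ s, (1 : Matrix (Fin m) (Fin m) ℝ) (I.2 s) (J.2 s)) = 1 := by
  ext I J
  simp only [Matrix.of_apply, Matrix.one_apply, Finset.prod_boole, Finset.mem_univ, forall_const]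
  by_cases h : I = J
  · simp [h]
  · rw [if_neg h]
    by_cases h1 : I.1 = J.1
    · rw [if_neg fun h2 => h (Prod.ext h1 (funext h2)), mul_zero]
    · rw [if_neg h1, zero_mul]

-- A positive semidefinite matrix is positive definite once it is invertible. Semidefiniteness comes
-- from factoring both metrics as in `sum_mul_prod_nonneg`, invertibility from the tensor product of
-- the inverse matrices.
open scoped MatrixOrder in
theorem posDef_tensorMetric (g : BMetric M) (h : FibreMetric E) {κ : VBChart m r E.Fiber}
    (hκ : κ ∈ E.atlas) (j : ℕ) {u : Fin m → ℝ} (hu : u ∈ κ.chart.source) :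
    (tensorMetric g h κ j u).PosDef := by
  have hH := h.posDef_comp κ u
  have hG := (g.posDef _ (E.chart_mem κ hκ) u hu).inv
  have hs : (tensorMetric g h κ j u).PosSemidef := by
    refine Matrix.PosSemidef.of_dotProduct_mulVec_nonneg ?_ fun t => ?_
    · ext I J
      simp only [tensorMetric, Matrix.conjTranspose_apply, Matrix.of_apply, star_trivial]
      congr 1
      · exact h.symm _ _ _
      · exact Finset.prod_congr rfl fun s _ => hG.isHermitian.apply _ _
    · refine (sum_mul_prod_nonneg hH.posSemidef hG.posSemidef t).trans_eq ?_
      simp only [dotProduct, Matrix.mulVec, Finset.mul_sum, Pi.star_apply, star_trivial,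
        tensorMetric, Matrix.of_apply]
      exact Finset.sum_congr rfl fun I _ => Finset.sum_congr rfl fun J _ => by ring
  -- The double inverse occurs because the tensor factors for `ᵇT*X` are already given by the
  -- inverse of `g`.
  refine hs.posDef_iff_isUnit.2 (IsUnit.of_mul_eq_one (Matrix.of fun I J : TIdx r m j =>
    (h.comp κ u)⁻¹ I.1 J.1 * ∏ s, (g.comp κ.chart u)⁻¹⁻¹ (I.2 s) (J.2 s)) ?_)
  rw [tensorMetric, tensorPower_mul, Matrix.mul_nonsing_inv _ ((Matrix.isUnit_iff_isUnit_det _).1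
    hH.isUnit), Matrix.mul_nonsing_inv _ ((Matrix.isUnit_iff_isUnit_det _).1 hG.isUnit),
    tensorPower_one]

theorem continuousOn_tensorMetric (g : BMetric M) (h : FibreMetric E) {κ : VBChart m r E.Fiber}
    (hκ : κ ∈ E.atlas) (j : ℕ) : ContinuousOn (tensorMetric g h κ j) κ.chart.source := by
  refine continuousOn_pi.2 fun I => continuousOn_pi.2 fun J => ?_
  refine ContinuousOn.mul (h.smooth κ hκ I.1 J.1).continuousOn
    (continuousOn_finsetProd _ fun s _ => ?_)
  exact continuousOn_pi.1 (continuousOn_pi.1 (g.continuousOn_inv (E.chart_mem κ hκ)) _) _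

/-- On compact sets the pointwise norms are equivalent to a norm of the components. -/
theorem exists_tensorNorm_bounds (g : BMetric M) (h : FibreMetric E) {κ : VBChart m r E.Fiber}
    (hκ : κ ∈ E.atlas) (j : ℕ) {K : Set (Fin m → ℝ)} (hK : IsCompact K)
    (hKs : K ⊆ κ.chart.source) :
    ∃ C > 0, ∀ u ∈ K, ∀ t : TComp r m j,
      tensorNorm g h κ j t u ≤ C * ‖fun I => t I u‖ ∧
      ‖fun I => t I u‖ ≤ C * tensorNorm g h κ j t u := by
  obtain ⟨C, hC, hb⟩ := exists_sqrt_quadForm_bounds hK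
    ((continuousOn_tensorMetric g h hκ j).mono hKs)
    fun u hu => posDef_tensorMetric g h hκ j (hKs hu)
  exact ⟨C, hC, fun u hu t => hb u hu fun I => t I u⟩

theorem tensorNorm_nonneg (g : BMetric M) (h : FibreMetric E) (κ : VBChart m r E.Fiber) {j : ℕ}
    (t : TComp r m j) (u : Fin m → ℝ) : 0 ≤ tensorNorm g h κ j t u := Real.sqrt_nonneg _

/-- Each density may be unbounded near the boundary, but its singular factor depends only on the
chart. It cancels, and the quotient of the determinants is continuous up to the boundary. -/
theorem exists_density_bound (g g' : BMetric M) {c : AChart m X} (hc : c ∈ M.atlas)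
    {K : Set (Fin m → ℝ)} (hK : IsCompact K) (hKs : K ⊆ c.source) :
    ∃ C > 0, ∀ u ∈ K, u ∈ c.interior → g'.density c u ≤ C * g.density c u := by
  have hdet : ∀ g : BMetric M, ContinuousOn (fun u => √(g.comp c u).det) K := fun g =>
    (((Continuous.matrix_det continuous_id).comp_continuousOn
      (g.continuousOn_comp hc)).mono hKs).sqrt
  have hpos : ∀ u ∈ K, 0 < √(g.comp c u).det := fun u hu =>
    Real.sqrt_pos.2 (g.posDef c hc u (hKs hu)).det_pos
  obtain ⟨B, hB⟩ := hK.exists_bound_of_continuousOn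
    ((hdet g').div (hdet g) fun u hu => (hpos u hu).ne')
  refine ⟨max 1 B, lt_max_of_lt_left one_pos, fun u hu hui => ?_⟩
  have h1 : √(g'.comp c u).det ≤ max 1 B * √(g.comp c u).det := by
    have := (le_abs_self _).trans ((hB u hu).trans (le_max_right 1 B))
    rwa [Pi.div_apply, div_le_iff₀ (hpos u hu)] at this
  unfold BMetric.density
  rw [← mul_assoc]
  refine mul_le_mul_of_nonneg_right h1 (Finset.prod_nonneg fun i _ => inv_nonneg.2 ?_)
  unfold bCoef
  split_ifs with hi
  · exact (hui.2 i hi).le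
  · exact zero_le_one

/-- The pointwise estimate between the norms of a combination of the components of a jet and those of
the components, for different metrics. -/
theorem JetCombination.exists_tensorNorm_le (g g' : BMetric M) (h h' : FibreMetric E)
    {κ : VBChart m r E.Fiber} (hκ : κ ∈ E.atlas) {j N : ℕ}
    {T : TIdx r m j → (∀ j, TComp r m j) → (Fin m → ℝ) → ℝ}
    (hT : ∀ I, JetCombination κ.chart N (T I)) {K : Set (Fin m → ℝ)} (hK : IsCompact K)
    (hKs : K ⊆ κ.chart.source) :
    ∃ C > 0, ∀ u ∈ K, ∀ t, tensorNorm g' h' κ j (fun I => T I t) u ≤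
      C * ∑ l ∈ Finset.range (N + 1), tensorNorm g h κ l (t l) u := by
  obtain ⟨A, hA, h1⟩ := exists_tensorNorm_bounds g' h' hκ j hK hKs
  choose B hB h2 using fun l => exists_tensorNorm_bounds g h hκ l hK hKs
  choose C hC h3 using fun I => (hT I).exists_bound hK hKs
  -- A single constant that dominates every `B l` with `l ≤ N`.
  set b := ∑ l ∈ Finset.range (N + 1), B l with hb
  have hb0 : 0 < b := Finset.sum_pos (fun l _ => hB l) (by simp)
  have hc0 : 0 ≤ ∑ I, C I := Finset.sum_nonneg fun I _ => hC I
  -- The factors pass in turn from the new norm to the sup norm of the combinations, from there to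
  -- the sup norms of the jet, and back to the old norms. The sum dominates each `C I`, and the `1`
  -- keeps the constant positive if that sum is zero.
  refine ⟨A * ((∑ I, C I + 1) * b), by positivity, fun u hu t => (h1 u hu _).1.trans ?_⟩
  rw [mul_assoc]
  refine mul_le_mul_of_nonneg_left ?_ hA.le
  have h4 : ∑ l ∈ Finset.range (N + 1), ‖fun J => t l J u‖ ≤
      b * ∑ l ∈ Finset.range (N + 1), tensorNorm g h κ l (t l) u := by
    rw [Finset.mul_sum]
    refine Finset.sum_le_sum fun l hl => ((h2 l u hu _).2).trans ?_
    exact mul_le_mul_of_nonneg_right (Finset.single_le_sum (fun l _ => (hB l).le) hl)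
      (tensorNorm_nonneg _ _ _ _ _)
  have h5 : 0 ≤ ∑ l ∈ Finset.range (N + 1), ‖fun J => t l J u‖ :=
    Finset.sum_nonneg fun _ _ => norm_nonneg _
  calc ‖fun I => T I t u‖ ≤ (∑ I, C I + 1) * ∑ l ∈ Finset.range (N + 1), ‖fun J => t l J u‖ := by
        refine (pi_norm_le_iff_of_nonneg (by positivity)).2 fun I => (h3 I t u hu).trans ?_
        refine mul_le_mul_of_nonneg_right ?_ h5
        linarith [Finset.single_le_sum (fun I _ => hC I) (Finset.mem_univ I)]
    _ ≤ _ := by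
        rw [mul_assoc]
        exact mul_le_mul_of_nonneg_left h4 (by positivity)

end TensorNorms

/-! ### Integration of the pointwise estimates over the pieces. -/

section IntegralEstimates

variable {m r : ℕ} {X : Type*} [TopologicalSpace X] {M : AManifold m X} {E : AVectorBundle M r}

theorem AVectorBundle.Pieces.isCompact_coordinates (P : E.Pieces) (n : Fin P.card) :
    IsCompact ((P.triv n).chart.toPartialEquiv.symm '' P.compact n) :=
  (P.isCompact n).image_of_continuousOn
    ((P.triv n).chart.continuousOn_invFun.mono (P.subset n))

theorem AVectorBundle.Pieces.coordinates_subset (P : E.Pieces) (n : Fin P.card) :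
    (P.triv n).chart.toPartialEquiv.symm '' P.compact n ⊆ (P.triv n).chart.source := by
  rintro _ ⟨x, hx, rfl⟩
  exact (P.triv n).chart.map_target (P.subset n hx)

/-- The domain lies in the intersection of an open set and a compact set. That intersection is
measurable, so measurability of the domain itself need not be established. -/
theorem AVectorBundle.Pieces.ae_mem (P : E.Pieces) (n : Fin P.card) :
    ∀ᵐ u ∂volume.restrict (P.domain n), u ∈ (P.triv n).chart.interior ∧
      u ∈ (P.triv n).chart.toPartialEquiv.symm '' P.compact n := by
  have hsub : P.domain n ⊆ (P.triv n).chart.interior ∩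
      (P.triv n).chart.toPartialEquiv.symm '' P.compact n := fun u hu =>
    ⟨hu.1, _, hu.2.1, (P.triv n).chart.left_inv hu.1.1⟩
  exact ae_mono (Measure.restrict_mono hsub le_rfl) (ae_restrict_mem
    ((P.triv n).chart.isOpen_interior.measurableSet.inter
      (P.isCompact_coordinates n).isClosed.measurableSet))

/-- The integrand of the `p`-th power of the norm is compared pointwise, density included. One
constant serves all pieces, since there are finitely many, and all jets, of which no regularity is
asked at this stage. -/
theorem AVectorBundle.Pieces.exists_pointwise_le (P : E.Pieces) (g g' : BMetric M)
    (h h' : FibreMetric E) {p : ℝ} (hp : 1 ≤ p) {j N : ℕ}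
    {T : Fin P.card → TIdx r m j → (∀ j, TComp r m j) → (Fin m → ℝ) → ℝ}
    (hT : ∀ n I, JetCombination (P.triv n).chart N (T n I)) :
    ∃ C : ℝ≥0, 0 < C ∧ ∀ n, ∀ u ∈ (P.triv n).chart.interior,
      u ∈ (P.triv n).chart.toPartialEquiv.symm '' P.compact n → ∀ t,
      ENNReal.ofReal (tensorNorm g' h' (P.triv n) j (fun I => T n I t) u ^ p *
          g'.density (P.triv n).chart u) ≤
        C * ∑ l ∈ Finset.range (N + 1), ENNReal.ofReal
          (tensorNorm g h (P.triv n) l (t l) u ^ p * g.density (P.triv n).chart u) := by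
  have hp0 : 0 ≤ p := zero_le_one.trans hp
  choose A hA h1 using fun n => JetCombination.exists_tensorNorm_le g g' h h' (P.triv_mem n) (hT n)
    (P.isCompact_coordinates n) (P.coordinates_subset n)
  choose B hB h2 using fun n => exists_density_bound g g' (E.chart_mem _ (P.triv_mem n))
    (P.isCompact_coordinates n) (P.coordinates_subset n)
  -- The factors come from the pointwise norms, from the power mean inequality for `N + 1` summands,
  -- and from the densities.
  set c : Fin P.card → ℝ := fun n => A n ^ p * ((N + 1 : ℕ) : ℝ) ^ (p - 1) * B n with hc
  have hc0 : ∀ n, 0 ≤ c n := fun n => by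
    have := (hA n).le
    have := (hB n).le
    positivity
  have hpt : ∀ n, ∀ u ∈ (P.triv n).chart.interior,
      u ∈ (P.triv n).chart.toPartialEquiv.symm '' P.compact n → ∀ t,
      tensorNorm g' h' (P.triv n) j (fun I => T n I t) u ^ p * g'.density (P.triv n).chart u ≤
        c n * ∑ l ∈ Finset.range (N + 1),
          tensorNorm g h (P.triv n) l (t l) u ^ p * g.density (P.triv n).chart u := by
    intro n u hui hu t
    have hs : 0 ≤ ∑ l ∈ Finset.range (N + 1), tensorNorm g h (P.triv n) l (t l) u :=
      Finset.sum_nonneg fun _ _ => tensorNorm_nonneg _ _ _ _ _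
    have e1 := Real.rpow_le_rpow (tensorNorm_nonneg _ _ _ _ _) (h1 n u hu t) hp0
    rw [Real.mul_rpow (hA n).le hs] at e1
    -- Convexity of the `p`-th power: the power of a sum of orders is bounded by the sum of the
    -- powers. This is where `1 ≤ p` enters.
    have e2 := Real.rpow_sum_le_const_mul_sum_rpow_of_nonneg (Finset.range (N + 1)) hp
      (f := fun l => tensorNorm g h (P.triv n) l (t l) u) fun _ _ => tensorNorm_nonneg _ _ _ _ _
    rw [Finset.card_range] at e2
    have e3 := h2 n u hu hui
    have hA' : 0 ≤ A n ^ p := Real.rpow_nonneg (hA n).le p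
    calc _ ≤ (A n ^ p * (((N + 1 : ℕ) : ℝ) ^ (p - 1) *
          ∑ l ∈ Finset.range (N + 1), tensorNorm g h (P.triv n) l (t l) u ^ p)) *
          (B n * g.density (P.triv n).chart u) :=
        mul_le_mul (e1.trans (mul_le_mul_of_nonneg_left e2 hA')) e3 (g'.density_nonneg _ hui)
          (mul_nonneg hA' (mul_nonneg (by positivity)
            (Finset.sum_nonneg fun _ _ => Real.rpow_nonneg (tensorNorm_nonneg _ _ _ _ _) p)))
      _ = _ := by
        rw [← Finset.sum_mul, hc]
        ring
  have hsum0 : 0 ≤ ∑ n, c n := Finset.sum_nonneg fun n _ => hc0 n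
  -- The sum dominates each `c n`; the `1` makes the constant positive even if there are no pieces.
  refine ⟨Real.toNNReal (∑ n, c n + 1), Real.toNNReal_pos.2 (by linarith), fun n u hui hu t => ?_⟩
  have hn : ∀ l ∈ Finset.range (N + 1), 0 ≤
      tensorNorm g h (P.triv n) l (t l) u ^ p * g.density (P.triv n).chart u := fun l _ =>
    mul_nonneg (Real.rpow_nonneg (tensorNorm_nonneg _ _ _ _ _) p) (g.density_nonneg _ hui)
  rw [← ENNReal.ofReal_sum_of_nonneg hn, ← ENNReal.ofReal, ← ENNReal.ofReal_mul (by linarith)]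
  refine ENNReal.ofReal_le_ofReal ((hpt n u hui hu t).trans ?_)
  refine mul_le_mul_of_nonneg_right ?_ (Finset.sum_nonneg hn)
  linarith [Finset.single_le_sum (fun n _ => hc0 n) (Finset.mem_univ n)]

/-- Integrates the pointwise estimate. Local integrability of the jet is needed only for
measurability, so that the integral of the sum over the orders is the sum of the integrals. -/
theorem AVectorBundle.Pieces.exists_normIntegral_le (P : E.Pieces) (g g' : BMetric M)
    (h h' : FibreMetric E) {p : ℝ} (hp : 1 ≤ p) {j N : ℕ}
    {T : Fin P.card → TIdx r m j → (∀ j, TComp r m j) → (Fin m → ℝ) → ℝ}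
    (hT : ∀ n I, JetCombination (P.triv n).chart N (T n I)) :
    ∃ C : ℝ≥0, 0 < C ∧ ∀ t : Fin P.card → ∀ j, TComp r m j,
      (∀ n, ∀ l ≤ N, ∀ I, LocallyIntegrableOn (t n l I) (P.triv n).chart.interior) →
      P.normIntegral g' h' p j (fun n I => T n I (t n)) ≤
        C * ∑ l ∈ Finset.range (N + 1), P.normIntegral g h p l fun n => t n l := by
  obtain ⟨C, hC, hle⟩ := P.exists_pointwise_le g g' h h' hp hT
  refine ⟨C, hC, fun t ht => ?_⟩
  unfold AVectorBundle.Pieces.normIntegral AVectorBundle.Pieces.integral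
  rw [Finset.sum_comm, Finset.mul_sum]
  refine Finset.sum_le_sum fun n _ => ?_
  have hm : ∀ l ∈ Finset.range (N + 1), AEMeasurable (fun u => ENNReal.ofReal
      (tensorNorm g h (P.triv n) l (t n l) u ^ p * g.density (P.triv n).chart u))
      (volume.restrict (P.domain n)) := fun l hl =>
    (aemeasurable_norm g h (P.triv_mem n) (ht n l (Nat.lt_succ_iff.1 (Finset.mem_range.1 hl)))
      p).mono_measure (P.restrict_le n)
  rw [← lintegral_finsetSum' _ hm, ← lintegral_const_mul' _ _ ENNReal.coe_ne_top]
  refine lintegral_mono_ae ?_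
  filter_upwards [P.ae_mem n] with u hu using hle n u hu.1 hu.2 (t n)

/-- A jet for one choice is transformed into a jet for the other, in every chart of the bundle and
not only in those of the chosen cover. -/
theorem weaklyDifferentiable_iff (g g' : BMetric M) (D D' : BConnection E) (k : ℕ)
    (e : E.InteriorSection) :
    E.WeaklyDifferentiable g D k e ↔ E.WeaklyDifferentiable g' D' k e := by
  have key : ∀ (g g' : BMetric M) (D D' : BConnection E),
      E.WeaklyDifferentiable g D k e → E.WeaklyDifferentiable g' D' k e := by
    intro g g' D D' he κ hκ
    obtain ⟨t, ht⟩ := he κ hκ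
    obtain ⟨T, -, hT⟩ := exists_jetTransform g g' D D' hκ
    exact ⟨_, hT k e t ht⟩
  exact ⟨key g g' D D', key g' g D' D⟩

end IntegralEstimates

/-! ### One-sided inequalities between norms for two choices. -/

section NormEstimates

variable {m r : ℕ} {X : Type*} [TopologicalSpace X] [T2Space X] [CompactSpace X]
  {M : AManifold m X} {E : AVectorBundle M r}

/-- The estimate is the case of order zero, with the components themselves as combinations. Only one
summand occurs, so no integrals have to be added: the inequality holds for every section, measurable
or not. -/
theorem exists_lpNorm_le (g g' : BMetric M) (h h' : FibreMetric E) {p : ℝ} (hp : 1 < p) :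
    ∃ C : ℝ≥0, 0 < C ∧ ∀ e, lpNorm g' h' p e ≤ C * lpNorm g h p e := by
  obtain ⟨C, hC, hle⟩ := E.pieces.exists_pointwise_le g g' h h' hp.le (j := 0) (N := 0)
    (T := fun _ I t => t 0 I) fun n I => .component le_rfl I
  have hp0 : 0 ≤ 1 / p := by positivity
  refine ⟨C ^ (1 / p), NNReal.rpow_pos hC, fun e => ?_⟩
  rw [ENNReal.coe_rpow_of_nonneg _ hp0, lpNorm, lpNorm, ← ENNReal.mul_rpow_of_nonneg _ _ hp0]
  refine ENNReal.rpow_le_rpow ?_ hp0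
  unfold AVectorBundle.Pieces.normIntegral AVectorBundle.Pieces.integral
  rw [Finset.mul_sum]
  refine Finset.sum_le_sum fun n _ => ?_
  rw [← lintegral_const_mul' _ _ ENNReal.coe_ne_top]
  refine lintegral_mono_ae ?_
  filter_upwards [E.pieces.ae_mem n] with u hu
  have := hle n u hu.1 hu.2 fun l I u => (E.pieces.triv n).interiorCoords e u I.1
  rwa [Finset.sum_range_one] at this

/-- Every jet admitted in the infimum for the first choice is carried by `T` to one admitted for the
second, with controlled integrals. If there are none, the right side is infinite and the inequality
is vacuous. -/
theorem exists_sobolevNorm_le (g g' : BMetric M) (h h' : FibreMetric E) (D D' : BConnection E)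
    {p : ℝ} (hp : 1 < p) (k : ℕ) :
    ∃ C : ℝ≥0, 0 < C ∧ ∀ e, sobolevNorm g' h' D' p k e ≤ C * sobolevNorm g h D p k e := by
  choose T hT hjet using fun n => exists_jetTransform g g' D D' (E.pieces.triv_mem n)
  choose C hC hle using fun j => E.pieces.exists_normIntegral_le g g' h h' hp.le
    (T := fun n => T n j) fun n I => hT n j I
  have hp0 : 0 ≤ 1 / p := by positivity
  set c : ℝ≥0 := ∑ j ∈ Finset.range (k + 1), C j with hc
  have hc0 : 0 < c := Finset.sum_pos (fun j _ => hC j) (by simp)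
  refine ⟨c ^ (1 / p), NNReal.rpow_pos hc0, fun e => ?_⟩
  rw [ENNReal.coe_rpow_of_nonneg _ hp0, sobolevNorm, sobolevNorm,
    ← ENNReal.mul_rpow_of_nonneg _ _ hp0]
  refine ENNReal.rpow_le_rpow ?_ hp0
  -- The constant is nonzero and finite, so it can be moved inside the infimum, including an infimum
  -- over an empty set.
  rw [ENNReal.mul_iInf_of_ne (by exact_mod_cast hc0.ne') ENNReal.coe_ne_top]
  refine le_iInf fun t => ?_
  rw [ENNReal.mul_iInf_of_ne (by exact_mod_cast hc0.ne') ENNReal.coe_ne_top]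
  refine le_iInf fun ht => ?_
  refine (iInf₂_le (fun n j I => T n j I (t n)) fun n => hjet n k e (t n) (ht n)).trans ?_
  rw [hc, ENNReal.ofNNReal_finsetSum, Finset.sum_mul]
  -- The estimate for order `j` involves the orders `l ≤ j`; enlarging this range to all `l ≤ k`
  -- gives the same sum for every `j`, and the constants `C j` add up to `c`.
  refine Finset.sum_le_sum fun j hj => ?_
  have hjk : j ≤ k := Nat.lt_succ_iff.1 (Finset.mem_range.1 hj)
  refine (hle j t fun n l hl I => (ht n).locallyIntegrableOn l (hl.trans hjk) I).trans ?_
  gcongr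

end NormEstimates

/-! ### Equivalent norms give the same topological subspace. -/

section NormTopologies

variable {V : Type*}

theorem equivalentNorms_of_le {N N' : V → ℝ≥0∞}
    (h : ∃ C : ℝ≥0, 0 < C ∧ ∀ v, N' v ≤ C * N v) (h' : ∃ C : ℝ≥0, 0 < C ∧ ∀ v, N v ≤ C * N' v) :
    EquivalentNorms N N' := by
  obtain ⟨C, hC, h⟩ := h
  obtain ⟨C', -, h'⟩ := h'
  refine ⟨max C C', lt_max_of_lt_left hC, fun v => ⟨(h v).trans ?_, (h' v).trans ?_⟩⟩
  · gcongr
    exact le_max_left _ _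
  · gcongr
    exact le_max_right _ _

variable [AddCommGroup V] [Module ℝ V]

/-- If `N'` is bounded by `C * N`, the `N`-ball of radius `ε / C` lies in the `N'`-ball of radius
`ε`. No norm axiom is involved, and for `C = 0` the radius is infinite, which is harmless. -/
theorem isOpen_normTopology_of_le {S : Submodule ℝ V} {N N' : V → ℝ≥0∞} {C : ℝ≥0}
    (h : ∀ v, N' v ≤ C * N v) {U : Set S} (hU : IsOpen[normTopology S N'] U) :
    IsOpen[normTopology S N] U := by
  intro x hx
  obtain ⟨ε, hε, hb⟩ := hU x hx
  refine ⟨ε / C, ENNReal.div_pos hε.ne' ENNReal.coe_ne_top, fun y hy => hb y ?_⟩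
  exact (h _).trans_lt (ENNReal.mul_lt_of_lt_div' hy)

theorem topSubspace_eq_of_equivalentNorms {S S' : Submodule ℝ V} {N N' : V → ℝ≥0∞} (hS : S = S')
    (h : EquivalentNorms N N') :
    (⟨S, normTopology S N⟩ : TopSubspace V) = ⟨S', normTopology S' N'⟩ := by
  subst hS
  obtain ⟨C, -, h⟩ := h
  congr 1
  exact TopologicalSpace.ext (funext fun U => propext
    ⟨isOpen_normTopology_of_le fun v => (h v).2, isOpen_normTopology_of_le fun v => (h v).1⟩)

end NormTopologies

/-! ### Independence of the choices for the unweighted spaces. -/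

section Independence

variable {m r : ℕ} {X : Type*} [TopologicalSpace X] [T2Space X] [CompactSpace X]
  {M : AManifold m X} {E : AVectorBundle M r}

/-- Local integrability does not refer to the metrics, and finiteness of the norm passes through the
inequality; the roles of the two choices are then exchanged. -/
theorem lpSections_eq (g g' : BMetric M) (h h' : FibreMetric E) (p : ℝ) (hp : 1 < p) :
    lpSections g h p hp = lpSections g' h' p hp := by
  have key : ∀ (g g' : BMetric M) (h h' : FibreMetric E),
      lpSections g h p hp ≤ lpSections g' h' p hp := by
    rintro g g' h h' e ⟨h1, h2⟩
    obtain ⟨C, -, hle⟩ := exists_lpNorm_le g g' h h' hp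
    exact ⟨h1, (hle e).trans_lt (ENNReal.mul_lt_top ENNReal.coe_lt_top h2)⟩
  exact le_antisymm (key g g' h h') (key g' g h' h)

theorem sobolevSections_eq (g g' : BMetric M) (h h' : FibreMetric E) (D D' : BConnection E) (p : ℝ)
    (hp : 1 < p) (k : ℕ) : sobolevSections g h D p hp k = sobolevSections g' h' D' p hp k := by
  have key : ∀ (g g' : BMetric M) (h h' : FibreMetric E) (D D' : BConnection E),
      sobolevSections g h D p hp k ≤ sobolevSections g' h' D' p hp k := by
    rintro g g' h h' D D' e ⟨h1, h2⟩
    obtain ⟨C, -, hle⟩ := exists_sobolevNorm_le g g' h h' D D' hp k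
    exact ⟨(weaklyDifferentiable_iff g g' D D' k e).1 h1,
      (hle e).trans_lt (ENNReal.mul_lt_top ENNReal.coe_lt_top h2)⟩
  exact le_antisymm (key g g' h h' D D') (key g' g h' h D' D)

/-- The inequality holds for all sections over the interior, including those of infinite norm, so it
descends to classes without any restriction to the space. -/
theorem equivalentNorms_lpNormAE (g g' : BMetric M) (h h' : FibreMetric E) {p : ℝ} (hp : 1 < p) :
    EquivalentNorms (lpNormAE g h p) (lpNormAE g' h' p) := by
  have key : ∀ (g g' : BMetric M) (h h' : FibreMetric E),
      ∃ C : ℝ≥0, 0 < C ∧ ∀ q : E.AESection, lpNormAE g' h' p q ≤ C * lpNormAE g h p q := by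
    intro g g' h h'
    obtain ⟨C, hC, hle⟩ := exists_lpNorm_le g g' h h' hp
    exact ⟨C, hC, fun q => Quotient.inductionOn' q hle⟩
  exact equivalentNorms_of_le (key g g' h h') (key g' g h' h)

theorem equivalentNorms_sobolevNormAE (g g' : BMetric M) (h h' : FibreMetric E)
    (D D' : BConnection E) {p : ℝ} (hp : 1 < p) (k : ℕ) :
    EquivalentNorms (sobolevNormAE g h D p k) (sobolevNormAE g' h' D' p k) := by
  have key : ∀ (g g' : BMetric M) (h h' : FibreMetric E) (D D' : BConnection E), ∃ C : ℝ≥0, 0 < C ∧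
      ∀ q : E.AESection, sobolevNormAE g' h' D' p k q ≤ C * sobolevNormAE g h D p k q := by
    intro g g' h h' D D'
    obtain ⟨C, hC, hle⟩ := exists_sobolevNorm_le g g' h h' D D' hp k
    exact ⟨C, hC, fun q => Quotient.inductionOn' q hle⟩
  exact equivalentNorms_of_le (key g g' h h' D D') (key g' g h' h D' D)

theorem lpSpace_eq (g g' : BMetric M) (h h' : FibreMetric E) (p : ℝ) (hp : 1 < p) :
    lpSpace g h p hp = lpSpace g' h' p hp :=
  topSubspace_eq_of_equivalentNorms (congrArg _ (lpSections_eq g g' h h' p hp))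
    (equivalentNorms_lpNormAE g g' h h' hp)

theorem sobolevSpace_eq (g g' : BMetric M) (h h' : FibreMetric E) (D D' : BConnection E) (p : ℝ)
    (hp : 1 < p) (k : ℕ) : sobolevSpace g h D p hp k = sobolevSpace g' h' D' p hp k :=
  topSubspace_eq_of_equivalentNorms (congrArg _ (sobolevSections_eq g g' h h' D D' p hp k))
    (equivalentNorms_sobolevNormAE g g' h h' D D' hp k)

theorem EquivalentNorms.comp {V V' : Type*} {N N' : V → ℝ≥0∞} (h : EquivalentNorms N N')
    (f : V' → V) : EquivalentNorms (fun v => N (f v)) fun v => N' (f v) := by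
  obtain ⟨C, hC, h⟩ := h
  exact ⟨C, hC, fun v => h (f v)⟩

end Independence

end ACorners

theorem lemma5p1 {m r : ℕ} {X : Type*} [TopologicalSpace X] [T2Space X]
    [SecondCountableTopology X] [CompactSpace X] (M : AManifold m X) (E : AVectorBundle M r)
    (w : Weight M) (p : ℝ) (hp : 1 < p) (k : ℕ) :
    -- the Lebesgue space of `E`
    (∀ (g g' : BMetric M) (h h' : FibreMetric E),
      lpSpace g h p hp = lpSpace g' h' p hp ∧
      EquivalentNorms (lpNormAE g h p) (lpNormAE g' h' p)) ∧
    -- the Sobolev space of `E`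
    (∀ (g g' : BMetric M) (h h' : FibreMetric E) (D D' : BConnection E),
      sobolevSpace g h D p hp k = sobolevSpace g' h' D' p hp k ∧
      EquivalentNorms (sobolevNormAE g h D p k) (sobolevNormAE g' h' D' p k)) ∧
    -- the weighted Lebesgue space of `E`
    (∀ (g g' : BMetric M) (h h' : FibreMetric (E.twist w)),
      weightedLpSpace g h p hp = weightedLpSpace g' h' p hp ∧
      EquivalentNorms (weightedLpNorm g h p) (weightedLpNorm g' h' p)) ∧
    -- the weighted Sobolev space of `E`
    (∀ (g g' : BMetric M) (h h' : FibreMetric (E.twist w)) (D D' : BConnection (E.twist w)),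
      weightedSobolevSpace g h D p hp k = weightedSobolevSpace g' h' D' p hp k ∧
      EquivalentNorms (weightedSobolevNorm g h D p k) (weightedSobolevNorm g' h' D' p k)) := by
  refine ⟨fun g g' h h' => ⟨lpSpace_eq g g' h h' p hp, equivalentNorms_lpNormAE g g' h h' hp⟩,
    fun g g' h h' D D' => ⟨sobolevSpace_eq g g' h h' D D' p hp k,
      equivalentNorms_sobolevNormAE g g' h h' D D' hp k⟩,
    fun g g' h h' => ⟨?_, (equivalentNorms_lpNormAE g g' h h' hp).comp (E.twistAESection w)⟩,
    fun g g' h h' D D' => ⟨?_,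
      (equivalentNorms_sobolevNormAE g g' h h' D D' hp k).comp (E.twistAESection w)⟩⟩
  -- Inverse images of equal subspaces with topology are equal, so the unweighted statement for
  -- `E.twist w` suffices.
  · rw [weightedLpSpace, weightedLpSpace, lpSpace_eq g g' h h' p hp]
  · rw [weightedSobolevSpace, weightedSobolevSpace, sobolevSpace_eq g g' h h' D D' p hp k]
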